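/- Let $X=[0,1]$ with Lebesgue measure $m$, and let $\|\cdot\|$ denote the norm of $L^1=L^1(X,m;\mathbb{C})$. For $h\in L^1$ let $\mathrm{var}(h)=\sup\left|\int_X\varphi' h\,dm\right|$, the supremum over compactly supported $C^1$ functions $\varphi$ on $\mathbb{R}$ with $|\varphi|\le 1$ (the variation of $h\cdot 1_X$ over $\mathbb{R}$). Let $BV=\{h\in L^1:\mathrm{var}(h)<\infty\}$, with norm $\mathrm{var}(h)+\|h\|$. Let $f:X\to X$ be piecewise expanding: there is a finite partition of $X$ into nondegenerate intervals $X_j$ such that each $f|_{X_j}$ extends to a $C^2$ diffeomorphism of $\overline{X_j}$ onto its image, and some iterate satisfies $\inf|(f^k)'|>1$, the infimum over the points where the derivative exists. A turning point is a point of $X$ where the derivative of $f$ (one-sided at $0$ and $1$) does not exist. Assume that $f$ has no periodic turning points; here, at a discontinuity, both one-sided limits of $f$ count as values of $f$, i.e. for no turning point $c$ is there a chain $c=x_0,x_1,\dots,x_n=c$ with $n\ge1$ and every $x_{i+1}$ a one-sided limit of $f$ at $x_i$. Let $E\subset(0,\infty)$, and for $\varepsilon\in E$ let $Q_\varepsilon(x,A)$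 be transition probabilities on $X$ which map $m$ to an absolutely continuous measure, and so act on $L^1$ by $\int_A Q_\varepsilon h\,dm=\int Q_\varepsilon(x,A)h(x)\,dm(x)$. Suppose that for all $\varepsilon\in E$ and all real-valued $h\in BV$: 1. (locality) $Q_\varepsilon(x,A)=0$ whenever $\mathrm{dist}(x,A)>\varepsilon$; 2. (smallness) $\|Q_\varepsilon h-h\|\le d_\varepsilon\,\mathrm{var}(h)$, where $d_\varepsilon\to0$ as $\varepsilon\to0$; 3. (regularity) $\mathrm{var}(Q_\varepsilon h)\le\mathrm{var}(h)+C\|h\|$, where $C$ does not depend on $\varepsilon$ or $h$. Let $P_f$ be the Perron–Frobenius operator, $\int_A P_f h\,dm=\int_{f^{-1}A}h\,dm$, and let $P_\varepsilon=Q_\varepsilon P_f$. Let $\theta$ be the essential spectral radius of $P_f$ on $BV$, i.e. the smallest $\theta\ge0$ such that all elements of the spectrum of $P_f$ on $BV$ of modulus greater than $\theta$ are isolated eigenvalues of finite multiplicity. Let $\tilde\theta>\theta$. For $\varepsilon\in E$ let $r_\varepsilon\in\mathbb{C}$ be an eigenvalue of $P_\varepsilon$ with $|r_\varepsilon|>\tilde\theta$,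 and let $h_\varepsilon\in BV$ be an eigenfunction, $P_\varepsilon h_\varepsilon=r_\varepsilon h_\varepsilon$, with $\|h_\varepsilon\|=1$. Let $r$ be an accumulation point of $(r_\varepsilon)$ as $\varepsilon\to0$ in $E$. Then there are a sequence $\varepsilon_k\to0$ in $E$ and a function $h\in BV$, $h\ne0$, such that $r_{\varepsilon_k}\to r$, $\|h_{\varepsilon_k}-h\|\to0$ and $P_f h=rh$. In particular, $r$ is an eigenvalue of $P_f$ on $BV$. -/

import Mathlib

open MeasureTheory ProbabilityTheory Filter Topology
open scoped unitInterval ENNReal NNReal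

noncomputable section

namespace RandomPerturbation

/-! ### Functions of bounded variation on the unit interval -/

/-- The complex space `L¹` of the unit interval `X = [0,1]` with Lebesgue measure. -/
abbrev L1 : Type := Lp ℂ 1 (volume : Measure I)

/-- The variation of `h · 1_X` over the real line: the supremum of `|∫_X φ' h dx|` over all
compactly supported `C¹` functions `φ` on `ℝ` with `|φ| ≤ 1`. -/
def var (h : L1) : ℝ≥0∞ :=
  ⨆ (φ : ℝ → ℂ) (_ : ContDiff ℝ 1 φ ∧ HasCompactSupport φ ∧ ∀ t, ‖φ t‖ ≤ 1),
    ‖∫ x : I, deriv φ (x : ℝ) * h x‖ₑ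

theorem integrable_test {φ : ℝ → ℂ} (hφ : ContDiff ℝ 1 φ) (h : L1) :
    Integrable (fun x : I => deriv φ (x : ℝ) * h x) := by
  have hc : Continuous (fun x : I => deriv φ (x : ℝ)) :=
    (hφ.continuous_deriv le_rfl).comp continuous_subtype_val
  obtain ⟨B, hB⟩ := isCompact_univ.exists_bound_of_continuousOn hc.continuousOn
  exact (L1.integrable_coeFn h).bdd_mul hc.aestronglyMeasurable
    (ae_of_all _ fun x => hB x (Set.mem_univ x))

theorem le_var {φ : ℝ → ℂ} (hφ : ContDiff ℝ 1 φ) (hs : HasCompactSupport φ)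
    (hb : ∀ t, ‖φ t‖ ≤ 1) (h : L1) :
    ‖∫ x : I, deriv φ (x : ℝ) * h x‖ₑ ≤ var h :=
  le_iSup₂_of_le φ ⟨hφ, hs, hb⟩ le_rfl

theorem var_zero : var 0 = 0 := by
  refine le_antisymm (iSup₂_le fun φ hφ => ?_) bot_le
  have : (fun x : I => deriv φ (x : ℝ) * (0 : L1) x) =ᵐ[volume] fun _ => 0 := by
    filter_upwards [Lp.coeFn_zero ℂ 1 (volume : Measure I)] with x hx
    rw [hx, Pi.zero_apply, mul_zero]
  rw [integral_congr_ae this]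
  simp

theorem var_add_le (h g : L1) : var (h + g) ≤ var h + var g := by
  refine iSup₂_le fun φ hφ => ?_
  have : (fun x : I => deriv φ (x : ℝ) * (h + g : L1) x) =ᵐ[volume]
      fun x => deriv φ (x : ℝ) * h x + deriv φ (x : ℝ) * g x := by
    filter_upwards [Lp.coeFn_add h g] with x hx
    rw [hx, Pi.add_apply, mul_add]
  rw [integral_congr_ae this, integral_add (integrable_test hφ.1 h) (integrable_test hφ.1 g)]
  exact (enorm_add_le _ _).trans
    (add_le_add (le_var hφ.1 hφ.2.1 hφ.2.2 h) (le_var hφ.1 hφ.2.1 hφ.2.2 g))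

theorem var_smul_le (c : ℂ) (h : L1) : var (c • h) ≤ ‖c‖ₑ * var h := by
  refine iSup₂_le fun φ hφ => ?_
  have : (fun x : I => deriv φ (x : ℝ) * (c • h : L1) x) =ᵐ[volume]
      fun x => c * (deriv φ (x : ℝ) * h x) := by
    filter_upwards [Lp.coeFn_smul c h] with x hx
    simp only [hx, Pi.smul_apply, smul_eq_mul]
    ring
  rw [integral_congr_ae this, integral_const_mul, enorm_mul]
  gcongr
  exact le_var hφ.1 hφ.2.1 hφ.2.2 h

/-- The space `BV` of functions of bounded variation. -/
def BV : Submodule ℂ L1 where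
  carrier := {h | var h < ∞}
  zero_mem' := by simp [var_zero]
  add_mem' {h g} hh hg := (var_add_le h g).trans_lt (ENNReal.add_lt_top.2 ⟨hh, hg⟩)
  smul_mem' c h hh := (var_smul_le c h).trans_lt (ENNReal.mul_lt_top enorm_lt_top hh)

/-- The norm of `BV`: variation plus `L¹` norm. -/
def bvNorm (h : L1) : ℝ := (var h).toReal + ‖h‖

/-! ### Operators on `BV` and their essential spectral radius -/

/-- `r` is an eigenvalue of `T` on `BV` with eigenfunction `h`. -/
def IsEigenpair (T : Module.End ℂ L1) (r : ℂ) (h : L1) : Prop :=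
  h ∈ BV ∧ h ≠ 0 ∧ T h = r • h

/-- The spectrum of `T` as an operator on the Banach space `BV`: the complement of the set of
those `z` for which `z - T` is a bijection of `BV` onto `BV` with bounded inverse. -/
def bvSpectrum (T : Module.End ℂ L1) : Set ℂ :=
  {z | Set.BijOn (fun h : L1 => z • h - T h) BV BV ∧
    ∃ K : ℝ, ∀ h ∈ BV, bvNorm h ≤ K * bvNorm (z • h - T h)}ᶜ

/-- `z` is an isolated eigenvalue of finite (algebraic) multiplicity of `T` on `BV`: an isolated
point of the spectrum and an eigenvalue such that, for some `k ≥ 1`, the space `BV` is the direct sum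
of the finite-dimensional kernel of `(T - z)ᵏ` (the spectral subspace of `z`) and of the range of
`(T - z)ᵏ`. -/
def IsIsolatedEigenvalue (T : Module.End ℂ L1) (z : ℂ) : Prop :=
  z ∈ bvSpectrum T ∧ ¬ AccPt z (𝓟 (bvSpectrum T)) ∧
  (∃ h, IsEigenpair T z h) ∧
  ∃ k : ℕ, 1 ≤ k ∧
    let N : Submodule ℂ L1 := LinearMap.ker ((T - algebraMap ℂ _ z) ^ k) ⊓ BV
    let R : Submodule ℂ L1 := BV.map ((T - algebraMap ℂ _ z) ^ k)
    FiniteDimensional ℂ N ∧ N ⊓ R = ⊥ ∧ N ⊔ R = BV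

/-- The essential spectral radius of `T` on `BV`: the smallest `θ ≥ 0` such that all elements of
the spectrum outside the disk of radius `θ` are isolated eigenvalues of finite multiplicity. -/
def essSpectralRadius (T : Module.End ℂ L1) : ℝ≥0∞ :=
  sInf {θ | ∀ z ∈ bvSpectrum T, θ < ‖z‖ₑ → IsIsolatedEigenvalue T z}

/-! ### Transfer operators of transition probabilities -/

/-- A transition probability `κ` is nonsingular if it maps Lebesgue measure to an absolutely
continuous measure. -/
def IsNonsingular (κ : Kernel I I) : Prop :=
  ∀ A : Set I, MeasurableSet A → volume A = 0 → ∀ᵐ x : I, κ x A = 0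

/-- `κ` transports the complex measure with density `h` to the one with density `g`:
`∫_A g = ∫ κ(x, A) h(x) dx` for all measurable `A`. -/
def IsTransfer (κ : Kernel I I) (h g : L1) : Prop :=
  ∀ A : Set I, MeasurableSet A → ∫ y in A, g y = ∫ x : I, ((κ x).real A : ℂ) * h x

theorem measurable_kernel_real (κ : Kernel I I) {A : Set I} (hA : MeasurableSet A) :
    Measurable (fun x => (κ x).real A) :=
  (κ.measurable_coe hA).ennreal_toReal

theorem integrable_kernel_mul (κ : Kernel I I) [IsMarkovKernel κ] {A : Set I}
    (hA : MeasurableSet A) {h : I → ℂ} (hh : Integrable h) :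
    Integrable (fun x : I => ((κ x).real A : ℂ) * h x) := by
  refine hh.bdd_mul (c := 1)
    (Complex.measurable_ofReal.comp (measurable_kernel_real κ hA)).aestronglyMeasurable
    (ae_of_all _ fun x => ?_)
  simp only [Complex.norm_real, Real.norm_eq_abs, abs_of_nonneg measureReal_nonneg]
  exact measureReal_le_one

theorem integrable_kernel_mul_real (κ : Kernel I I) [IsMarkovKernel κ] {A : Set I}
    (hA : MeasurableSet A) {h : I → ℝ} (hh : Integrable h) :
    Integrable (fun x : I => (κ x).real A * h x) := by
  refine hh.bdd_mul (c := 1) (measurable_kernel_real κ hA).aestronglyMeasurable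
    (ae_of_all _ fun x => ?_)
  rw [Real.norm_eq_abs, abs_of_nonneg measureReal_nonneg]
  exact measureReal_le_one

theorem exists_transfer_nonneg {κ : Kernel I I} [IsMarkovKernel κ] (hκ : IsNonsingular κ)
    {u : I → ℝ} (hu : Integrable u) (hu0 : ∀ x, 0 ≤ u x) :
    ∃ g : I → ℝ, Integrable g ∧ ∀ A : Set I, MeasurableSet A →
      ∫ y in A, g y = ∫ x : I, (κ x).real A * u x := by
  set μ : Measure I := volume.withDensity fun x => ENNReal.ofReal (u x) with hμ
  have hfin : IsFiniteMeasure μ := isFiniteMeasure_withDensity_ofReal hu.2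
  have hac : μ.bind κ ≪ (volume : Measure I) := by
    refine Measure.AbsolutelyContinuous.mk fun A hA hA0 => ?_
    rw [Measure.bind_apply hA κ.aemeasurable]
    have h1 : ∀ᵐ x ∂μ, κ x A = 0 := (withDensity_absolutelyContinuous _ _) (hκ A hA hA0)
    rw [lintegral_congr_ae h1]
    simp
  have hfin' : IsFiniteMeasure (μ.bind κ) := by infer_instance
  refine ⟨fun y => ((μ.bind κ).rnDeriv volume y).toReal, Measure.integrable_toReal_rnDeriv,
    fun A hA => ?_⟩
  rw [Measure.setIntegral_toReal_rnDeriv hac, measureReal_def,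
    Measure.bind_apply hA κ.aemeasurable,
    lintegral_withDensity_eq_lintegral_mul₀ hu.1.aemeasurable.ennreal_ofReal
      (κ.measurable_coe hA).aemeasurable,
    integral_eq_lintegral_of_nonneg_ae
      (ae_of_all _ fun x => mul_nonneg measureReal_nonneg (hu0 x))
      (integrable_kernel_mul_real κ hA hu).1]
  congr 1
  refine lintegral_congr fun x => ?_
  simp only [Pi.mul_apply]
  rw [ENNReal.ofReal_mul measureReal_nonneg, measureReal_def,
    ENNReal.ofReal_toReal (measure_ne_top _ _), mul_comm]

theorem exists_transfer_real {κ : Kernel I I} [IsMarkovKernel κ] (hκ : IsNonsingular κ)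
    {u : I → ℝ} (hu : Integrable u) :
    ∃ g : I → ℝ, Integrable g ∧ ∀ A : Set I, MeasurableSet A →
      ∫ y in A, g y = ∫ x : I, (κ x).real A * u x := by
  obtain ⟨g₁, hg₁, h₁⟩ := exists_transfer_nonneg hκ hu.pos_part (fun x => le_max_right _ _)
  obtain ⟨g₂, hg₂, h₂⟩ := exists_transfer_nonneg hκ hu.neg_part (fun x => le_max_right _ _)
  refine ⟨g₁ - g₂, hg₁.sub hg₂, fun A hA => ?_⟩
  simp only [Pi.sub_apply]
  rw [integral_sub hg₁.integrableOn hg₂.integrableOn, h₁ A hA, h₂ A hA,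
    ← integral_sub (integrable_kernel_mul_real κ hA hu.pos_part)
      (integrable_kernel_mul_real κ hA hu.neg_part)]
  refine integral_congr_ae (ae_of_all _ fun x => ?_)
  simp only
  rw [← mul_sub]
  congr 1
  rcases le_total 0 (u x) with h | h
  · rw [max_eq_left h, max_eq_right (neg_nonpos.2 h), sub_zero]
  · rw [max_eq_right h, max_eq_left (neg_nonneg.2 h), zero_sub, neg_neg]

theorem exists_transfer {κ : Kernel I I} [IsMarkovKernel κ] (hκ : IsNonsingular κ) (h : L1) :
    ∃ g : L1, IsTransfer κ h g := by
  have hh := L1.integrable_coeFn h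
  obtain ⟨g₁, hg₁, h₁⟩ := exists_transfer_real hκ hh.re
  obtain ⟨g₂, hg₂, h₂⟩ := exists_transfer_real hκ hh.im
  have c₁ : Integrable (fun y => (g₁ y : ℂ)) := hg₁.ofReal
  have c₂ : Integrable (fun y => (g₂ y : ℂ) * Complex.I) := hg₂.ofReal.mul_const _
  have hG : Integrable (fun y => (g₁ y : ℂ) + (g₂ y : ℂ) * Complex.I) := c₁.add c₂
  refine ⟨hG.toL1 _, fun A hA => ?_⟩
  have d₁ : Integrable (fun x : I => (((κ x).real A * RCLike.re (h x) : ℝ) : ℂ)) :=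
    (integrable_kernel_mul_real κ hA hh.re).ofReal
  have d₂ : Integrable (fun x : I => (((κ x).real A * RCLike.im (h x) : ℝ) : ℂ) * Complex.I) :=
    (integrable_kernel_mul_real κ hA hh.im).ofReal.mul_const _
  rw [integral_congr_ae (ae_restrict_of_ae hG.coeFn_toL1),
    integral_add c₁.integrableOn c₂.integrableOn,
    integral_mul_const, integral_complex_ofReal, integral_complex_ofReal, h₁ A hA, h₂ A hA,
    ← integral_complex_ofReal, ← integral_complex_ofReal, ← integral_mul_const,
    ← integral_add d₁ d₂]
  refine integral_congr_ae (ae_of_all _ fun x => ?_)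
  simp only [RCLike.re_to_complex, RCLike.im_to_complex]
  conv_rhs => rw [← Complex.re_add_im (h x)]
  push_cast
  ring

theorem IsTransfer.unique {κ : Kernel I I} {h g g' : L1} (hg : IsTransfer κ h g)
    (hg' : IsTransfer κ h g') : g = g' := by
  refine Lp.ext ((L1.integrable_coeFn g).ae_eq_of_forall_setIntegral_eq _ _
    (L1.integrable_coeFn g') fun A hA _ => ?_)
  rw [hg A hA, hg' A hA]

theorem IsTransfer.add {κ : Kernel I I} [IsMarkovKernel κ] {h h' g g' : L1}
    (hg : IsTransfer κ h g) (hg' : IsTransfer κ h' g') : IsTransfer κ (h + h') (g + g') := by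
  intro A hA
  rw [integral_congr_ae (ae_restrict_of_ae (Lp.coeFn_add g g'))]
  simp only [Pi.add_apply]
  rw [integral_add (L1.integrable_coeFn g).integrableOn (L1.integrable_coeFn g').integrableOn,
    hg A hA, hg' A hA, ← integral_add (integrable_kernel_mul κ hA (L1.integrable_coeFn h))
      (integrable_kernel_mul κ hA (L1.integrable_coeFn h'))]
  refine integral_congr_ae ?_
  filter_upwards [Lp.coeFn_add h h'] with x hx
  rw [hx, Pi.add_apply, mul_add]

theorem IsTransfer.smul {κ : Kernel I I} {h g : L1} (c : ℂ)
    (hg : IsTransfer κ h g) : IsTransfer κ (c • h) (c • g) := by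
  intro A hA
  rw [integral_congr_ae (ae_restrict_of_ae (Lp.coeFn_smul c g))]
  simp only [Pi.smul_apply, smul_eq_mul]
  rw [integral_const_mul, hg A hA, ← integral_const_mul]
  refine integral_congr_ae ?_
  filter_upwards [Lp.coeFn_smul c h] with x hx
  simp only [hx, Pi.smul_apply, smul_eq_mul]
  ring

open Classical in
/-- The action `h ↦ κ h` of a nonsingular transition probability on densities, the linear operator
on `L¹` with `∫_A κ h = ∫ κ(x, A) h(x) dx` (and `0` if `κ` is not nonsingular). -/
def transferOp (κ : Kernel I I) [IsMarkovKernel κ] : Module.End ℂ L1 :=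
  if hκ : IsNonsingular κ then
    { toFun := fun h => (exists_transfer hκ h).choose
      map_add' := fun h h' => (exists_transfer hκ (h + h')).choose_spec.unique
        ((exists_transfer hκ h).choose_spec.add (exists_transfer hκ h').choose_spec)
      map_smul' := fun c h => (exists_transfer hκ (c • h)).choose_spec.unique
        ((exists_transfer hκ h).choose_spec.smul c) }
  else 0

theorem isTransfer_transferOp {κ : Kernel I I} [IsMarkovKernel κ] (hκ : IsNonsingular κ)
    (h : L1) : IsTransfer κ h (transferOp κ h) := by
  rw [transferOp, dif_pos hκ]
  exact (exists_transfer hκ h).choose_spec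

/-- The Perron–Frobenius operator `P_f`, characterised by `∫_A P_f h = ∫_{f⁻¹ A} h`. -/
def perronFrobenius (f : I → I) (hf : Measurable f) : Module.End ℂ L1 :=
  transferOp (Kernel.deterministic f hf)

/-! ### Piecewise expanding maps -/

/-- A self-map of `[0,1]` as a real function of a real variable; only its values on `[0,1]`
are ever used. -/
def realMap (f : I → I) (t : ℝ) : ℝ := f (Set.projIcc 0 1 zero_le_one t)

/-- `f` has a (finite) derivative at the point `x` of `[0,1]` (one-sided at `0` and `1`). -/
def HasDerivativeAt (f : I → I) (x : I) : Prop :=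
  DifferentiableWithinAt ℝ (realMap f) (Set.Icc 0 1) x

/-- The derivative of `f` at `x`. -/
def derivative (f : I → I) (x : I) : ℝ := derivWithin (realMap f) (Set.Icc 0 1) x

/-- `f` is piecewise `C²`: there is a finite partition of `[0,1]` into nondegenerate intervals `J`
such that `f` restricted to `J` extends to a `C²` diffeomorphism of the closure of `J` onto its
image, i.e. to a `C²` function `g` with nowhere vanishing derivative there. -/
def IsPiecewiseC2 (f : I → I) : Prop :=
  ∃ Z : Finset (Set I),
    (Z : Set (Set I)).PairwiseDisjoint id ∧ (⋃ J ∈ Z, J) = Set.univ ∧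
    ∀ J ∈ Z, J.OrdConnected ∧ J.Nontrivial ∧
      ∃ g : ℝ → ℝ, ContDiff ℝ 2 g ∧ (∀ x ∈ closure J, deriv g (x : ℝ) ≠ 0) ∧
        ∀ x ∈ J, (f x : ℝ) = g x

/-- The expanding constant `λ_f`, the infimum of `|f'|`. -/
def expandingConst (f : I → I) : ℝ :=
  sInf ((fun x => |derivative f x|) '' {x | HasDerivativeAt f x})

/-- `f` is piecewise expanding: piecewise `C²` with `λ_{fᵏ} > 1` for some iterate `fᵏ`. -/
def IsPiecewiseExpanding (f : I → I) : Prop :=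
  IsPiecewiseC2 f ∧ ∃ k : ℕ, 1 < expandingConst (f^[k])

/-- The turning points of `f`: the points where the derivative is not well defined. -/
def turningPoints (f : I → I) : Set I := {c | ¬ HasDerivativeAt f c}

/-- `y` is a one-sided limit of `f` at `x`. If `f` is continuous at `x` this means `y = f x`; at a
discontinuity `f` is regarded as taking both one-sided limits as values. -/
def OneSidedValue (f : I → I) (x y : I) : Prop :=
  (0 < x ∧ Tendsto f (𝓝[<] x) (𝓝 y)) ∨ (x < 1 ∧ Tendsto f (𝓝[>] x) (𝓝 y))

/-- The periodic turning points of `f`: those turning points from which one can return to the same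
point in `n ≥ 1` steps, each step going from a point to a one-sided value of `f` at it. -/
def periodicTurningPoints (f : I → I) : Set I :=
  {c ∈ turningPoints f | Relation.TransGen (OneSidedValue f) c c}

/-! ### Small random perturbations -/

/-- The assumptions on the transition probabilities `Q_ε`, `ε ∈ E`, where `E` is a set of positive
parameters: they act on densities and satisfy locality, smallness and regularity. The last two
conditions are imposed on real functions of bounded variation only. -/
structure IsSmallPerturbation (E : Set ℝ) (Q : ℝ → Kernel I I) [∀ ε, IsMarkovKernel (Q ε)] :
    Prop where
  nonsingular : ∀ ε ∈ E, IsNonsingular (Q ε)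
  locality : ∀ ε ∈ E, ∀ (x : I) (A : Set I), MeasurableSet A →
    ε < Metric.infDist x A → Q ε x A = 0
  smallness : ∃ d : ℝ → ℝ≥0, Tendsto d (𝓝[E] 0) (𝓝 0) ∧
    ∀ ε ∈ E, ∀ h ∈ BV, (∀ᵐ x, (h x).im = 0) → ‖transferOp (Q ε) h - h‖ₑ ≤ d ε * var h
  regularity : ∃ C : ℝ≥0, ∀ ε ∈ E, ∀ h ∈ BV, (∀ᵐ x, (h x).im = 0) →
    var (transferOp (Q ε) h) ≤ var h + C * ‖h‖ₑ

/-- The transition operator `P_ε = Q_ε P_f` of the randomly perturbed map. -/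
def perturbedOp (f : I → I) (hf : Measurable f) (κ : Kernel I I) [IsMarkovKernel κ] :
    Module.End ℂ L1 :=
  transferOp κ ∘ₗ perronFrobenius f hf

end RandomPerturbation

end

open RandomPerturbation

/-!
The eigenfunctions `h_ε` are compact in `L¹` as soon as their variations are bounded uniformly in `ε`
(Helly's selection principle, `exists_tendsto_subseq_of_bvar_le`), and smallness then turns
`P_ε h_ε = r_ε h_ε` into `P_f h = r h` in the limit. Since `P_ε^N h_ε = r_ε^N h_ε` and `|r_ε| > θt`, the
uniform bound follows from a Lasota–Yorke inequality `var (P_ε^N h) ≤ a var h + B ‖h‖` whose constants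
do not depend on `ε`, with `a < θt^N` for some `N`.

The inequality is local (`LocalBound`): a partition of unity at a fixed scale, `exists_localisation`,
splits `h` into pieces concentrated near finitely many points. While a piece stays away from the turning
points, `P_f` divides its variation by the slope, up to a small factor and a multiple of the `L¹` norm,
and `Q_ε` moves its support by at most `ε` and does not increase its variation, up to a multiple of
the `L¹` norm. At a turning point the piece is cut into a left and a right part, which move along
different branches. Each part has at most the variation of the whole, so the bound at most picks up a
constant factor. As no turning point is periodic, a pseudo-orbit meets each turning point at most once,
and there are boundedly many such factors (`Branches.exists_localBound`).

Along the orbit segments between turning points, one needs that the reciprocal slope of `fⁿ` is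
`O(βⁿ)` with `β < θt` (`Branches.exists_inv_slope_le`). The definition of the essential spectral
radius yields a number `m` such that every `m + 1` functions in `BV` have a nontrivial combination `h`
with `var (P_fⁿ h) = O(βⁿ)` (`exists_decay_of_essSpectralRadius_lt`). Applied to the indicators of
`m + 1` tiny disjoint intervals near a point, on which `fⁿ` is injective, this bounds the height of
`P_fⁿ h` on the image of the interval with the largest coefficient, a height equal to that coefficient
divided by the slope.
-/

noncomputable section

namespace RandomPerturbation

/-! ### Variation and test functions -/

/-- The variation as a real number; it is only meaningful on `BV`. -/
def bvar (h : L1) : ℝ := (var h).toReal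

theorem bvar_nonneg (h : L1) : 0 ≤ bvar h := ENNReal.toReal_nonneg

theorem mem_BV_of_bound {h : L1} {K : ℝ}
    (hK : ∀ φ : ℝ → ℂ, ContDiff ℝ 1 φ → HasCompactSupport φ → (∀ t, ‖φ t‖ ≤ 1) →
      ‖∫ x : I, deriv φ (x : ℝ) * h x‖ ≤ K) : h ∈ BV ∧ bvar h ≤ K := by
  have hv : var h ≤ ENNReal.ofReal K := by
    refine iSup₂_le fun φ hφ => ?_
    rw [← ofReal_norm]
    exact ENNReal.ofReal_le_ofReal (hK φ hφ.1 hφ.2.1 hφ.2.2)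
  have hK0 : 0 ≤ K := by
    refine (norm_nonneg _).trans (hK (fun _ => 0) contDiff_const HasCompactSupport.zero ?_)
    simp
  exact ⟨hv.trans_lt ENNReal.ofReal_lt_top, ENNReal.toReal_le_of_le_ofReal hK0 hv⟩

theorem norm_integral_deriv_le {h : L1} (hh : h ∈ BV) {φ : ℝ → ℂ} (hφ : ContDiff ℝ 1 φ)
    (hs : HasCompactSupport φ) {M : ℝ} (hM : 0 < M) (hb : ∀ t, ‖φ t‖ ≤ M) :
    ‖∫ x : I, deriv φ (x : ℝ) * h x‖ ≤ M * bvar h := by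
  have hM' : (M : ℂ) ≠ 0 := by exact_mod_cast hM.ne'
  have h1 := le_var (φ := fun t => (M : ℂ)⁻¹ * φ t) (contDiff_const.mul hφ) hs.mul_left
    (fun t => by
      rw [norm_mul, norm_inv, Complex.norm_real, Real.norm_of_nonneg hM.le]
      exact inv_mul_le_one_of_le₀ (hb t) hM.le) h
  have h2 : ∀ x : I, deriv (fun t => (M : ℂ)⁻¹ * φ t) (x : ℝ) * h x
      = (M : ℂ)⁻¹ * (deriv φ (x : ℝ) * h x) := by
    intro x
    rw [deriv_const_mul _ ((hφ.differentiable one_ne_zero) _), mul_assoc]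
  simp_rw [h2] at h1
  rw [integral_const_mul] at h1
  have h3 := ENNReal.toReal_mono (ne_of_lt hh) h1
  rw [toReal_enorm, norm_mul, norm_inv, Complex.norm_real, Real.norm_of_nonneg hM.le,
    inv_mul_le_iff₀ hM] at h3
  exact h3

/-- Compact support of the test function is irrelevant since densities live on `[0,1]`. -/
theorem norm_integral_deriv_le_of_contDiff {h : L1} (hh : h ∈ BV) {φ : ℝ → ℂ}
    (hφ : ContDiff ℝ 1 φ) {M : ℝ} (hM : 0 < M) (hb : ∀ t, ‖φ t‖ ≤ M) :
    ‖∫ x : I, deriv φ (x : ℝ) * h x‖ ≤ M * bvar h := by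
  let χ : ContDiffBump (0 : ℝ) := ⟨2, 3, by norm_num, by norm_num⟩
  have hχ : ContDiff ℝ 1 (fun t => ((χ t : ℝ) : ℂ)) :=
    Complex.ofRealCLM.contDiff.comp χ.contDiff
  have hχs : HasCompactSupport (fun t => ((χ t : ℝ) : ℂ)) :=
    χ.hasCompactSupport.comp_left (g := fun t : ℝ => (t : ℂ)) (by simp)
  have h1 := norm_integral_deriv_le hh (φ := fun t => ((χ t : ℝ) : ℂ) * φ t) (hχ.mul hφ)
    hχs.mul_right hM (fun t => by
      rw [norm_mul, Complex.norm_real, Real.norm_of_nonneg χ.nonneg]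
      exact (mul_le_of_le_one_left (norm_nonneg _) χ.le_one).trans (hb t))
  have h2 : ∀ x : I, deriv (fun t => ((χ t : ℝ) : ℂ) * φ t) (x : ℝ) = deriv φ (x : ℝ) := by
    intro x
    refine Filter.EventuallyEq.deriv_eq ?_
    have : Set.Ioo (-2 : ℝ) 2 ∈ 𝓝 (x : ℝ) :=
      Ioo_mem_nhds (by linarith [x.2.1]) (by linarith [x.2.2])
    filter_upwards [this] with t ht
    have : χ t = 1 := χ.one_of_mem_closedBall (by
      rw [Metric.mem_closedBall, dist_zero_right, Real.norm_eq_abs, abs_le]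
      exact ⟨ht.1.le, ht.2.le⟩)
    rw [this]; simp
  simp_rw [h2] at h1
  exact h1

theorem volume_eq_image (A : Set I) : volume A = volume (Subtype.val '' A : Set ℝ) := by
  rw [unitInterval.volume_def, (MeasurableEmbedding.subtype_coe measurableSet_Icc).comap_apply]

theorem ae_coe_of_ae {p : ℝ → Prop} (hp : ∀ᵐ t : ℝ, p t) : ∀ᵐ x : I, p x :=
  unitInterval.measurePreserving_coe.quasiMeasurePreserving.ae (ae_restrict_of_ae hp)

theorem ae_ne (p : ℝ) : ∀ᵐ x : I, (x : ℝ) ≠ p :=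
  ae_coe_of_ae (p := fun t => t ≠ p) (Measure.ae_ne volume p)

/-- Lipschitz test functions may be used in place of `C¹` ones: if `c + ∫ₐˣ u` is bounded by `M`,
then `|∫ u h| ≤ M var h`. The primitive is approximated by its averages over short intervals, whose
derivatives converge boundedly almost everywhere to `u`. -/
theorem norm_integral_mul_le_of_primitive {h : L1} (hh : h ∈ BV) {u : ℝ → ℂ} (hu : Measurable u)
    {K : ℝ} (hK : ∀ t, ‖u t‖ ≤ K) {a b : ℝ} {c : ℂ} {M : ℝ} (hab : a ≤ b)
    (hsupp : ∀ t, t ∉ Set.Icc a b → u t = 0) (hM : 0 < M)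
    (hprim : ∀ x ∈ Set.Icc a b, ‖c + ∫ t in a..x, u t‖ ≤ M) :
    ‖∫ x : I, u x * h x‖ ≤ M * bvar h := by
  have hK0 : 0 ≤ K := (norm_nonneg _).trans (hK 0)
  have hloc : LocallyIntegrable u volume := by
    intro x
    refine ⟨Metric.ball x 1, Metric.ball_mem_nhds x one_pos, ?_⟩
    exact Measure.integrableOn_of_bounded (M := K) (by simp)
      hu.aestronglyMeasurable (ae_of_all _ hK)
  have hint : ∀ s t, IntervalIntegrable u volume s t := fun s t => by
    rw [intervalIntegrable_iff]
    exact Measure.integrableOn_of_bounded (M := K) (by simp)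
      hu.aestronglyMeasurable (ae_of_all _ hK)
  set Ψ : ℝ → ℂ := fun x => c + ∫ t in a..x, u t with hΨ
  have hdiff : ∀ s t, Ψ t - Ψ s = ∫ x in s..t, u x := by
    intro s t
    simp only [hΨ]
    rw [add_sub_add_left_eq_sub, intervalIntegral.integral_interval_sub_left (hint _ _) (hint _ _)]
  have hlip : ∀ s t, ‖Ψ t - Ψ s‖ ≤ K * |t - s| := by
    intro s t
    rw [hdiff]
    exact intervalIntegral.norm_integral_le_of_norm_le_const fun x _ => hK x
  have hcont : Continuous Ψ := by
    have : LipschitzWith K.toNNReal Ψ := by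
      refine LipschitzWith.of_dist_le_mul fun s t => ?_
      rw [dist_eq_norm, Real.dist_eq, Real.coe_toNNReal _ hK0]
      exact hlip t s
    exact this.continuous
  have hbound : ∀ x, ‖Ψ x‖ ≤ M := by
    intro x
    rcases le_total x a with hx | hx
    · have h0 : Ψ x = c + ∫ t in a..a, u t := by
        simp only [hΨ]
        congr 1
        rw [intervalIntegral.integral_same]
        refine intervalIntegral.integral_zero_ae ?_
        filter_upwards [Measure.ae_ne volume a] with t hta ht
        rw [Set.uIoc_of_ge hx] at ht
        exact hsupp t fun h' => hta (le_antisymm ht.2 h'.1)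
      rw [h0]
      exact hprim a (Set.left_mem_Icc.2 hab)
    rcases le_total x b with hxb | hxb
    · exact hprim x ⟨hx, hxb⟩
    · have h0 : Ψ x - Ψ b = 0 := by
        rw [hdiff]
        refine intervalIntegral.integral_zero_ae (ae_of_all _ fun t ht => ?_)
        rw [Set.uIoc_of_le hxb] at ht
        exact hsupp t fun h' => absurd h'.2 (not_le.2 ht.1)
      rw [sub_eq_zero.1 h0]
      exact hprim b (Set.right_mem_Icc.2 hab)
  set G : ℝ → ℂ := fun x => ∫ t in (0 : ℝ)..x, Ψ t with hG
  have hGd : ∀ x, HasDerivAt G (Ψ x) x := fun x => hcont.integral_hasStrictDerivAt 0 x |>.hasDerivAt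
  set τ : ℕ → ℝ := fun k => 1 / ((k : ℝ) + 1) with hτ
  have hτ0 : ∀ k, 0 < τ k := fun k => Nat.one_div_pos_of_nat
  have hτlim : Tendsto τ atTop (𝓝 0) := tendsto_one_div_add_atTop_nhds_zero_nat
  set S : ℕ → ℝ → ℂ := fun k x => ((τ k)⁻¹ : ℝ) • (G (x + τ k) - G x) with hS
  have hSd : ∀ k x, HasDerivAt (S k) ((τ k)⁻¹ • (Ψ (x + τ k) - Ψ x)) x := fun k x =>
    (((hGd (x + τ k)).comp_add_const x (τ k)).sub (hGd x)).fun_const_smul _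
  have hSderiv : ∀ k, deriv (S k) = fun x => (τ k)⁻¹ • (Ψ (x + τ k) - Ψ x) := fun k =>
    funext fun x => (hSd k x).deriv
  have hSc : ∀ k, ContDiff ℝ 1 (S k) := by
    intro k
    rw [contDiff_one_iff_deriv]
    refine ⟨fun x => (hSd k x).differentiableAt, ?_⟩
    rw [hSderiv]
    have hc2 : Continuous fun x => Ψ (x + τ k) - Ψ x := by fun_prop
    exact hc2.const_smul ((τ k)⁻¹ : ℝ)
  have hSb : ∀ k t, ‖S k t‖ ≤ M := by
    intro k t
    have h1 : G (t + τ k) - G t = ∫ x in t..(t + τ k), Ψ x := by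
      simp only [hG]
      exact intervalIntegral.integral_interval_sub_left (hcont.intervalIntegrable _ _)
        (hcont.intervalIntegrable _ _)
    have h2 : ‖G (t + τ k) - G t‖ ≤ M * τ k := by
      rw [h1]
      refine (intervalIntegral.norm_integral_le_of_norm_le_const fun x _ => hbound x).trans_eq ?_
      rw [add_sub_cancel_left, abs_of_pos (hτ0 k)]
    simp only [hS]
    rw [norm_smul, norm_inv, Real.norm_of_nonneg (hτ0 k).le, inv_mul_le_iff₀ (hτ0 k), mul_comm]
    exact h2
  have hkey : ∀ k, ‖∫ x : I, deriv (S k) (x : ℝ) * h x‖ ≤ M * bvar h := fun k =>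
    norm_integral_deriv_le_of_contDiff hh (hSc k) hM (hSb k)
  have hlim : Tendsto (fun k => ∫ x : I, deriv (S k) (x : ℝ) * h x) atTop
      (𝓝 (∫ x : I, u x * h x)) := by
    refine tendsto_integral_of_dominated_convergence (fun x => K * ‖h x‖) (fun k => ?_)
      ((L1.integrable_coeFn h).norm.const_mul K) (fun k => ?_) ?_
    · exact (integrable_test (hSc k) h).1
    · refine ae_of_all _ fun x => ?_
      rw [norm_mul]
      refine mul_le_mul_of_nonneg_right ?_ (norm_nonneg _)
      rw [hSderiv, norm_smul, norm_inv, Real.norm_of_nonneg (hτ0 k).le, inv_mul_le_iff₀ (hτ0 k)]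
      refine (hlip _ _).trans_eq ?_
      rw [add_sub_cancel_left, abs_of_pos (hτ0 k), mul_comm]
    · filter_upwards [ae_coe_of_ae (LocallyIntegrable.ae_hasDerivAt_integral hloc)] with x hx
      refine Tendsto.mul_const _ ?_
      have h1 : HasDerivAt Ψ (u x) x := (hx a).const_add c
      have h2 := h1.tendsto_slope_zero_right
      have h3 : Tendsto τ atTop (𝓝[>] 0) :=
        tendsto_nhdsWithin_iff.2 ⟨hτlim, Eventually.of_forall hτ0⟩
      refine (h2.comp h3).congr fun k => ?_
      rw [hSderiv]
      rfl
  exact le_of_tendsto hlim.norm (Eventually.of_forall hkey)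

/-- A continuous, piecewise differentiable test function on an interval `[a,b]`, extended by
constants. -/
theorem norm_integral_indicator_deriv_le {h : L1} (hh : h ∈ BV) {Φ u : ℝ → ℂ} (hu : Measurable u)
    {K a b M : ℝ} (hK : ∀ t ∈ Set.Ioo a b, ‖u t‖ ≤ K) (hab : a ≤ b) {s : Set ℝ} (hs : s.Countable)
    (hc : ContinuousOn Φ (Set.Icc a b)) (hd : ∀ x ∈ Set.Ioo a b \ s, HasDerivAt Φ (u x) x)
    (hM : 0 < M) (hb : ∀ x ∈ Set.Icc a b, ‖Φ x‖ ≤ M) :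
    ‖∫ x : I, (Set.Ioo a b).indicator u x * h x‖ ≤ M * bvar h := by
  have hKm : ∀ t, ‖(Set.Ioo a b).indicator u t‖ ≤ max K 0 := by
    intro t
    by_cases ht : t ∈ Set.Ioo a b
    · rw [Set.indicator_of_mem ht]; exact (hK t ht).trans (le_max_left _ _)
    · rw [Set.indicator_of_notMem ht]; simp
  refine norm_integral_mul_le_of_primitive hh (hu.indicator measurableSet_Ioo) hKm (c := Φ a) hab
    (fun t ht => Set.indicator_of_notMem (fun h' => ht (Set.Ioo_subset_Icc_self h')) _) hM ?_
  intro x hx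
  have hmeas : Measurable ((Set.Ioo a b).indicator u) := hu.indicator measurableSet_Ioo
  have h1 : ∫ t in a..x, (Set.Ioo a b).indicator u t = Φ x - Φ a := by
    refine integral_eq_of_hasDerivAt_off_countable_of_le Φ _ hx.1 hs
      (hc.mono (Set.Icc_subset_Icc_right hx.2)) (fun t ht => ?_) ?_
    · have ht' : t ∈ Set.Ioo a b := ⟨ht.1.1, ht.1.2.trans_le hx.2⟩
      rw [Set.indicator_of_mem ht']
      exact hd t ⟨ht', ht.2⟩
    · rw [intervalIntegrable_iff]
      exact Measure.integrableOn_of_bounded (M := max K 0) (by simp)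
        hmeas.aestronglyMeasurable (ae_of_all _ hKm)
  rw [h1, add_sub_cancel]
  exact hb x hx

theorem bvar_add_le {h g : L1} (hh : h ∈ BV) (hg : g ∈ BV) : bvar (h + g) ≤ bvar h + bvar g := by
  rw [bvar, bvar, bvar, ← ENNReal.toReal_add (ne_of_lt hh) (ne_of_lt hg)]
  exact ENNReal.toReal_mono (ENNReal.add_ne_top.2 ⟨ne_of_lt hh, ne_of_lt hg⟩) (var_add_le h g)

theorem bvar_smul_le (c : ℂ) {h : L1} (hh : h ∈ BV) : bvar (c • h) ≤ ‖c‖ * bvar h := by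
  have := ENNReal.toReal_mono (ENNReal.mul_ne_top enorm_ne_top (ne_of_lt hh)) (var_smul_le c h)
  rwa [ENNReal.toReal_mul, toReal_enorm] at this

theorem bvar_smul (c : ℂ) {h : L1} (hh : h ∈ BV) : bvar (c • h) = ‖c‖ * bvar h := by
  refine le_antisymm (bvar_smul_le c hh) ?_
  rcases eq_or_ne c 0 with rfl | hc
  · simpa using bvar_nonneg _
  have := bvar_smul_le c⁻¹ (BV.smul_mem c hh)
  rw [smul_smul, inv_mul_cancel₀ hc, one_smul, norm_inv] at this
  rwa [inv_mul_eq_div, le_div_iff₀ (norm_pos_iff.2 hc), mul_comm] at this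

theorem bvar_zero : bvar 0 = 0 := by rw [bvar, var_zero]; rfl

theorem bvar_sum_le {ι : Type*} (s : Finset ι) (g : ι → L1) (hg : ∀ i ∈ s, g i ∈ BV) :
    bvar (∑ i ∈ s, g i) ≤ ∑ i ∈ s, bvar (g i) := by
  classical
  induction s using Finset.induction_on with
  | empty => simp [bvar_zero]
  | insert i s hi ih =>
    rw [Finset.sum_insert hi, Finset.sum_insert hi]
    have h1 : ∀ j ∈ s, g j ∈ BV := fun j hj => hg j (Finset.mem_insert_of_mem hj)
    exact (bvar_add_le (hg i (Finset.mem_insert_self _ _)) (BV.sum_mem h1)).trans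
      (by linarith [ih h1])

theorem continuous_integral_mul {w : I → ℂ} (hw : Measurable w) {K : ℝ} (hK : ∀ x, ‖w x‖ ≤ K) :
    Continuous fun h : L1 => ∫ x : I, w x * h x := by
  have hi : ∀ h : L1, Integrable (fun x => w x * h x) := fun h =>
    (L1.integrable_coeFn h).bdd_mul hw.aestronglyMeasurable (ae_of_all _ hK)
  have hK0 : 0 ≤ K := (norm_nonneg _).trans (hK 0)
  have : LipschitzWith K.toNNReal fun h : L1 => ∫ x : I, w x * h x := by
    refine LipschitzWith.of_dist_le_mul fun h g => ?_
    rw [dist_eq_norm, dist_eq_norm, Real.coe_toNNReal _ hK0, ← integral_sub (hi h) (hi g),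
      L1.norm_eq_integral_norm, ← integral_const_mul]
    refine norm_integral_le_of_norm_le ((L1.integrable_coeFn (h - g)).norm.const_mul K) ?_
    filter_upwards [Lp.coeFn_sub h g] with x hx
    rw [hx, ← mul_sub, norm_mul]
    exact mul_le_mul_of_nonneg_right (hK x) (norm_nonneg _)
  exact this.continuous

/-- Lower semicontinuity of the variation under `L¹` convergence. -/
theorem mem_BV_of_tendsto {u : ℕ → L1} {h : L1} (hu : Tendsto u atTop (𝓝 h)) {K : ℝ}
    (hK : ∀ᶠ k in atTop, u k ∈ BV ∧ bvar (u k) ≤ K) : h ∈ BV ∧ bvar h ≤ K := by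
  refine mem_BV_of_bound fun φ hφ hs hb => ?_
  have hc : Continuous (fun x : I => deriv φ (x : ℝ)) :=
    (hφ.continuous_deriv le_rfl).comp continuous_subtype_val
  obtain ⟨B, hB⟩ := isCompact_univ.exists_bound_of_continuousOn hc.continuousOn
  have h1 := ((continuous_integral_mul hc.measurable (fun x => hB x (Set.mem_univ x))).tendsto
    h).comp hu
  refine le_of_tendsto h1.norm (hK.mono fun k hk => ?_)
  refine (norm_integral_deriv_le hk.1 hφ hs one_pos hb).trans ?_
  rw [one_mul]; exact hk.2

/-- The mean of a function over a set is bounded by its variation. There is no `L¹` term, because the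
variation over `ℝ` includes the jumps at `0` and `1`. -/
theorem norm_setIntegral_le_volume_mul_bvar {h : L1} (hh : h ∈ BV) {W : Set I}
    (hW : MeasurableSet W) : ‖∫ x in W, h x‖ ≤ volume.real W * bvar h := by
  set W' : Set ℝ := Subtype.val '' W with hW'
  have hW'm : MeasurableSet W' := measurableSet_Icc.subtype_image hW
  have hsub : W' ⊆ Set.Icc 0 1 := by rintro _ ⟨x, -, rfl⟩; exact x.2
  have hvol : volume.real W' = volume.real W := by
    rw [measureReal_def, measureReal_def, volume_eq_image W]
  have h1 : ∫ x in W, h x = ∫ x : I, W'.indicator (fun _ => (1 : ℂ)) x * h x := by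
    rw [← integral_indicator hW]
    refine integral_congr_ae (ae_of_all _ fun x => ?_)
    have hxW : (x : ℝ) ∈ W' ↔ x ∈ W := Subtype.val_injective.mem_set_image
    by_cases hx : x ∈ W
    · simp [hx, Set.indicator_of_mem (hxW.2 hx)]
    · simp [hx, Set.indicator_of_notMem (fun h' => hx (hxW.1 h'))]
  rw [h1]
  refine le_of_forall_pos_le_add fun η hη => ?_
  have hv := bvar_nonneg h
  set η' := η / (bvar h + 1) with hη'
  have hη'0 : 0 < η' := by positivity
  have h2 : ‖∫ x : I, W'.indicator (fun _ => (1 : ℂ)) x * h x‖ ≤ (volume.real W + η') * bvar h := by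
    refine norm_integral_mul_le_of_primitive (c := 0) (a := 0) (b := 1) hh
      (measurable_const.indicator hW'm) (K := 1) (fun t => ?_) zero_le_one (fun t ht => ?_)
      (by positivity) (fun x hx => ?_)
    · by_cases ht : t ∈ W' <;> simp [ht]
    · exact Set.indicator_of_notMem (fun h' => ht (hsub h')) _
    · rw [zero_add, intervalIntegral.integral_of_le hx.1, setIntegral_indicator hW'm]
      simp only [integral_const]
      have : ‖((volume.restrict (Set.Ioc 0 x ∩ W')).real Set.univ) • (1 : ℂ)‖
          ≤ volume.real W' := by
        rw [norm_smul, norm_one, mul_one, Real.norm_of_nonneg measureReal_nonneg,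
          measureReal_restrict_apply MeasurableSet.univ, Set.univ_inter]
        exact measureReal_mono Set.inter_subset_right
          (ne_top_of_le_ne_top (by simp) (measure_mono hsub : volume W' ≤ volume (Set.Icc (0:ℝ) 1)))
      rw [← hvol]
      linarith
  refine h2.trans ?_
  rw [add_mul, add_le_add_iff_left, hη', div_mul_eq_mul_div, div_le_iff₀ (by positivity)]
  nlinarith

/-! ### Multiplication operators, real parts and localisation -/

theorem exists_mul (w : I → ℂ) (hw : Measurable w) {K : ℝ} (hK : ∀ x, ‖w x‖ ≤ K) (h : L1) :
    ∃ g : L1, g =ᵐ[volume] fun x => w x * h x := by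
  have hi : Integrable (fun x => w x * h x) :=
    (L1.integrable_coeFn h).bdd_mul hw.aestronglyMeasurable (ae_of_all _ hK)
  exact ⟨hi.toL1 _, hi.coeFn_toL1⟩

/-- The function is real-valued. -/
def IsReal (h : L1) : Prop := ∀ᵐ x, (h x).im = 0

/-- The function vanishes outside the interval of radius `δ` around `p`. -/
def SupportedNear (h : L1) (p δ : ℝ) : Prop := ∀ᵐ x : I, δ ≤ |(x : ℝ) - p| → h x = 0

theorem norm_le_of_ae_norm_le {h g : L1} (hg : ∀ᵐ x, ‖g x‖ ≤ ‖h x‖) : ‖g‖ ≤ ‖h‖ :=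
  Lp.norm_le_norm_of_ae_le hg

theorem norm_le_mul_of_eq_mul {h g : L1} {w : I → ℂ} {K : ℝ} (hK : ∀ x, ‖w x‖ ≤ K)
    (hg : g =ᵐ[volume] fun x => w x * h x) : ‖g‖ ≤ K * ‖h‖ := by
  refine Lp.norm_le_mul_norm_of_ae_le_mul ?_
  filter_upwards [hg] with x hx
  rw [hx, norm_mul]
  exact mul_le_mul_of_nonneg_right (hK x) (norm_nonneg _)

/-- Restricting a function to the right of a point does not increase its variation over `ℝ`. -/
theorem bvar_right_le {h g : L1} (hh : h ∈ BV) {p : ℝ} (hp : p ≤ 1)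
    (hg : g =ᵐ[volume] fun x => (Set.Ioi p).indicator (fun _ => (1 : ℂ)) (x : ℝ) * h x) :
    g ∈ BV ∧ bvar g ≤ bvar h := by
  refine mem_BV_of_bound fun φ hφ hs hb => ?_
  obtain ⟨B, hB⟩ := isCompact_Icc.exists_bound_of_continuousOn
    (hφ.continuous_deriv le_rfl).continuousOn (s := Set.Icc p 2)
  have h1 := norm_integral_indicator_deriv_le hh (Φ := φ) (u := deriv φ)
    (hφ.continuous_deriv le_rfl).measurable (a := p) (b := 2)
    (fun t ht => hB t (Set.Ioo_subset_Icc_self ht)) (by linarith) Set.countable_empty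
    hφ.continuous.continuousOn
    (fun x _ => (hφ.differentiable one_ne_zero x).hasDerivAt) one_pos (fun x _ => hb x)
  rw [one_mul] at h1
  refine le_trans (le_of_eq ?_) h1
  congr 1
  refine integral_congr_ae ?_
  filter_upwards [hg] with x hx
  rw [hx]
  by_cases hxp : p < (x : ℝ)
  · have : (x : ℝ) ∈ Set.Ioo p 2 := ⟨hxp, by linarith [x.2.2]⟩
    simp [this, hxp]
  · have : (x : ℝ) ∉ Set.Ioo p 2 := fun h' => hxp h'.1
    rw [Set.indicator_of_notMem this, Set.indicator_of_notMem (show (x : ℝ) ∉ Set.Ioi p from hxp)]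
    simp

theorem bvar_left_le {h g : L1} (hh : h ∈ BV) {p : ℝ} (hp : 0 ≤ p)
    (hg : g =ᵐ[volume] fun x => (Set.Iio p).indicator (fun _ => (1 : ℂ)) (x : ℝ) * h x) :
    g ∈ BV ∧ bvar g ≤ bvar h := by
  refine mem_BV_of_bound fun φ hφ hs hb => ?_
  obtain ⟨B, hB⟩ := isCompact_Icc.exists_bound_of_continuousOn
    (hφ.continuous_deriv le_rfl).continuousOn (s := Set.Icc (-1) p)
  have h1 := norm_integral_indicator_deriv_le hh (Φ := φ) (u := deriv φ)
    (hφ.continuous_deriv le_rfl).measurable (a := -1) (b := p)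
    (fun t ht => hB t (Set.Ioo_subset_Icc_self ht)) (by linarith) Set.countable_empty
    hφ.continuous.continuousOn
    (fun x _ => (hφ.differentiable one_ne_zero x).hasDerivAt) one_pos (fun x _ => hb x)
  rw [one_mul] at h1
  refine le_trans (le_of_eq ?_) h1
  congr 1
  refine integral_congr_ae ?_
  filter_upwards [hg] with x hx
  rw [hx]
  by_cases hxp : (x : ℝ) < p
  · have : (x : ℝ) ∈ Set.Ioo (-1) p := ⟨by linarith [x.2.1], hxp⟩
    simp [this, hxp]
  · have : (x : ℝ) ∉ Set.Ioo (-1) p := fun h' => hxp h'.2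
    rw [Set.indicator_of_notMem this, Set.indicator_of_notMem (show (x : ℝ) ∉ Set.Iio p from hxp)]
    simp

theorem conj_mem_BV {h g : L1} (hh : h ∈ BV)
    (hg : g =ᵐ[volume] fun x => (starRingEnd ℂ) (h x)) : g ∈ BV ∧ bvar g ≤ bvar h := by
  refine mem_BV_of_bound fun φ hφ hs hb => ?_
  have hc : ContDiff ℝ 1 (fun t => (starRingEnd ℂ) (φ t)) :=
    Complex.conjCLE.contDiff.comp hφ
  have h1 := norm_integral_deriv_le hh (φ := fun t => (starRingEnd ℂ) (φ t)) hc
    (hs.comp_left (g := starRingEnd ℂ) (by simp)) one_pos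
    (fun t => by rw [RCLike.norm_conj]; exact hb t)
  rw [one_mul] at h1
  refine le_trans (le_of_eq ?_) h1
  rw [← RCLike.norm_conj, ← integral_conj]
  congr 1
  refine integral_congr_ae ?_
  filter_upwards [hg] with x hx
  have hd : deriv (fun t => (starRingEnd ℂ) (φ t)) (x : ℝ) = (starRingEnd ℂ) (deriv φ (x : ℝ)) :=
    (Complex.conjCLE.toContinuousLinearMap.hasFDerivAt.comp_hasDerivAt (x : ℝ)
      (hφ.differentiable one_ne_zero x).hasDerivAt).deriv
  rw [hx, map_mul, Complex.conj_conj, hd]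

/-- Decomposition of a function of bounded variation into real and imaginary part. -/
theorem exists_re_im {h : L1} (hh : h ∈ BV) : ∃ h₁ h₂ : L1, h = h₁ + Complex.I • h₂ ∧
    IsReal h₁ ∧ IsReal h₂ ∧ (h₁ ∈ BV ∧ bvar h₁ ≤ bvar h ∧ ‖h₁‖ ≤ ‖h‖) ∧
    (h₂ ∈ BV ∧ bvar h₂ ≤ bvar h ∧ ‖h₂‖ ≤ ‖h‖) := by
  have hci : Integrable (fun x => (starRingEnd ℂ) (h x)) :=
    Complex.conjCLE.toContinuousLinearMap.integrable_comp (L1.integrable_coeFn h)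
  set g : L1 := hci.toL1 _ with hg
  have hga : g =ᵐ[volume] fun x => (starRingEnd ℂ) (h x) := hci.coeFn_toL1
  obtain ⟨hgB, hgv⟩ := conj_mem_BV hh hga
  have hgn : ‖g‖ ≤ ‖h‖ := norm_le_of_ae_norm_le (by
    filter_upwards [hga] with x hx
    rw [hx, RCLike.norm_conj])
  have hv := bvar_nonneg h
  have key : ∀ c d : ℂ, ‖c‖ ≤ 1 / 2 → ‖d‖ ≤ 1 / 2 →
      (c • h + d • g ∈ BV ∧ bvar (c • h + d • g) ≤ bvar h ∧ ‖c • h + d • g‖ ≤ ‖h‖) := by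
    intro c d hc hd
    have m1 := BV.smul_mem c hh
    have m2 := BV.smul_mem d hgB
    refine ⟨BV.add_mem m1 m2, ?_, ?_⟩
    · have := bvar_add_le m1 m2
      rw [bvar_smul c hh, bvar_smul d hgB] at this
      nlinarith [bvar_nonneg g, norm_nonneg c, norm_nonneg d]
    · have := norm_add_le (c • h) (d • g)
      rw [norm_smul, norm_smul] at this
      nlinarith [norm_nonneg g, norm_nonneg c, norm_nonneg d, norm_nonneg h]
  refine ⟨(1 / 2 : ℂ) • h + (1 / 2 : ℂ) • g, (-Complex.I / 2) • h + (Complex.I / 2) • g,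
    ?_, ?_, ?_, key _ _ (by norm_num) (by norm_num), key _ _ (by simp) (by simp)⟩
  · rw [smul_add, smul_smul, smul_smul]
    have e1 : Complex.I * (-Complex.I / 2) = 1 / 2 := by
      linear_combination (-1 / 2 : ℂ) * Complex.I_mul_I
    have e2 : Complex.I * (Complex.I / 2) = -1 / 2 := by
      linear_combination (1 / 2 : ℂ) * Complex.I_mul_I
    rw [e1, e2]
    module
  · filter_upwards [Lp.coeFn_add ((1 / 2 : ℂ) • h) ((1 / 2 : ℂ) • g),
      Lp.coeFn_smul (1 / 2 : ℂ) h, Lp.coeFn_smul (1 / 2 : ℂ) g, hga] with x h1 h2 h3 h4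
    rw [h1, Pi.add_apply, h2, h3, Pi.smul_apply, Pi.smul_apply, h4]
    simp
  · filter_upwards [Lp.coeFn_add ((-Complex.I / 2 : ℂ) • h) ((Complex.I / 2 : ℂ) • g),
      Lp.coeFn_smul (-Complex.I / 2 : ℂ) h, Lp.coeFn_smul (Complex.I / 2 : ℂ) g, hga]
      with x h1 h2 h3 h4
    rw [h1, Pi.add_apply, h2, h3, Pi.smul_apply, Pi.smul_apply, h4]
    simp
    ring

/-- Localising a function by a smooth partition of unity increases the total variation only by a
multiple of the `L¹` norm. -/
theorem exists_sum_bvar_mul_le {ι : Type*} [Fintype ι] (χ : ι → ℝ → ℝ)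
    (hχ : ∀ i, ContDiff ℝ 1 (χ i)) (hχ0 : ∀ i t, 0 ≤ χ i t) (hχ1 : ∀ t, ∑ i, χ i t ≤ 1) :
    ∃ B : ℝ, 0 ≤ B ∧ ∀ h ∈ BV, ∀ g : ι → L1,
      (∀ i, g i =ᵐ[volume] fun x => ((χ i (x : ℝ) : ℝ) : ℂ) * h x) →
      (∀ i, g i ∈ BV) ∧ ∑ i, bvar (g i) ≤ bvar h + B * ‖h‖ := by
  have hd : ∀ i, Continuous (deriv (χ i)) := fun i => (hχ i).continuous_deriv le_rfl
  have hb : ∀ i, ∃ B, ∀ t ∈ Set.Icc (0 : ℝ) 1, ‖deriv (χ i) t‖ ≤ B := fun i =>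
    isCompact_Icc.exists_bound_of_continuousOn (hd i).continuousOn
  choose B hB using hb
  have hB0 : ∀ i, 0 ≤ B i := fun i => (norm_nonneg _).trans (hB i 0 (by simp))
  refine ⟨∑ i, B i, Finset.sum_nonneg fun i _ => hB0 i, fun h hh g hg => ?_⟩
  have hχle : ∀ i t, χ i t ≤ 1 := fun i t =>
    (Finset.single_le_sum (f := fun i => χ i t) (fun j _ => hχ0 j t) (Finset.mem_univ i)).trans
      (hχ1 t)
  -- the estimate for an arbitrary choice of test functions
  have key : ∀ φ : ι → ℝ → ℂ, (∀ i, ContDiff ℝ 1 (φ i)) → (∀ i, HasCompactSupport (φ i)) →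
      (∀ i t, ‖φ i t‖ ≤ 1) →
      ‖∑ i, ∫ x : I, deriv (φ i) (x : ℝ) * g i x‖ ≤ bvar h + (∑ i, B i) * ‖h‖ := by
    intro φ hφ hs hφb
    have hχC : ∀ i, ContDiff ℝ 1 (fun t => ((χ i t : ℝ) : ℂ)) := fun i =>
      Complex.ofRealCLM.contDiff.comp (hχ i)
    have hχCd : ∀ i t, HasDerivAt (fun t => ((χ i t : ℝ) : ℂ)) ((deriv (χ i) t : ℝ) : ℂ) t :=
      fun i t => ((hχ i).differentiable one_ne_zero t).hasDerivAt.ofReal_comp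
    set Φ : ℝ → ℂ := fun t => ∑ i, ((χ i t : ℝ) : ℂ) * φ i t with hΦ
    have hΦc : ContDiff ℝ 1 Φ := ContDiff.sum fun i _ => (hχC i).mul (hφ i)
    have hΦd : ∀ t, deriv Φ t
        = ∑ i, (((deriv (χ i) t : ℝ) : ℂ) * φ i t + ((χ i t : ℝ) : ℂ) * deriv (φ i) t) := by
      intro t
      refine HasDerivAt.deriv (HasDerivAt.fun_sum fun i _ => ?_)
      exact (hχCd i t).mul ((hφ i).differentiable one_ne_zero t).hasDerivAt
    have hΦb : ∀ t, ‖Φ t‖ ≤ 1 := by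
      intro t
      refine (norm_sum_le _ _).trans (le_trans (Finset.sum_le_sum fun i _ => ?_) (hχ1 t))
      rw [norm_mul, Complex.norm_real, Real.norm_of_nonneg (hχ0 i t)]
      exact mul_le_of_le_one_right (hχ0 i t) (hφb i t)
    have h1 := norm_integral_deriv_le_of_contDiff hh hΦc one_pos hΦb
    rw [one_mul] at h1
    have hint1 : ∀ i, Integrable (fun x : I => deriv (φ i) (x : ℝ) * g i x) := fun i =>
      integrable_test (hφ i) (g i)
    have hint2 : ∀ i, Integrable
        (fun x : I => (((deriv (χ i) (x : ℝ) : ℝ) : ℂ) * φ i x) * h x) := by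
      intro i
      refine (L1.integrable_coeFn h).bdd_mul (c := B i) ?_ (ae_of_all _ fun x => ?_)
      · have : Continuous (fun x : I => ((deriv (χ i) (x : ℝ) : ℝ) : ℂ) * φ i x) :=
          (Complex.continuous_ofReal.comp ((hd i).comp continuous_subtype_val)).mul
            ((hφ i).continuous.comp continuous_subtype_val)
        exact this.aestronglyMeasurable
      · rw [norm_mul, Complex.norm_real]
        exact (mul_le_of_le_one_right (norm_nonneg _) (hφb i x)).trans (hB i x x.2)
    have h2 : ∫ x : I, deriv Φ (x : ℝ) * h x = (∑ i, ∫ x : I, deriv (φ i) (x : ℝ) * g i x)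
        + ∑ i, ∫ x : I, (((deriv (χ i) (x : ℝ) : ℝ) : ℂ) * φ i x) * h x := by
      rw [← integral_finsetSum _ fun i _ => hint1 i, ← integral_finsetSum _ fun i _ => hint2 i,
        ← integral_add (integrable_finsetSum _ fun i _ => hint1 i)
          (integrable_finsetSum _ fun i _ => hint2 i)]
      refine integral_congr_ae ?_
      filter_upwards [ae_all_iff.2 hg] with x hx
      simp only [hΦd, hx, Finset.sum_mul, ← Finset.sum_add_distrib]
      exact Finset.sum_congr rfl fun i _ => by ring
    have h3 : ‖∑ i, ∫ x : I, (((deriv (χ i) (x : ℝ) : ℝ) : ℂ) * φ i x) * h x‖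
        ≤ (∑ i, B i) * ‖h‖ := by
      rw [Finset.sum_mul]
      refine (norm_sum_le _ _).trans (Finset.sum_le_sum fun i _ => ?_)
      rw [L1.norm_eq_integral_norm, ← integral_const_mul]
      refine norm_integral_le_of_norm_le ((L1.integrable_coeFn h).norm.const_mul (B i))
        (ae_of_all _ fun x => ?_)
      rw [norm_mul, norm_mul, Complex.norm_real]
      refine mul_le_mul_of_nonneg_right ?_ (norm_nonneg _)
      exact (mul_le_of_le_one_right (norm_nonneg _) (hφb i x)).trans (hB i x x.2)
    have h4 := eq_sub_of_add_eq h2.symm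
    rw [h4]
    exact (norm_sub_le _ _).trans (add_le_add h1 h3)
  have hgB : ∀ i, g i ∈ BV := by
    intro i
    classical
    refine (mem_BV_of_bound (K := bvar h + (∑ i, B i) * ‖h‖) fun φ hφ hs hφb => ?_).1
    have := key (fun j => if j = i then φ else fun _ => 0)
      (fun j => by split_ifs; exacts [hφ, contDiff_const])
      (fun j => by split_ifs; exacts [hs, HasCompactSupport.zero])
      (fun j t => by split_ifs; exacts [hφb t, by simp])
    rw [Finset.sum_eq_single i] at this
    · simpa using this
    · intro j _ hj
      simp [hj]
    · simp
  refine ⟨hgB, le_of_forall_pos_le_add fun η hη => ?_⟩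
  -- nearly optimal test functions, rotated so that all integrals are nonnegative
  have hopt : ∀ i, ∃ φ : ℝ → ℂ, ContDiff ℝ 1 φ ∧ HasCompactSupport φ ∧ (∀ t, ‖φ t‖ ≤ 1) ∧
      ∃ s : ℝ, bvar (g i) - η / (Fintype.card ι + 1) ≤ s ∧
        ∫ x : I, deriv φ (x : ℝ) * g i x = (s : ℂ) := by
    intro i
    have hη' : 0 < η / (Fintype.card ι + 1) := by positivity
    by_contra hcon
    have : g i ∈ BV ∧ bvar (g i) ≤ bvar (g i) - η / (Fintype.card ι + 1) := by
      refine mem_BV_of_bound fun φ hφ hs hφb => ?_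
      by_contra hlt
      refine hcon ?_
      set z := ∫ x : I, deriv φ (x : ℝ) * g i x with hz
      obtain ⟨c, hc, hcz⟩ : ∃ c : ℂ, ‖c‖ ≤ 1 ∧ c * z = (‖z‖ : ℂ) := by
        rcases eq_or_ne z 0 with h0 | h0
        · exact ⟨1, by simp, by simp [h0]⟩
        · refine ⟨‖z‖ / z, ?_, by field_simp⟩
          rw [norm_div, Complex.norm_real, norm_norm, div_self (norm_ne_zero_iff.2 h0)]
      refine ⟨fun t => c * φ t, contDiff_const.mul hφ, hs.mul_left, fun t => ?_, ‖z‖,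
        (not_le.1 hlt).le, ?_⟩
      · rw [norm_mul]
        exact mul_le_one₀ hc (norm_nonneg _) (hφb t)
      · rw [← hcz, hz, ← integral_const_mul]
        refine integral_congr_ae (ae_of_all _ fun x => ?_)
        simp only
        rw [deriv_const_mul _ (hφ.differentiable one_ne_zero _), mul_assoc]
    linarith [this.2]
  choose φ hφ hs hφb s hsle hsint using hopt
  have h1 := key φ hφ hs hφb
  simp_rw [hsint] at h1
  rw [← Complex.ofReal_sum, Complex.norm_real] at h1
  have h2 := (le_abs_self _).trans h1
  have h3 : ∑ i, (bvar (g i) - η / (Fintype.card ι + 1)) ≤ ∑ i, s i :=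
    Finset.sum_le_sum fun i _ => hsle i
  rw [Finset.sum_sub_distrib, Finset.sum_const, nsmul_eq_mul, Finset.card_univ] at h3
  have h4 : (Fintype.card ι : ℝ) * (η / (Fintype.card ι + 1)) ≤ η := by
    rw [mul_div_assoc', div_le_iff₀ (by positivity)]
    nlinarith
  linarith

/-- For every cover of `[0,1]` by open intervals around its points, a function decomposes into
finitely many pieces that are supported in such intervals and whose total variation is controlled. -/
theorem exists_localisation (δ : I → ℝ) (hδ : ∀ p, 0 < δ p) :
    ∃ (s : Finset I) (B : ℝ), 0 ≤ B ∧ ∀ h ∈ BV, ∃ g : I → L1, h = ∑ p ∈ s, g p ∧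
      (∀ p ∈ s, g p ∈ BV ∧ SupportedNear (g p) p (δ p) ∧ ‖g p‖ ≤ ‖h‖ ∧ (IsReal h → IsReal (g p))) ∧
      ∑ p ∈ s, bvar (g p) ≤ bvar h + B * ‖h‖ := by
  obtain ⟨s, hs⟩ := (isCompact_univ : IsCompact (Set.univ : Set I)).elim_finite_subcover
    (fun p : I => Metric.ball p (δ p)) (fun p => Metric.isOpen_ball)
    (fun p _ => Set.mem_iUnion.2 ⟨p, Metric.mem_ball_self (hδ p)⟩)
  have hcov : Set.Icc (0 : ℝ) 1 ⊆ ⋃ p : s, Metric.ball ((p : I) : ℝ) (δ p) := by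
    intro t ht
    obtain ⟨p, hp, hpt⟩ := Set.mem_iUnion₂.1 (hs (Set.mem_univ (⟨t, ht⟩ : I)))
    exact Set.mem_iUnion.2 ⟨⟨p, hp⟩, hpt⟩
  obtain ⟨P, hP⟩ := SmoothPartitionOfUnity.exists_isSubordinate (modelWithCornersSelf ℝ ℝ)
    (isClosed_Icc : IsClosed (Set.Icc (0 : ℝ) 1))
    (fun p : s => Metric.ball ((p : I) : ℝ) (δ p)) (fun p => Metric.isOpen_ball) hcov
  have hsm : ∀ i, ContDiff ℝ 1 (P i) := fun i =>
    ((P i).contMDiff.contDiff).of_le (by exact_mod_cast le_top)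
  have hfs : ∀ t, ∑ᶠ i, P i t = ∑ i, P i t := fun t => finsum_eq_sum_of_fintype _
  obtain ⟨B, hB0, hB⟩ := exists_sum_bvar_mul_le (fun i t => P i t) hsm (fun i t => P.nonneg i t)
    (fun t => by rw [← hfs]; exact P.sum_le_one t)
  refine ⟨s, B, hB0, fun h hh => ?_⟩
  have hPle : ∀ i t, ‖((P i t : ℝ) : ℂ)‖ ≤ 1 := fun i t => by
    rw [Complex.norm_real, Real.norm_of_nonneg (P.nonneg i t)]; exact P.le_one i t
  have hex : ∀ i : s, ∃ g : L1, g =ᵐ[volume] fun x => ((P i (x : ℝ) : ℝ) : ℂ) * h x := fun i =>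
    exists_mul _ (Complex.measurable_ofReal.comp
      ((hsm i).continuous.measurable.comp measurable_subtype_coe)) (fun x => hPle i x) h
  choose g hg using hex
  obtain ⟨hgB, hgs⟩ := hB h hh g hg
  classical
  refine ⟨fun p => if hp : p ∈ s then g ⟨p, hp⟩ else 0, ?_, fun p hp => ?_, ?_⟩
  · rw [← Finset.sum_coe_sort]
    simp only [Finset.coe_mem, dif_pos, Subtype.coe_eta]
    refine Lp.ext ?_
    have h1 : ⇑(∑ i, g i : L1) =ᵐ[volume] fun x => ∑ i, g i x := by
      have := Lp.coeFn_finsetSum (p := 1) (μ := (volume : Measure I)) Finset.univ g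
      filter_upwards [this] with x hx
      rw [hx, Finset.sum_apply]
    filter_upwards [h1, ae_all_iff.2 hg] with x hx1 hx2
    rw [hx1]
    simp_rw [hx2]
    rw [← Finset.sum_mul, ← Complex.ofReal_sum, ← hfs, P.sum_eq_one x.2]
    simp
  · simp only [dif_pos hp]
    refine ⟨hgB _, ?_, ?_, fun hr => ?_⟩
    · filter_upwards [hg ⟨p, hp⟩] with x hx hxd
      have : P ⟨p, hp⟩ (x : ℝ) = 0 := by
        by_contra hne
        have := hP ⟨p, hp⟩ (subset_tsupport _ hne)
        rw [Metric.mem_ball, Real.dist_eq] at this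
        exact absurd this (not_lt.2 hxd)
      rw [hx, this]; simp
    · have := norm_le_mul_of_eq_mul (fun x : I => hPle ⟨p, hp⟩ x) (hg ⟨p, hp⟩)
      rwa [one_mul] at this
    · filter_upwards [hg ⟨p, hp⟩, hr] with x hx hx2
      rw [hx]; simp [hx2]
  · rw [← Finset.sum_coe_sort]
    simpa using hgs

/-! ### Transfer operators as preduals of Koopman operators -/

theorem integrable_bdd_mul_coeFn {ψ : I → ℂ} (hψ : Measurable ψ) {K : ℝ} (hK : ∀ y, ‖ψ y‖ ≤ K)
    (h : L1) : Integrable (fun x => ψ x * h x) :=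
  (L1.integrable_coeFn h).bdd_mul hψ.aestronglyMeasurable (ae_of_all _ hK)

theorem norm_integral_kernel_le (κ : Kernel I I) [IsMarkovKernel κ] {ψ : I → ℂ} {K : ℝ}
    (hK : ∀ y, ‖ψ y‖ ≤ K) (x : I) : ‖∫ y, ψ y ∂(κ x)‖ ≤ K := by
  have := norm_integral_le_of_norm_le_const (μ := κ x) (ae_of_all _ hK)
  simpa using this

theorem measurable_integral_kernel (κ : Kernel I I) [IsMarkovKernel κ] {ψ : I → ℂ}
    (hψ : Measurable ψ) : Measurable (fun x => ∫ y, ψ y ∂(κ x)) :=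
  (hψ.stronglyMeasurable.integral_kernel (κ := κ)).measurable

/-- The defining identity of a transfer operator extends from sets to bounded functions. -/
theorem IsTransfer.integral_mul {κ : Kernel I I} [IsMarkovKernel κ] {h g : L1}
    (hg : IsTransfer κ h g) {ψ : I → ℂ} (hψ : Measurable ψ) {K : ℝ} (hK : ∀ y, ‖ψ y‖ ≤ K) :
    ∫ y, ψ y * g y = ∫ x, (∫ y, ψ y ∂(κ x)) * h x := by
  -- simple functions
  have hsimple : ∀ s : SimpleFunc I ℂ,
      ∫ y, s y * g y = ∫ x, (∫ y, s y ∂(κ x)) * h x := by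
    intro s
    induction s using SimpleFunc.induction with
    | const c hA =>
      rename_i A
      have e1 : ∀ y, (SimpleFunc.piecewise A hA (SimpleFunc.const I c) (SimpleFunc.const I 0)) y
          = A.indicator (fun _ => c) y := by
        intro y
        by_cases hy : y ∈ A <;> simp [hy]
      simp_rw [e1]
      have e2 : ∀ y, A.indicator (fun _ => c) y * g y = A.indicator (fun y => c * g y) y := by
        intro y
        by_cases hy : y ∈ A <;> simp [hy]
      simp_rw [e2]
      rw [integral_indicator hA, integral_const_mul, hg A hA, ← integral_const_mul]
      refine integral_congr_ae (ae_of_all _ fun x => ?_)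
      simp only
      rw [integral_indicator_const _ hA, Complex.real_smul]
      ring
    | @add s t _ hs ht =>
      obtain ⟨Ks, hKs⟩ := s.exists_forall_norm_le
      obtain ⟨Kt, hKt⟩ := t.exists_forall_norm_le
      simp only [SimpleFunc.coe_add, Pi.add_apply, add_mul]
      rw [integral_add (integrable_bdd_mul_coeFn s.measurable hKs g)
        (integrable_bdd_mul_coeFn t.measurable hKt g), hs, ht, ← integral_add
        (integrable_bdd_mul_coeFn (measurable_integral_kernel κ s.measurable)
          (norm_integral_kernel_le κ hKs) h)
        (integrable_bdd_mul_coeFn (measurable_integral_kernel κ t.measurable)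
          (norm_integral_kernel_le κ hKt) h)]
      refine integral_congr_ae (ae_of_all _ fun x => ?_)
      simp only
      rw [integral_add (SimpleFunc.integrable_of_isFiniteMeasure s)
        (SimpleFunc.integrable_of_isFiniteMeasure t), add_mul]
  have hK0 : 0 ≤ K := (norm_nonneg _).trans (hK 0)
  set s : ℕ → SimpleFunc I ℂ := hψ.stronglyMeasurable.approxBounded K with hs
  have hsK : ∀ n y, ‖s n y‖ ≤ K := fun n y =>
    hψ.stronglyMeasurable.norm_approxBounded_le hK0 n y
  have hsl : ∀ y, Tendsto (fun n => s n y) atTop (𝓝 (ψ y)) := fun y =>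
    hψ.stronglyMeasurable.tendsto_approxBounded_of_norm_le (hK y)
  have l1 : Tendsto (fun n => ∫ y, s n y * g y) atTop (𝓝 (∫ y, ψ y * g y)) := by
    refine tendsto_integral_of_dominated_convergence (fun x => K * ‖g x‖)
      (fun n => (integrable_bdd_mul_coeFn (s n).measurable (hsK n) g).1)
      ((L1.integrable_coeFn g).norm.const_mul K) (fun n => ae_of_all _ fun x => ?_)
      (ae_of_all _ fun x => (hsl x).mul_const _)
    rw [norm_mul]
    exact mul_le_mul_of_nonneg_right (hsK n x) (norm_nonneg _)
  have l2 : Tendsto (fun n => ∫ x, (∫ y, s n y ∂(κ x)) * h x) atTop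
      (𝓝 (∫ x, (∫ y, ψ y ∂(κ x)) * h x)) := by
    refine tendsto_integral_of_dominated_convergence (fun x => K * ‖h x‖)
      (fun n => (integrable_bdd_mul_coeFn (measurable_integral_kernel κ (s n).measurable)
        (norm_integral_kernel_le κ (hsK n)) h).1)
      ((L1.integrable_coeFn h).norm.const_mul K) (fun n => ae_of_all _ fun x => ?_)
      (ae_of_all _ fun x => Tendsto.mul_const _ ?_)
    · rw [norm_mul]
      exact mul_le_mul_of_nonneg_right (norm_integral_kernel_le κ (hsK n) x) (norm_nonneg _)
    · exact tendsto_integral_of_dominated_convergence (fun _ => K)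
        (fun n => (s n).measurable.aestronglyMeasurable) (integrable_const K)
        (fun n => ae_of_all _ fun y => hsK n y) (ae_of_all _ hsl)
  refine tendsto_nhds_unique l1 (l2.congr fun n => (hsimple (s n)).symm)

theorem IsTransfer.norm_le {κ : Kernel I I} [IsMarkovKernel κ] {h g : L1}
    (hg : IsTransfer κ h g) : ‖g‖ ≤ ‖h‖ := by
  -- test against the conjugate phase of `g`
  have hgm : StronglyMeasurable g := Lp.stronglyMeasurable g
  set ψ : I → ℂ := fun y => (starRingEnd ℂ) (g y) / (‖g y‖ : ℂ) with hψ
  have hψm : Measurable ψ :=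
    (Complex.continuous_conj.measurable.comp hgm.measurable).div
      (Complex.measurable_ofReal.comp hgm.measurable.norm)
  have hψ1 : ∀ y, ‖ψ y‖ ≤ 1 := fun y => by
    simp only [hψ]
    rw [norm_div, RCLike.norm_conj, Complex.norm_real, norm_norm]
    exact div_self_le_one _
  have h1 := hg.integral_mul hψm hψ1
  have h2 : ∫ y, ψ y * g y = ((‖g‖ : ℝ) : ℂ) := by
    rw [L1.norm_eq_integral_norm, ← integral_complex_ofReal]
    refine integral_congr_ae (ae_of_all _ fun y => ?_)
    simp only [hψ]
    rcases eq_or_ne (g y) 0 with h0 | h0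
    · simp [h0]
    · have : (‖g y‖ : ℂ) ≠ 0 := by exact_mod_cast norm_ne_zero_iff.2 h0
      rw [div_mul_eq_mul_div, Complex.conj_mul', sq, mul_div_assoc, div_self this, mul_one]
  rw [h2] at h1
  have h3 : ‖g‖ = ‖∫ x, (∫ y, ψ y ∂(κ x)) * h x‖ := by
    rw [← h1, Complex.norm_real, norm_norm]
  rw [h3, L1.norm_eq_integral_norm h]
  refine norm_integral_le_of_norm_le (L1.integrable_coeFn h).norm (ae_of_all _ fun x => ?_)
  rw [norm_mul]
  exact mul_le_of_le_one_left (norm_nonneg _) (norm_integral_kernel_le κ hψ1 x)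

theorem norm_transferOp_le {κ : Kernel I I} [IsMarkovKernel κ] (hκ : IsNonsingular κ) (h : L1) :
    ‖transferOp κ h‖ ≤ ‖h‖ :=
  (isTransfer_transferOp hκ h).norm_le

theorem isReal_transferOp {κ : Kernel I I} [IsMarkovKernel κ] (hκ : IsNonsingular κ) {h : L1}
    (hr : IsReal h) : IsReal (transferOp κ h) := by
  set g := transferOp κ h with hg
  have hT : IsTransfer κ h g := isTransfer_transferOp hκ h
  have hi : Integrable (fun y => (g y).im) := (L1.integrable_coeFn g).im
  refine hi.ae_eq_zero_of_forall_setIntegral_eq_zero (fun A hA _ => ?_)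
  have h1 : ∫ y in A, (g y).im = (∫ y in A, g y).im :=
    integral_im (𝕜 := ℂ) (L1.integrable_coeFn g).integrableOn
  have h2 : ∫ x : I, (((κ x).real A : ℂ) * h x).im = (∫ x : I, ((κ x).real A : ℂ) * h x).im :=
    integral_im (𝕜 := ℂ) (integrable_kernel_mul κ hA (L1.integrable_coeFn h))
  rw [h1, hT A hA, ← h2]
  refine integral_eq_zero_of_ae ?_
  filter_upwards [hr] with x hx
  simp [hx]

/-- Locality moves supports by at most `ε`. -/
theorem supportedNear_transferOp {κ : Kernel I I} [IsMarkovKernel κ] (hκ : IsNonsingular κ)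
    {ε : ℝ} (hloc : ∀ (x : I) (A : Set I), MeasurableSet A → ε < Metric.infDist x A → κ x A = 0)
    {h : L1} {p δ δ' : ℝ} (hδ : δ + ε < δ') (hs : SupportedNear h p δ) :
    SupportedNear (transferOp κ h) p δ' := by
  set g := transferOp κ h with hg
  have hT : IsTransfer κ h g := isTransfer_transferOp hκ h
  set S : Set I := {x | δ' ≤ |(x : ℝ) - p|} with hS
  have hSm : MeasurableSet S := measurableSet_le measurable_const
    ((measurable_subtype_coe.sub measurable_const).abs)
  have h1 : g =ᵐ[volume.restrict S] 0 := by
    refine Integrable.ae_eq_zero_of_forall_setIntegral_eq_zero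
      (L1.integrable_coeFn g).integrableOn (fun A hA _ => ?_)
    rw [Measure.restrict_restrict hA, hT _ (hA.inter hSm)]
    refine integral_eq_zero_of_ae ?_
    filter_upwards [hs] with x hx
    by_cases hxp : δ ≤ |(x : ℝ) - p|
    · simp [hx hxp]
    · have : κ x (A ∩ S) = 0 := by
        rcases (A ∩ S).eq_empty_or_nonempty with he | hne
        · rw [he]; simp
        · refine hloc x _ (hA.inter hSm) (lt_of_lt_of_le (b := δ' - δ) (by linarith) ?_)
          refine (Metric.le_infDist hne).2 fun y hy => ?_
          have hy2 : δ' ≤ |(y : ℝ) - p| := hy.2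
          have hd : dist x y = |(x : ℝ) - y| := rfl
          rw [hd]
          have := abs_sub_abs_le_abs_sub ((y : ℝ) - p) (x - p)
          rw [sub_sub_sub_cancel_right, abs_sub_comm (y : ℝ) (x : ℝ)] at this
          linarith [not_le.1 hxp]
      simp [measureReal_def, this]
  have h2 := (ae_restrict_iff' hSm).1 h1
  filter_upwards [h2] with x hx hxp using hx hxp

theorem perronFrobenius_integral_mul {f : I → I} {hf : Measurable f}
    (hns : IsNonsingular (Kernel.deterministic f hf)) (h : L1) {ψ : I → ℂ} (hψ : Measurable ψ)
    {K : ℝ} (hK : ∀ y, ‖ψ y‖ ≤ K) :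
    ∫ y, ψ y * perronFrobenius f hf h y = ∫ x, ψ (f x) * h x := by
  have := (isTransfer_transferOp hns h).integral_mul hψ hK
  rw [perronFrobenius, this]
  refine integral_congr_ae (ae_of_all _ fun x => ?_)
  simp only
  rw [Kernel.integral_deterministic hf]

theorem setIntegral_perronFrobenius {f : I → I} {hf : Measurable f}
    (hns : IsNonsingular (Kernel.deterministic f hf)) (h : L1) {A : Set I} (hA : MeasurableSet A) :
    ∫ y in A, perronFrobenius f hf h y = ∫ x in f ⁻¹' A, h x := by
  have := perronFrobenius_integral_mul hns h (ψ := A.indicator (fun _ => (1 : ℂ)))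
    (measurable_const.indicator hA) (K := 1) (fun y => by by_cases hy : y ∈ A <;> simp [hy])
  rw [← integral_indicator hA, ← integral_indicator (hf hA)]
  calc _ = ∫ y, A.indicator (fun _ => (1 : ℂ)) y * perronFrobenius f hf h y :=
        integral_congr_ae (ae_of_all _ fun y => by by_cases hy : y ∈ A <;> simp [hy])
    _ = _ := this
    _ = _ := integral_congr_ae (ae_of_all _ fun x => by
        by_cases hx : f x ∈ A <;> simp [hx])

theorem setIntegral_perronFrobenius_pow {f : I → I} {hf : Measurable f}
    (hns : IsNonsingular (Kernel.deterministic f hf)) (n : ℕ) (h : L1) {A : Set I}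
    (hA : MeasurableSet A) :
    ∫ y in A, (perronFrobenius f hf ^ n) h y = ∫ x in f^[n] ⁻¹' A, h x := by
  induction n generalizing h with
  | zero => simp
  | succ n ih =>
    rw [pow_succ, Module.End.mul_apply, ih, setIntegral_perronFrobenius hns h (hf.iterate n hA),
      ← Set.preimage_comp, ← Function.iterate_succ]

/-! ### Compactness of bounded variation in `L¹` -/

/-- The integrals of a function over the cells of the mesh of size `1 / n`. -/
def cellIntegral (n : ℕ) (h : L1) (i : Fin (n + 1)) : ℂ :=
  ∫ x in {x : I | ⌊(n : ℝ) * x⌋₊ = i}, h x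

theorem measurableSet_floor_eq (n i : ℕ) : MeasurableSet {x : I | ⌊(n : ℝ) * x⌋₊ = i} :=
  (Nat.measurable_floor.comp (measurable_subtype_coe.const_mul _)) (measurableSet_singleton i)

theorem cellIntegral_sub (n : ℕ) (h g : L1) (i : Fin (n + 1)) :
    cellIntegral n (h - g) i = cellIntegral n h i - cellIntegral n g i := by
  rw [cellIntegral, cellIntegral, cellIntegral, ← integral_sub
    (L1.integrable_coeFn h).integrableOn (L1.integrable_coeFn g).integrableOn]
  exact integral_congr_ae (ae_restrict_of_ae (Lp.coeFn_sub h g))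

theorem norm_cellIntegral_le (n : ℕ) (h : L1) (i : Fin (n + 1)) : ‖cellIntegral n h i‖ ≤ ‖h‖ := by
  rw [L1.norm_eq_integral_norm]
  exact (norm_integral_le_integral_norm _).trans
    (setIntegral_le_integral (L1.integrable_coeFn h).norm (ae_of_all _ fun _ => norm_nonneg _))

/-- A function of bounded variation is determined in `L¹` by its integrals over the cells of a mesh,
up to an error controlled by the mesh size. By duality this reduces to the fact that the primitive of
a bounded function minus its cell averages is small. -/
theorem norm_le_bvar_add_sum_cellIntegral {h : L1} (hh : h ∈ BV) {n : ℕ} (hn : 0 < n) :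
    ‖h‖ ≤ 2 / n * bvar h + ∑ i, ‖cellIntegral n h i‖ := by
  have hn' : (0 : ℝ) < n := by exact_mod_cast hn
  have hhm : StronglyMeasurable h := Lp.stronglyMeasurable h
  -- the conjugate phase of `h`, so that `∫ ψ h = ‖h‖`
  set ψ₀ : I → ℂ := fun y => (starRingEnd ℂ) (h y) / (‖h y‖ : ℂ) with hψ₀
  have hψ₀m : Measurable ψ₀ :=
    (Complex.continuous_conj.measurable.comp hhm.measurable).div
      (Complex.measurable_ofReal.comp hhm.measurable.norm)
  have hψ₀1 : ∀ y, ‖ψ₀ y‖ ≤ 1 := fun y => by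
    simp only [hψ₀]
    rw [norm_div, RCLike.norm_conj, Complex.norm_real, norm_norm]
    exact div_self_le_one _
  set ψ : ℝ → ℂ := fun t => ψ₀ (Set.projIcc 0 1 zero_le_one t) with hψ
  have hψm : Measurable ψ := hψ₀m.comp continuous_projIcc.measurable
  have hψ1 : ∀ t, ‖ψ t‖ ≤ 1 := fun t => hψ₀1 _
  have hψint : ∀ a b, IntervalIntegrable ψ volume a b := fun a b => by
    rw [intervalIntegrable_iff]
    exact Measure.integrableOn_of_bounded (M := 1) (by simp)
      hψm.aestronglyMeasurable (ae_of_all _ hψ1)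
  have hnorm : ∫ x : I, ψ x * h x = ((‖h‖ : ℝ) : ℂ) := by
    rw [L1.norm_eq_integral_norm, ← integral_complex_ofReal]
    refine integral_congr_ae (ae_of_all _ fun y => ?_)
    simp only [hψ, hψ₀, Set.projIcc_val]
    rcases eq_or_ne (h y) 0 with h0 | h0
    · simp [h0]
    · have : (‖h y‖ : ℂ) ≠ 0 := by exact_mod_cast norm_ne_zero_iff.2 h0
      rw [div_mul_eq_mul_div, Complex.conj_mul', sq, mul_div_assoc, div_self this, mul_one]
  -- the cell averages of `ψ`
  set c : ℕ → ℂ := fun i => (n : ℝ) • ∫ t in (i / n : ℝ)..((i + 1) / n : ℝ), ψ t with hc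
  have hlen : ∀ i : ℕ, ((i : ℝ) + 1) / n - i / n = 1 / n := fun i => by ring
  have hle : ∀ i : ℕ, (i / n : ℝ) ≤ ((i : ℝ) + 1) / n := fun i => by
    have := hlen i
    have : (0 : ℝ) < 1 / n := by positivity
    linarith
  have hc1 : ∀ i, ‖c i‖ ≤ 1 := by
    intro i
    simp only [hc]
    have := intervalIntegral.norm_integral_le_of_norm_le_const (C := 1) (f := ψ)
      (a := (i / n : ℝ)) (b := ((i : ℝ) + 1) / n) fun t _ => hψ1 t
    rw [hlen, abs_of_pos (by positivity), one_mul] at this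
    rw [norm_smul, Real.norm_of_nonneg hn'.le]
    calc (n : ℝ) * _ ≤ n * (1 / n) := mul_le_mul_of_nonneg_left this hn'.le
      _ = 1 := by field_simp
  -- `v` has mean zero on every cell, so its primitive vanishes at the nodes and is at most `2 / n`
  set v : ℝ → ℂ := fun t => ψ t - c ⌊(n : ℝ) * t⌋₊ with hv
  have hcm : Measurable fun t : ℝ => c ⌊(n : ℝ) * t⌋₊ :=
    (measurable_from_nat (f := c)).comp (Nat.measurable_floor.comp (measurable_id.const_mul _))
  have hvm : Measurable v := hψm.sub hcm
  have hv2 : ∀ t, ‖v t‖ ≤ 2 := fun t => (norm_sub_le _ _).trans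
    (by linarith [hψ1 t, hc1 ⌊(n : ℝ) * t⌋₊])
  have hvint : ∀ a b, IntervalIntegrable v volume a b := fun a b => by
    rw [intervalIntegrable_iff]
    exact Measure.integrableOn_of_bounded (M := 2) (by simp)
      hvm.aestronglyMeasurable (ae_of_all _ hv2)
  have hcell : ∀ (i : ℕ) (x : ℝ), (i / n : ℝ) ≤ x → x ≤ ((i : ℝ) + 1) / n →
      ∫ t in (i / n : ℝ)..x, v t = (∫ t in (i / n : ℝ)..x, ψ t) - (x - i / n) • c i := by
    intro i x hix hxi
    rw [← intervalIntegral.integral_const, ← intervalIntegral.integral_sub (hψint _ _)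
      intervalIntegrable_const]
    refine intervalIntegral.integral_congr_ae ?_
    filter_upwards [Measure.ae_ne volume (((i : ℝ) + 1) / n)] with t htn ht
    rw [Set.uIoc_of_le hix] at ht
    have h1 : ⌊(n : ℝ) * t⌋₊ = i := by
      rw [Nat.floor_eq_iff (by have := (div_nonneg i.cast_nonneg hn'.le).trans ht.1.le; positivity)]
      have a1 := ht.1
      have a2 := lt_of_le_of_ne (ht.2.trans hxi) htn
      rw [div_lt_iff₀ hn'] at a1
      rw [lt_div_iff₀ hn'] at a2
      constructor <;> linarith
    simp only [hv, h1]
  have hfull : ∀ i : ℕ, ∫ t in (i / n : ℝ)..((i : ℝ) + 1) / n, v t = 0 := by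
    intro i
    rw [hcell i _ (hle i) le_rfl, hlen]
    simp only [hc]
    rw [smul_smul, one_div, inv_mul_cancel₀ hn'.ne', one_smul, sub_self]
  have hzero : ∀ i : ℕ, ∫ t in (0 : ℝ)..(i / n : ℝ), v t = 0 := by
    intro i
    induction i with
    | zero => simp
    | succ i ih =>
      rw [← intervalIntegral.integral_add_adjacent_intervals (hvint 0 (i / n)) (hvint (i / n) _), ih]
      push_cast
      rw [hfull, add_zero]
  have hprim : ∀ x ∈ Set.Icc (0 : ℝ) 1, ‖∫ t in (0 : ℝ)..x, v t‖ ≤ 2 / n := by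
    intro x hx
    have hx0 : 0 ≤ (n : ℝ) * x := mul_nonneg hn'.le hx.1
    set i := ⌊(n : ℝ) * x⌋₊
    have h1 : (i / n : ℝ) ≤ x := by
      rw [div_le_iff₀ hn', mul_comm x]; exact Nat.floor_le hx0
    have h2 : x ≤ ((i : ℝ) + 1) / n := by
      rw [le_div_iff₀ hn', mul_comm x]; exact (Nat.lt_floor_add_one _).le
    rw [← intervalIntegral.integral_add_adjacent_intervals (hvint 0 (i / n)) (hvint (i / n) _),
      hzero, zero_add]
    refine (intervalIntegral.norm_integral_le_of_norm_le_const fun t _ => hv2 t).trans ?_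
    have := hlen i
    rw [abs_of_nonneg (by linarith), show (2 : ℝ) / n = 2 * (1 / n) by ring]
    linarith
  have hI : ∀ x : I, (Set.Icc (0 : ℝ) 1).indicator v x = v x := fun x =>
    Set.indicator_of_mem x.2 _
  have h1 : ‖∫ x : I, v x * h x‖ ≤ 2 / n * bvar h := by
    have := norm_integral_mul_le_of_primitive hh (u := (Set.Icc (0 : ℝ) 1).indicator v)
      (hvm.indicator measurableSet_Icc) (K := 2) (c := 0) (a := 0) (b := 1) (M := 2 / n)
      (fun t => by
        by_cases ht : t ∈ Set.Icc (0 : ℝ) 1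
        · rw [Set.indicator_of_mem ht]; exact hv2 t
        · rw [Set.indicator_of_notMem ht]; simp)
      zero_le_one (fun t ht => Set.indicator_of_notMem ht _) (by positivity)
      (fun x hx => by
        rw [zero_add]
        refine le_trans (le_of_eq ?_) (hprim x hx)
        congr 1
        refine intervalIntegral.integral_congr fun t ht => ?_
        rw [Set.uIcc_of_le hx.1] at ht
        exact Set.indicator_of_mem (show t ∈ Set.Icc (0 : ℝ) 1 from ⟨ht.1, ht.2.trans hx.2⟩) _)
    simpa only [hI] using this
  have h2 : ∫ x : I, c ⌊(n : ℝ) * x⌋₊ * h x = ∑ i : Fin (n + 1), c i * cellIntegral n h i := by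
    simp_rw [cellIntegral, ← integral_const_mul, ← integral_indicator (measurableSet_floor_eq n _)]
    rw [← integral_finsetSum _ fun i _ =>
      ((L1.integrable_coeFn h).const_mul _).indicator (measurableSet_floor_eq n _)]
    refine integral_congr_ae (ae_of_all _ fun x => ?_)
    have hlt : ⌊(n : ℝ) * x⌋₊ < n + 1 := by
      rw [Nat.floor_lt (mul_nonneg hn'.le x.2.1)]
      push_cast
      nlinarith [x.2.2]
    simp only
    rw [Finset.sum_eq_single (⟨⌊(n : ℝ) * x⌋₊, hlt⟩ : Fin (n + 1))]
    · rw [Set.indicator_of_mem (show x ∈ {x : I | ⌊(n : ℝ) * x⌋₊ = _} from rfl)]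
    · intro j _ hj
      exact Set.indicator_of_notMem
        (fun hx : x ∈ {x : I | ⌊(n : ℝ) * x⌋₊ = j} => hj (Fin.ext hx.symm)) _
    · simp
  have hint1 : Integrable fun x : I => v x * h x :=
    integrable_bdd_mul_coeFn (hvm.comp measurable_subtype_coe) (fun x => hv2 x) h
  have hint2 : Integrable fun x : I => c ⌊(n : ℝ) * x⌋₊ * h x :=
    integrable_bdd_mul_coeFn (hcm.comp measurable_subtype_coe) (fun x => hc1 _) h
  have h3 : ((‖h‖ : ℝ) : ℂ) = (∫ x : I, v x * h x) + ∑ i : Fin (n + 1), c i * cellIntegral n h i := by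
    rw [← hnorm, ← h2, ← integral_add hint1 hint2]
    refine integral_congr_ae (ae_of_all _ fun x => ?_)
    simp only [hv]
    ring
  calc ‖h‖ = ‖((‖h‖ : ℝ) : ℂ)‖ := by rw [Complex.norm_real, norm_norm]
    _ ≤ _ := by
      rw [h3]
      refine (norm_add_le _ _).trans (add_le_add h1 ((norm_sum_le _ _).trans
        (Finset.sum_le_sum fun i _ => ?_)))
      rw [norm_mul]
      exact mul_le_of_le_one_left (norm_nonneg _) (hc1 _)

/-- Bounded sets of `BV` are totally bounded in `L¹`: for a fine mesh the finitely many integrals over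
the cells determine a function up to a small error. -/
theorem totallyBounded_bvar_le (V : ℝ) :
    TotallyBounded {h : L1 | h ∈ BV ∧ bvar h ≤ V ∧ ‖h‖ ≤ 1} := by
  set S := {h : L1 | h ∈ BV ∧ bvar h ≤ V ∧ ‖h‖ ≤ 1} with hS
  refine Metric.totallyBounded_of_finite_discretization fun ε hε => ?_
  obtain ⟨n, hn⟩ := exists_nat_gt (8 * (|V| + 1) / ε)
  have hn' : (0 : ℝ) < n := lt_of_le_of_lt (by positivity) hn
  have hnN : 0 < n := by exact_mod_cast hn'
  set r : ℝ := ε / (8 * (n + 1)) with hr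
  have hr0 : 0 < r := by positivity
  have htb : TotallyBounded (Metric.closedBall (0 : Fin (n + 1) → ℂ) 1) :=
    (isCompact_closedBall _ _).totallyBounded
  obtain ⟨t, htf, ht⟩ := Metric.totallyBounded_iff.1 htb r hr0
  have hsel : ∀ h : S, ∃ y : t, dist (cellIntegral n (h : L1)) (y : Fin (n + 1) → ℂ) < r := by
    intro h
    have : cellIntegral n (h : L1) ∈ Metric.closedBall (0 : Fin (n + 1) → ℂ) 1 := by
      rw [mem_closedBall_zero_iff, pi_norm_le_iff_of_nonneg zero_le_one]
      exact fun i => (norm_cellIntegral_le n _ i).trans h.2.2.2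
    obtain ⟨y, hy, hyd⟩ := Set.mem_iUnion₂.1 (ht this)
    exact ⟨⟨y, hy⟩, hyd⟩
  choose F hF using hsel
  refine ⟨t, htf.fintype, F, fun h g hFe => ?_⟩
  have hd : dist (cellIntegral n (h : L1)) (cellIntegral n (g : L1)) < 2 * r := by
    have h1 := hF h
    have h2 := hF g
    rw [← hFe, dist_comm] at h2
    linarith [dist_triangle (cellIntegral n (h : L1)) (F h) (cellIntegral n (g : L1))]
  have hk : (h - g : L1) ∈ BV := BV.sub_mem h.2.1 g.2.1
  have hkv : bvar (h - g : L1) ≤ 2 * |V| := by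
    have h1 := bvar_add_le h.2.1 (BV.smul_mem (-1) g.2.1)
    rw [bvar_smul _ g.2.1, norm_neg, norm_one, one_mul, neg_one_smul, ← sub_eq_add_neg] at h1
    linarith [h.2.2.1, g.2.2.1, le_abs_self V]
  have hmain := norm_le_bvar_add_sum_cellIntegral hk hnN
  have hsum : ∑ i, ‖cellIntegral n (h - g : L1) i‖ ≤ ε / 4 := by
    have : ∀ i ∈ (Finset.univ : Finset (Fin (n + 1))), ‖cellIntegral n (h - g : L1) i‖ ≤ 2 * r := by
      intro i _
      rw [cellIntegral_sub, ← dist_eq_norm]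
      exact (dist_le_pi_dist _ _ i).trans hd.le
    refine (Finset.sum_le_sum this).trans_eq ?_
    rw [Finset.sum_const, Finset.card_univ, Fintype.card_fin, nsmul_eq_mul, hr]
    push_cast
    field_simp
    norm_num
  have h3 : 2 / n * bvar (h - g : L1) ≤ ε / 2 := by
    rw [div_lt_iff₀ hε] at hn
    rw [div_mul_eq_mul_div, div_le_iff₀ hn']
    nlinarith [abs_nonneg V]
  rw [dist_eq_norm]
  linarith

/-- Every sequence bounded in `BV` has a subsequence converging in `L¹`, and the limit is in `BV`. -/
theorem exists_tendsto_subseq_of_bvar_le {u : ℕ → L1} {V : ℝ}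
    (hu : ∀ k, u k ∈ BV ∧ bvar (u k) ≤ V ∧ ‖u k‖ ≤ 1) :
    ∃ (h : L1) (s : ℕ → ℕ), StrictMono s ∧ h ∈ BV ∧ Tendsto (u ∘ s) atTop (𝓝 h) := by
  have hc : IsCompact (closure {h : L1 | h ∈ BV ∧ bvar h ≤ V ∧ ‖h‖ ≤ 1}) :=
    (totallyBounded_bvar_le V).closure.isCompact_of_isClosed isClosed_closure
  obtain ⟨h, -, s, hs, hlim⟩ := hc.tendsto_subseq (x := u) fun k => subset_closure (hu k)
  exact ⟨h, s, hs, (mem_BV_of_tendsto hlim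
    (Eventually.of_forall fun k => ⟨(hu _).1, (hu _).2.1⟩)).1, hlim⟩

/-! ### The transfer operator of a single branch -/

/-- If `g` has derivative `d ≠ 0` at `p`, then near `p` the reciprocal slope is at most `1/|d| + η`
and `g` expands distances to `p` by less than `|d| + 1`. -/
theorem exists_nhd_of_contDiff {g : ℝ → ℝ} (hg : ContDiff ℝ 2 g) {p : ℝ} (hd : deriv g p ≠ 0)
    {η : ℝ} (hη : 0 < η) : ∃ δ > 0, ∀ x, |x - p| ≤ δ →
      deriv g x ≠ 0 ∧ |(deriv g x)⁻¹| ≤ |deriv g p|⁻¹ + η ∧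
        |g x - g p| ≤ (|deriv g p| + 1) * |x - p| := by
  have hc : Continuous (deriv g) := hg.continuous_deriv (by norm_num)
  have h1 : ∀ᶠ x in 𝓝 p, deriv g x ≠ 0 := hc.continuousAt.eventually_ne hd
  have h2 : ∀ᶠ x in 𝓝 p, |(deriv g x)⁻¹| < |deriv g p|⁻¹ + η := by
    have : ContinuousAt (fun x => |(deriv g x)⁻¹|) p := (hc.continuousAt.inv₀ hd).abs
    refine this.eventually_lt_const ?_
    simp only [abs_inv]
    linarith
  have h3 : ∀ᶠ x in 𝓝 p, |g x - g p| ≤ (|deriv g p| + 1) * |x - p| := by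
    have := (hg.differentiable (by norm_num) p).hasDerivAt.isLittleO.def one_pos
    filter_upwards [this] with x hx
    simp only [smul_eq_mul, Real.norm_eq_abs, one_mul] at hx
    have h4 := abs_sub_abs_le_abs_sub (g x - g p) ((x - p) * deriv g p)
    rw [abs_mul] at h4
    linarith
  obtain ⟨δ, hδ, hδ'⟩ := Metric.eventually_nhds_iff.1 (h1.and (h2.and h3))
  refine ⟨δ / 2, by positivity, fun x hx => ?_⟩
  obtain ⟨a, b, c⟩ := hδ' (show dist x p < δ by rw [Real.dist_eq]; linarith)
  exact ⟨a, b.le, c⟩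

theorem supportedNear_perronFrobenius {f : I → I} {hf : Measurable f}
    (hns : IsNonsingular (Kernel.deterministic f hf)) {h : L1} {q δ : ℝ}
    (hs : ∀ᵐ x : I, h x ≠ 0 → |(f x : ℝ) - q| < δ) :
    SupportedNear (perronFrobenius f hf h) q δ := by
  set S : Set I := {x | δ ≤ |(x : ℝ) - q|} with hS
  have hSm : MeasurableSet S := measurableSet_le measurable_const
    ((measurable_subtype_coe.sub measurable_const).abs)
  have h1 : perronFrobenius f hf h =ᵐ[volume.restrict S] 0 := by
    refine Integrable.ae_eq_zero_of_forall_setIntegral_eq_zero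
      (L1.integrable_coeFn _).integrableOn (fun A hA _ => ?_)
    rw [Measure.restrict_restrict hA, setIntegral_perronFrobenius hns h (hA.inter hSm)]
    refine setIntegral_eq_zero_of_ae_eq_zero ?_
    filter_upwards [hs] with x hx hxA
    by_contra hne
    exact absurd (hx hne) (not_lt.2 hxA.2)
  have h2 := (ae_restrict_iff' hSm).1 h1
  filter_upwards [h2] with x hx hxp using hx hxp

/-- The local Lasota–Yorke inequality. Near `p` the map is given by two `C²` functions that match to
first order at `p`; a function supported near `p` is transported with its variation multiplied by
nearly `1 / |d|`, where `d` is the derivative at `p`. A test function `φ` for the image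
corresponds to the test function `φ ∘ f / f'` for the original, which is continuous and piecewise
`C¹`. -/
theorem exists_local_bvar_perronFrobenius_le {f : I → I} {hf : Measurable f}
    (hns : IsNonsingular (Kernel.deterministic f hf)) {gl gr : ℝ → ℝ} (hl : ContDiff ℝ 2 gl)
    (hr : ContDiff ℝ 2 gr) {p d : ℝ} (hlr : gl p = gr p) (hdl : deriv gl p = d)
    (hdr : deriv gr p = d) (hd : d ≠ 0) {η : ℝ} (hη : 0 < η) :
    ∃ δ > 0, ∃ B : ℝ, 0 ≤ B ∧ ∀ h ∈ BV, ∀ δ' ≤ δ, SupportedNear h p δ' →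
      (∀ᵐ x : I, h x ≠ 0 → (f x : ℝ) = if (x : ℝ) ≤ p then gl x else gr x) →
      perronFrobenius f hf h ∈ BV ∧
      bvar (perronFrobenius f hf h) ≤ (|d|⁻¹ + η) * bvar h + B * ‖h‖ ∧
      SupportedNear (perronFrobenius f hf h) (gl p) ((|d| + 1) * δ') := by
  obtain ⟨δ₁, hδ₁, H₁⟩ := exists_nhd_of_contDiff hl (p := p) (by rwa [hdl]) hη
  obtain ⟨δ₂, hδ₂, H₂⟩ := exists_nhd_of_contDiff hr (p := p) (by rwa [hdr]) hη
  rw [hdl] at H₁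
  rw [hdr, ← hlr] at H₂
  set δ := min δ₁ δ₂ with hδ
  have hδ0 : 0 < δ := lt_min hδ₁ hδ₂
  have hl1 : ContDiff ℝ 1 (deriv gl) := (contDiff_succ_iff_deriv (n := 1).1 hl).2.2
  have hr1 : ContDiff ℝ 1 (deriv gr) := (contDiff_succ_iff_deriv (n := 1).1 hr).2.2
  have hl2 : Continuous (deriv (deriv gl)) := hl1.continuous_deriv le_rfl
  have hr2 : Continuous (deriv (deriv gr)) := hr1.continuous_deriv le_rfl
  set F : ℝ → ℝ := fun x => if x ≤ p then gl x else gr x with hF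
  set F₁ : ℝ → ℝ := fun x => if x ≤ p then deriv gl x else deriv gr x with hF₁
  set F₂ : ℝ → ℝ := fun x => if x ≤ p then deriv (deriv gl) x else deriv (deriv gr) x with hF₂
  have hFc : Continuous F := Continuous.if_le hl.continuous hr.continuous continuous_id
    continuous_const (fun x hx => by rw [show x = p from hx, hlr])
  have hF₁c : Continuous F₁ := Continuous.if_le hl1.continuous hr1.continuous continuous_id
    continuous_const (fun x hx => by rw [show x = p from hx, hdl, hdr])
  have hF₂m : Measurable F₂ := Measurable.ite measurableSet_Iic hl2.measurable hr2.measurable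
  have hFd : ∀ x, x ≠ p → HasDerivAt F (F₁ x) x ∧ HasDerivAt F₁ (F₂ x) x := by
    intro x hx
    rcases lt_or_gt_of_ne hx with hxp | hxp
    · have e : ∀ᶠ t in 𝓝 x, t ≤ p := (eventually_lt_nhds hxp).mono fun _ h => h.le
      have e1 : F =ᶠ[𝓝 x] gl := e.mono fun t ht => if_pos ht
      have e2 : F₁ =ᶠ[𝓝 x] deriv gl := e.mono fun t ht => if_pos ht
      simp only [hF₁, hF₂, if_pos hxp.le]
      exact ⟨((hl.differentiable (by norm_num) x).hasDerivAt).congr_of_eventuallyEq e1,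
        ((hl1.differentiable (by norm_num) x).hasDerivAt).congr_of_eventuallyEq e2⟩
    · have e : ∀ᶠ t in 𝓝 x, ¬ t ≤ p := (eventually_gt_nhds hxp).mono fun _ h => not_le.2 h
      have e1 : F =ᶠ[𝓝 x] gr := e.mono fun t ht => if_neg ht
      have e2 : F₁ =ᶠ[𝓝 x] deriv gr := e.mono fun t ht => if_neg ht
      simp only [hF₁, hF₂, if_neg (not_le.2 hxp)]
      exact ⟨((hr.differentiable (by norm_num) x).hasDerivAt).congr_of_eventuallyEq e1,
        ((hr1.differentiable (by norm_num) x).hasDerivAt).congr_of_eventuallyEq e2⟩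
  have hnear : ∀ x, |x - p| ≤ δ → F₁ x ≠ 0 ∧ |(F₁ x)⁻¹| ≤ |d|⁻¹ + η ∧
      |F x - gl p| ≤ (|d| + 1) * |x - p| := by
    intro x hx
    by_cases hxp : x ≤ p
    · simp only [hF, hF₁, if_pos hxp]
      exact H₁ x (hx.trans (min_le_left _ _))
    · simp only [hF, hF₁, if_neg hxp]
      exact H₂ x (hx.trans (min_le_right _ _))
  have habs : ∀ x, x ∈ Set.Icc (p - δ) (p + δ) ↔ |x - p| ≤ δ := fun x => by
    rw [abs_le, Set.mem_Icc]; constructor <;> rintro ⟨a, b⟩ <;> constructor <;> linarith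
  have habs' : ∀ x, x ∈ Set.Ioo (p - δ) (p + δ) ↔ |x - p| < δ := fun x => by
    rw [abs_lt, Set.mem_Ioo]; constructor <;> rintro ⟨a, b⟩ <;> constructor <;> linarith
  obtain ⟨B₁, hB₁⟩ := isCompact_Icc.exists_bound_of_continuousOn (s := Set.Icc (p - δ) (p + δ))
    hl2.continuousOn
  obtain ⟨B₂, hB₂⟩ := isCompact_Icc.exists_bound_of_continuousOn (s := Set.Icc (p - δ) (p + δ))
    hr2.continuousOn
  have hpos : 0 < |d|⁻¹ + η := by positivity
  set B := max B₁ B₂ * (|d|⁻¹ + η) ^ 2 with hB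
  have hB0 : 0 ≤ max B₁ B₂ := (norm_nonneg _).trans
    ((hB₁ p ((habs p).2 (by simpa using hδ0.le))).trans (le_max_left _ _))
  have hF₂b : ∀ x, |x - p| ≤ δ → |F₂ x / F₁ x ^ 2| ≤ B := by
    intro x hx
    rw [div_eq_mul_inv, abs_mul, ← inv_pow, abs_pow]
    refine mul_le_mul ?_ (pow_le_pow_left₀ (abs_nonneg _) (hnear x hx).2.1 2) (by positivity) hB0
    by_cases hxp : x ≤ p
    · simp only [hF₂, if_pos hxp]
      exact (hB₁ x ((habs x).2 hx)).trans (le_max_left _ _)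
    · simp only [hF₂, if_neg hxp]
      exact (hB₂ x ((habs x).2 hx)).trans (le_max_right _ _)
  refine ⟨δ, hδ0, B, by positivity, fun h hh δ' hδ' hs hm => ?_⟩
  have hs' : ∀ᵐ x : I, h x ≠ 0 → |(x : ℝ) - p| < δ' := by
    filter_upwards [hs] with x hx hne
    by_contra hcon
    exact hne (hx (not_lt.1 hcon))
  have hsupp : SupportedNear (perronFrobenius f hf h) (gl p) ((|d| + 1) * δ') := by
    refine supportedNear_perronFrobenius hns ?_
    filter_upwards [hs', hm] with x hx1 hx2 hne
    rw [hx2 hne]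
    have h1 := hx1 hne
    refine lt_of_le_of_lt (hnear x (h1.le.trans hδ')).2.2 ?_
    exact mul_lt_mul_of_pos_left h1 (by positivity)
  have hmain : perronFrobenius f hf h ∈ BV ∧
      bvar (perronFrobenius f hf h) ≤ (|d|⁻¹ + η) * bvar h + B * ‖h‖ := by
    refine mem_BV_of_bound fun φ hφ hφs hφb => ?_
    have hφ' : Continuous (deriv φ) := hφ.continuous_deriv le_rfl
    obtain ⟨Kφ, hKφ⟩ := hφs.deriv.exists_bound_of_continuous hφ'
    rw [perronFrobenius_integral_mul hns h (ψ := fun y : I => deriv φ (y : ℝ))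
      (hφ'.measurable.comp measurable_subtype_coe) (fun y => hKφ y)]
    -- `Φ = φ ∘ F / F'` has the derivative `u = φ' ∘ F - w`
    set Φ : ℝ → ℂ := fun x => (F₁ x)⁻¹ • φ (F x) with hΦ
    set w : ℝ → ℂ := fun x => (F₂ x / F₁ x ^ 2) • φ (F x) with hw
    set u : ℝ → ℂ := fun x => deriv φ (F x) - w x with hu
    have hwm : Measurable w := (hF₂m.div (hF₁c.measurable.pow_const 2)).smul
      (hφ.continuous.measurable.comp hFc.measurable)
    have hum : Measurable u := (hφ'.measurable.comp hFc.measurable).sub hwm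
    have hwb : ∀ x, |x - p| ≤ δ → ‖w x‖ ≤ B := by
      intro x hx
      simp only [hw]
      rw [norm_smul, Real.norm_eq_abs]
      exact (mul_le_of_le_one_right (abs_nonneg _) (hφb _)).trans (hF₂b x hx)
    have h1 : ‖∫ x : I, (Set.Ioo (p - δ) (p + δ)).indicator u x * h x‖
        ≤ (|d|⁻¹ + η) * bvar h := by
      refine norm_integral_indicator_deriv_le hh (Φ := Φ) hum (K := Kφ + B) (s := {p})
        (fun t ht => ?_) (by linarith) (Set.countable_singleton p) ?_ (fun x hx => ?_) hpos
        (fun x hx => ?_)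
      · exact (norm_sub_le _ _).trans (add_le_add (hKφ _) (hwb t ((habs' t).1 ht).le))
      · exact (hF₁c.continuousOn.inv₀ fun x hx => (hnear x ((habs x).1 hx)).1).smul
          (hφ.continuous.comp hFc).continuousOn
      · have hne := (hnear x ((habs' x).1 hx.1).le).1
        obtain ⟨d1, d2⟩ := hFd x hx.2
        have d3 : HasDerivAt (fun x => φ (F x)) (F₁ x • deriv φ (F x)) x :=
          (hφ.differentiable one_ne_zero (F x)).hasDerivAt.scomp x d1
        have d4 := (d2.fun_inv hne).fun_smul d3
        refine d4.congr_deriv ?_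
        rw [smul_smul, inv_mul_cancel₀ hne, one_smul, neg_div, neg_smul, ← sub_eq_add_neg]
      · simp only [hΦ]
        rw [norm_smul, Real.norm_eq_abs]
        exact (mul_le_of_le_one_right (abs_nonneg _) (hφb _)).trans (hnear x ((habs x).1 hx)).2.1
    have hwI : ∀ x, ‖(Set.Ioo (p - δ) (p + δ)).indicator w x‖ ≤ B := by
      intro x
      by_cases hx : x ∈ Set.Ioo (p - δ) (p + δ)
      · rw [Set.indicator_of_mem hx]; exact hwb x ((habs' x).1 hx).le
      · rw [Set.indicator_of_notMem hx, norm_zero]; positivity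
    have huI : ∀ x, ‖(Set.Ioo (p - δ) (p + δ)).indicator u x‖ ≤ Kφ + B := by
      intro x
      have hK0 := (norm_nonneg _).trans (hKφ 0)
      by_cases hx : x ∈ Set.Ioo (p - δ) (p + δ)
      · rw [Set.indicator_of_mem hx]
        exact (norm_sub_le _ _).trans (add_le_add (hKφ _) (hwb x ((habs' x).1 hx).le))
      · rw [Set.indicator_of_notMem hx, norm_zero]; positivity
    have hi1 := integrable_bdd_mul_coeFn (ψ := fun x : I => (Set.Ioo (p - δ) (p + δ)).indicator u x)
      ((hum.indicator measurableSet_Ioo).comp measurable_subtype_coe) (fun x => huI x) h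
    have hi2 := integrable_bdd_mul_coeFn (ψ := fun x : I => (Set.Ioo (p - δ) (p + δ)).indicator w x)
      ((hwm.indicator measurableSet_Ioo).comp measurable_subtype_coe) (fun x => hwI x) h
    have h2 : ‖∫ x : I, (Set.Ioo (p - δ) (p + δ)).indicator w x * h x‖ ≤ B * ‖h‖ := by
      rw [L1.norm_eq_integral_norm, ← integral_const_mul]
      refine norm_integral_le_of_norm_le ((L1.integrable_coeFn h).norm.const_mul B)
        (ae_of_all _ fun x => ?_)
      rw [norm_mul]
      exact mul_le_mul_of_nonneg_right (hwI x) (norm_nonneg _)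
    have h3 : ∫ x : I, deriv φ (f x : ℝ) * h x
        = (∫ x : I, (Set.Ioo (p - δ) (p + δ)).indicator u x * h x)
          + ∫ x : I, (Set.Ioo (p - δ) (p + δ)).indicator w x * h x := by
      rw [← integral_add hi1 hi2]
      refine integral_congr_ae ?_
      filter_upwards [hs', hm] with x hx1 hx2
      by_cases hne : h x = 0
      · simp [hne]
      · have hx : (x : ℝ) ∈ Set.Ioo (p - δ) (p + δ) := (habs' _).2 ((hx1 hne).trans_le hδ')
        rw [Set.indicator_of_mem hx, Set.indicator_of_mem hx, ← add_mul, hx2 hne]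
        simp only [hu, sub_add_cancel]
        rfl
    rw [h3]
    exact (norm_add_le _ _).trans (add_le_add h1 h2)
  exact ⟨hmain.1, hmain.2, hsupp⟩

/-! ### One-sided branches of a piecewise `C²` map -/

theorem realMap_coe (f : I → I) (x : I) : realMap f x = f x := by
  rw [realMap, Set.projIcc_val]

theorem notMem_turningPoints_of_mem_nhds {f : I → I} {J : Set I} {p : I} (hJ : J ∈ 𝓝 p) {g : ℝ → ℝ}
    (hg : ContDiff ℝ 2 g) (hfg : ∀ x ∈ J, (f x : ℝ) = g x) : p ∉ turningPoints f := by
  simp only [turningPoints, Set.mem_ofPred_eq, not_not, HasDerivativeAt]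
  have h1 : realMap f =ᶠ[𝓝[Set.Icc 0 1] (p : ℝ)] g := by
    have : 𝓝[Set.Icc (0 : ℝ) 1] (p : ℝ) = map Subtype.val (𝓝 p) := (map_nhds_subtype_val p).symm
    rw [this, EventuallyEq, eventually_map]
    filter_upwards [hJ] with x hx
    rw [realMap_coe, hfg x hx]
  refine DifferentiableWithinAt.congr_of_eventuallyEq
    (hg.differentiable (by norm_num) (p : ℝ)).differentiableWithinAt h1 ?_
  rw [realMap_coe, hfg p (mem_of_mem_nhds hJ)]

/-- Every turning point is an end point of an interval of the partition. -/
theorem finite_turningPoints {f : I → I} (hf : IsPiecewiseC2 f) : (turningPoints f).Finite := by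
  obtain ⟨Z, -, hcov, hZ⟩ := hf
  refine Set.Finite.subset (s := ⋃ J ∈ Z, ({p | p ∈ J ∧ ∀ a ∈ J, p ≤ a} ∪ {p | p ∈ J ∧ ∀ a ∈ J, a ≤ p}))
    (Z.finite_toSet.biUnion fun J _ => Set.Finite.union ?_ ?_) fun p hp => ?_
  · exact Set.Subsingleton.finite fun a ha b hb => le_antisymm (ha.2 b hb.1) (hb.2 a ha.1)
  · exact Set.Subsingleton.finite fun a ha b hb => le_antisymm (hb.2 a ha.1) (ha.2 b hb.1)
  · obtain ⟨J, hJ, hpJ⟩ := Set.mem_iUnion₂.1 (hcov.symm ▸ Set.mem_univ p : p ∈ ⋃ J ∈ Z, J)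
    refine Set.mem_iUnion₂.2 ⟨J, hJ, ?_⟩
    obtain ⟨hoc, -, g, hg, -, hfg⟩ := hZ J hJ
    by_contra hcon
    rw [Set.mem_union, not_or] at hcon
    obtain ⟨c1, c2⟩ := hcon
    have : ∃ a ∈ J, a < p := by
      by_contra! h; exact c1 ⟨hpJ, h⟩
    obtain ⟨a, ha, hap⟩ := this
    have : ∃ b ∈ J, p < b := by
      by_contra! h; exact c2 ⟨hpJ, h⟩
    obtain ⟨b, hb, hpb⟩ := this
    exact notMem_turningPoints_of_mem_nhds (mem_of_superset (Icc_mem_nhds hap hpb) (hoc.out ha hb))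
      hg hfg hp

theorem zero_notMem_turningPoints {f : I → I} (hf : IsPiecewiseC2 f) : 0 ∉ turningPoints f := by
  obtain ⟨Z, -, hcov, hZ⟩ := hf
  obtain ⟨J, hJ, hpJ⟩ := Set.mem_iUnion₂.1 (hcov.symm ▸ Set.mem_univ 0 : (0 : I) ∈ ⋃ J ∈ Z, J)
  obtain ⟨hoc, hnt, g, hg, -, hfg⟩ := hZ J hJ
  obtain ⟨y, hy, hy0⟩ := hnt.exists_ne 0
  have hy0' : 0 < y := lt_of_le_of_ne unitInterval.nonneg' (Ne.symm hy0)
  refine notMem_turningPoints_of_mem_nhds (mem_of_superset (Iic_mem_nhds hy0') fun x hx => ?_) hg hfg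
  exact hoc.out hpJ hy ⟨unitInterval.nonneg', hx⟩

theorem one_notMem_turningPoints {f : I → I} (hf : IsPiecewiseC2 f) : 1 ∉ turningPoints f := by
  obtain ⟨Z, -, hcov, hZ⟩ := hf
  obtain ⟨J, hJ, hpJ⟩ := Set.mem_iUnion₂.1 (hcov.symm ▸ Set.mem_univ 1 : (1 : I) ∈ ⋃ J ∈ Z, J)
  obtain ⟨hoc, hnt, g, hg, -, hfg⟩ := hZ J hJ
  obtain ⟨y, hy, hy1⟩ := hnt.exists_ne 1
  have hy1' : y < 1 := lt_of_le_of_ne unitInterval.le_one' hy1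
  refine notMem_turningPoints_of_mem_nhds (mem_of_superset (Ici_mem_nhds hy1') fun x hx => ?_) hg hfg
  exact hoc.out hy hpJ ⟨hx, unitInterval.le_one'⟩

theorem coe_mem_nhdsWithin_Ioi {p : I} {δ : ℝ} (hδ : 0 < δ) :
    ∀ᶠ x : I in 𝓝[>] p, p < x ∧ (x : ℝ) < p + δ := by
  refine eventually_mem_nhdsWithin.and (nhdsWithin_le_nhds ?_)
  exact continuous_subtype_val.continuousAt.eventually_lt_const (by linarith)

theorem coe_mem_nhdsWithin_Iio {p : I} {δ : ℝ} (hδ : 0 < δ) :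
    ∀ᶠ x : I in 𝓝[<] p, x < p ∧ (p : ℝ) - δ < x := by
  refine eventually_mem_nhdsWithin.and (nhdsWithin_le_nhds ?_)
  exact continuous_subtype_val.continuousAt.eventually_const_lt (by linarith)

theorem neBot_nhdsWithin_Ioi {p : I} (hp : p < 1) : (𝓝[>] p).NeBot := nhdsGT_neBot_of_exists_gt ⟨1, hp⟩

theorem neBot_nhdsWithin_Iio {p : I} (hp : 0 < p) : (𝓝[<] p).NeBot := nhdsLT_neBot_of_exists_lt ⟨0, hp⟩

/-- To the right of `p` the map coincides with one of the `C²` functions of the partition, since one of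
the finitely many intervals contains points arbitrarily close to `p` on the right. -/
theorem exists_right_branch {f : I → I} (hf : IsPiecewiseC2 f) {p : I} (hp : p < 1) :
    ∃ g : ℝ → ℝ, ContDiff ℝ 2 g ∧ deriv g p ≠ 0 ∧
      (∃ δ > 0, ∀ x : I, p < x → (x : ℝ) < p + δ → (f x : ℝ) = g x) ∧
      ∃ q : I, g p = q ∧ Tendsto f (𝓝[>] p) (𝓝 q) := by
  obtain ⟨Z, -, hcov, hZ⟩ := hf
  have hne := neBot_nhdsWithin_Ioi hp
  have hfr : ∃ J ∈ Z, ∃ᶠ x in 𝓝[>] p, x ∈ J := by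
    by_contra! hcon
    have h1 : ∀ᶠ x in 𝓝[>] p, ∀ J ∈ Z, x ∉ J := (eventually_all_finset Z).2 fun J hJ => by
      simpa using hcon J hJ
    obtain ⟨x, hx⟩ := h1.exists
    obtain ⟨J, hJ, hxJ⟩ := Set.mem_iUnion₂.1 (hcov.symm ▸ Set.mem_univ x : x ∈ ⋃ J ∈ Z, J)
    exact hx J hJ hxJ
  obtain ⟨J, hJ, hfr⟩ := hfr
  obtain ⟨hoc, -, g, hg, hgd, hfg⟩ := hZ J hJ
  obtain ⟨x₀, hx₀, hpx₀⟩ := (hfr.and_eventually eventually_mem_nhdsWithin).exists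
  have hpx₀' : p < x₀ := hpx₀
  have hpcl : p ∈ closure J := mem_closure_iff_frequently.2 (hfr.filter_mono nhdsWithin_le_nhds)
  have hmatch : ∀ x : I, p < x → (x : ℝ) < p + ((x₀ : ℝ) - p) → (f x : ℝ) = g x := by
    intro x hpx hxx₀
    obtain ⟨y, hy, hyx⟩ := (hfr.and_eventually (Ioo_mem_nhdsGT hpx)).exists
    refine hfg x (hoc.out hy hx₀ ⟨hyx.2.le, ?_⟩)
    have : (x : ℝ) < x₀ := by linarith
    exact_mod_cast this.le
  have hδ : (0 : ℝ) < x₀ - p := sub_pos.2 (by exact_mod_cast hpx₀')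
  have hlim : Tendsto (fun x => (f x : ℝ)) (𝓝[>] p) (𝓝 (g p)) := by
    have h1 : Tendsto (fun x : I => g x) (𝓝[>] p) (𝓝 (g p)) :=
      ((hg.continuous.comp continuous_subtype_val).tendsto p).mono_left nhdsWithin_le_nhds
    refine h1.congr' ?_
    filter_upwards [coe_mem_nhdsWithin_Ioi hδ] with x hx
    exact (hmatch x hx.1 hx.2).symm
  have hmem : g p ∈ Set.Icc (0 : ℝ) 1 :=
    isClosed_Icc.mem_of_tendsto hlim (Eventually.of_forall fun x => (f x).2)
  exact ⟨g, hg, hgd p hpcl, ⟨_, hδ, hmatch⟩, ⟨g p, hmem⟩, rfl, tendsto_subtype_rng.2 hlim⟩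

theorem exists_left_branch {f : I → I} (hf : IsPiecewiseC2 f) {p : I} (hp : 0 < p) :
    ∃ g : ℝ → ℝ, ContDiff ℝ 2 g ∧ deriv g p ≠ 0 ∧
      (∃ δ > 0, ∀ x : I, x < p → (p : ℝ) - δ < x → (f x : ℝ) = g x) ∧
      ∃ q : I, g p = q ∧ Tendsto f (𝓝[<] p) (𝓝 q) := by
  obtain ⟨Z, -, hcov, hZ⟩ := hf
  have hne := neBot_nhdsWithin_Iio hp
  have hfr : ∃ J ∈ Z, ∃ᶠ x in 𝓝[<] p, x ∈ J := by
    by_contra! hcon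
    have h1 : ∀ᶠ x in 𝓝[<] p, ∀ J ∈ Z, x ∉ J := (eventually_all_finset Z).2 fun J hJ => by
      simpa using hcon J hJ
    obtain ⟨x, hx⟩ := h1.exists
    obtain ⟨J, hJ, hxJ⟩ := Set.mem_iUnion₂.1 (hcov.symm ▸ Set.mem_univ x : x ∈ ⋃ J ∈ Z, J)
    exact hx J hJ hxJ
  obtain ⟨J, hJ, hfr⟩ := hfr
  obtain ⟨hoc, -, g, hg, hgd, hfg⟩ := hZ J hJ
  obtain ⟨x₀, hx₀, hpx₀⟩ := (hfr.and_eventually eventually_mem_nhdsWithin).exists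
  have hpx₀' : x₀ < p := hpx₀
  have hpcl : p ∈ closure J := mem_closure_iff_frequently.2 (hfr.filter_mono nhdsWithin_le_nhds)
  have hmatch : ∀ x : I, x < p → (p : ℝ) - ((p : ℝ) - x₀) < x → (f x : ℝ) = g x := by
    intro x hpx hxx₀
    obtain ⟨y, hy, hyx⟩ := (hfr.and_eventually (Ioo_mem_nhdsLT hpx)).exists
    refine hfg x (hoc.out hx₀ hy ⟨?_, hyx.1.le⟩)
    have : (x₀ : ℝ) < x := by linarith
    exact_mod_cast this.le
  have hδ : (0 : ℝ) < p - x₀ := sub_pos.2 (by exact_mod_cast hpx₀')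
  have hlim : Tendsto (fun x => (f x : ℝ)) (𝓝[<] p) (𝓝 (g p)) := by
    have h1 : Tendsto (fun x : I => g x) (𝓝[<] p) (𝓝 (g p)) :=
      ((hg.continuous.comp continuous_subtype_val).tendsto p).mono_left nhdsWithin_le_nhds
    refine h1.congr' ?_
    filter_upwards [coe_mem_nhdsWithin_Iio hδ] with x hx
    exact (hmatch x hx.1 hx.2).symm
  have hmem : g p ∈ Set.Icc (0 : ℝ) 1 :=
    isClosed_Icc.mem_of_tendsto hlim (Eventually.of_forall fun x => (f x).2)
  exact ⟨g, hg, hgd p hpcl, ⟨_, hδ, hmatch⟩, ⟨g p, hmem⟩, rfl, tendsto_subtype_rng.2 hlim⟩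

theorem tendsto_of_notMem_turningPoints {f : I → I} {p : I} (hp : p ∉ turningPoints f) :
    Tendsto f (𝓝 p) (𝓝 (f p)) := by
  simp only [turningPoints, Set.mem_ofPred_eq, not_not, HasDerivativeAt] at hp
  have h1 : Tendsto (realMap f) (𝓝[Set.Icc 0 1] (p : ℝ)) (𝓝 (realMap f p)) := hp.continuousWithinAt
  rw [← map_nhds_subtype_val p, tendsto_map'_iff, realMap_coe] at h1
  refine tendsto_subtype_rng.2 (h1.congr fun x => ?_)
  exact realMap_coe f x

theorem deriv_eq_derivative_of_right {f : I → I} {p : I} (hp1 : p < 1) (hp : p ∉ turningPoints f)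
    {g : ℝ → ℝ} (hg : ContDiff ℝ 2 g) (hgp : g p = f p) {δ : ℝ} (hδ : 0 < δ)
    (hm : ∀ x : I, p < x → (x : ℝ) < p + δ → (f x : ℝ) = g x) : deriv g p = derivative f p := by
  simp only [turningPoints, Set.mem_ofPred_eq, not_not, HasDerivativeAt] at hp
  have hp1' : (p : ℝ) < 1 := by exact_mod_cast hp1
  have hmin : (p : ℝ) < min (p + δ) 1 := lt_min (by linarith) hp1'
  have h1 : HasDerivWithinAt (realMap f) (derivative f p) (Set.Ioi (p : ℝ)) p := by
    refine hp.hasDerivWithinAt.mono_of_mem_nhdsWithin ?_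
    filter_upwards [Ioo_mem_nhdsGT hmin] with t ht
    exact ⟨p.2.1.trans ht.1.le, (ht.2.trans_le (min_le_right _ _)).le⟩
  have h2 : HasDerivWithinAt (realMap f) (deriv g p) (Set.Ioi (p : ℝ)) p := by
    refine (hg.differentiable (by norm_num) (p : ℝ)).hasDerivAt.hasDerivWithinAt.congr_of_eventuallyEq
      ?_ (by rw [realMap_coe, hgp])
    filter_upwards [Ioo_mem_nhdsGT hmin] with t ht
    have htI : t ∈ Set.Icc (0 : ℝ) 1 := ⟨p.2.1.trans ht.1.le, (ht.2.trans_le (min_le_right _ _)).le⟩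
    have := realMap_coe f ⟨t, htI⟩
    rw [this]
    exact hm ⟨t, htI⟩ ht.1 (ht.2.trans_le (min_le_left _ _))
  exact (uniqueDiffWithinAt_Ioi (p : ℝ)).eq_deriv _ h2 h1

theorem deriv_eq_derivative_of_left {f : I → I} {p : I} (hp0 : 0 < p) (hp : p ∉ turningPoints f)
    {g : ℝ → ℝ} (hg : ContDiff ℝ 2 g) (hgp : g p = f p) {δ : ℝ} (hδ : 0 < δ)
    (hm : ∀ x : I, x < p → (p : ℝ) - δ < x → (f x : ℝ) = g x) : deriv g p = derivative f p := by
  simp only [turningPoints, Set.mem_ofPred_eq, not_not, HasDerivativeAt] at hp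
  have hp0' : 0 < (p : ℝ) := by exact_mod_cast hp0
  have hmax : max ((p : ℝ) - δ) 0 < p := max_lt (by linarith) hp0'
  have h1 : HasDerivWithinAt (realMap f) (derivative f p) (Set.Iio (p : ℝ)) p := by
    refine hp.hasDerivWithinAt.mono_of_mem_nhdsWithin ?_
    filter_upwards [Ioo_mem_nhdsLT hmax] with t ht
    exact ⟨((le_max_right _ _).trans_lt ht.1).le, ht.2.le.trans p.2.2⟩
  have h2 : HasDerivWithinAt (realMap f) (deriv g p) (Set.Iio (p : ℝ)) p := by
    refine (hg.differentiable (by norm_num) (p : ℝ)).hasDerivAt.hasDerivWithinAt.congr_of_eventuallyEq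
      ?_ (by rw [realMap_coe, hgp])
    filter_upwards [Ioo_mem_nhdsLT hmax] with t ht
    have htI : t ∈ Set.Icc (0 : ℝ) 1 :=
      ⟨((le_max_right _ _).trans_lt ht.1).le, ht.2.le.trans p.2.2⟩
    have := realMap_coe f ⟨t, htI⟩
    rw [this]
    exact hm ⟨t, htI⟩ ht.2 ((le_max_left _ _).trans_lt ht.1)
  exact (uniqueDiffWithinAt_Iio (p : ℝ)).eq_deriv _ h2 h1

/-- A choice, at every point `p`, of `C²` functions `left p` and `right p` which coincide with the
map on the two sides of `p`. At the end points of `[0,1]`, where one side is void, both are the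
branch on the other side. -/
structure Branches (f : I → I) where
  left : I → ℝ → ℝ
  right : I → ℝ → ℝ
  contDiff_left : ∀ p, ContDiff ℝ 2 (left p)
  contDiff_right : ∀ p, ContDiff ℝ 2 (right p)
  deriv_left_ne : ∀ p : I, deriv (left p) p ≠ 0
  deriv_right_ne : ∀ p : I, deriv (right p) p ≠ 0
  radius : I → ℝ
  radius_pos : ∀ p, 0 < radius p
  eq_left : ∀ p x : I, x < p → (p : ℝ) - radius p < x → (f x : ℝ) = left p x
  eq_right : ∀ p x : I, p < x → (x : ℝ) < p + radius p → (f x : ℝ) = right p x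
  leftValue : I → I
  rightValue : I → I
  left_apply : ∀ p : I, left p p = leftValue p
  right_apply : ∀ p : I, right p p = rightValue p
  turning : ∀ p ∈ turningPoints f,
    OneSidedValue f p (leftValue p) ∧ OneSidedValue f p (rightValue p)
  regular : ∀ p ∉ turningPoints f, leftValue p = f p ∧ rightValue p = f p ∧
    deriv (left p) p = derivative f p ∧ deriv (right p) p = derivative f p ∧
    OneSidedValue f p (f p)

theorem exists_branches {f : I → I} (hf : IsPiecewiseC2 f) : Nonempty (Branches f) := by
  have key : ∀ p : I, ∃ (gl gr : ℝ → ℝ) (ql qr : I) (δ : ℝ), ContDiff ℝ 2 gl ∧ ContDiff ℝ 2 gr ∧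
      deriv gl p ≠ 0 ∧ deriv gr p ≠ 0 ∧ 0 < δ ∧
      (∀ x : I, x < p → (p : ℝ) - δ < x → (f x : ℝ) = gl x) ∧
      (∀ x : I, p < x → (x : ℝ) < p + δ → (f x : ℝ) = gr x) ∧ gl p = ql ∧ gr p = qr ∧
      (p ∈ turningPoints f → OneSidedValue f p ql ∧ OneSidedValue f p qr) ∧
      (p ∉ turningPoints f → ql = f p ∧ qr = f p ∧
        deriv gl p = derivative f p ∧ deriv gr p = derivative f p ∧ OneSidedValue f p (f p)) := by
    intro p
    rcases eq_or_ne p 0 with h0 | h0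
    · have hp1 : p < 1 := by rw [h0]; exact zero_lt_one
      obtain ⟨g, hg, hgd, ⟨δ, hδ, hm⟩, q, hq, hlim⟩ := exists_right_branch hf hp1
      have hne := neBot_nhdsWithin_Ioi hp1
      refine ⟨g, g, q, q, δ, hg, hg, hgd, hgd, hδ, fun x hx _ => ?_, hm, hq, hq, fun hp => ?_,
        fun hp => ?_⟩
      · rw [h0] at hx; exact absurd hx (not_lt.2 unitInterval.nonneg')
      · rw [h0] at hp; exact absurd hp (zero_notMem_turningPoints hf)
      · have hc := (tendsto_of_notMem_turningPoints hp).mono_left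
          (nhdsWithin_le_nhds (s := Set.Ioi p))
        have hqe : q = f p := tendsto_nhds_unique hlim hc
        have hd := deriv_eq_derivative_of_right hp1 hp hg (by rw [hq, hqe]) hδ hm
        exact ⟨hqe, hqe, hd, hd, Or.inr ⟨hp1, hc⟩⟩
    have hp0 : 0 < p := lt_of_le_of_ne unitInterval.nonneg' (Ne.symm h0)
    have hneL := neBot_nhdsWithin_Iio hp0
    obtain ⟨g, hg, hgd, ⟨δ, hδ, hm⟩, q, hq, hlim⟩ := exists_left_branch hf hp0
    rcases eq_or_ne p 1 with h1 | h1
    · refine ⟨g, g, q, q, δ, hg, hg, hgd, hgd, hδ, hm, fun x hx _ => ?_, hq, hq, fun hp => ?_,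
        fun hp => ?_⟩
      · rw [h1] at hx; exact absurd hx (not_lt.2 unitInterval.le_one')
      · rw [h1] at hp; exact absurd hp (one_notMem_turningPoints hf)
      · have hc := (tendsto_of_notMem_turningPoints hp).mono_left
          (nhdsWithin_le_nhds (s := Set.Iio p))
        have hqe : q = f p := tendsto_nhds_unique hlim hc
        have hd := deriv_eq_derivative_of_left hp0 hp hg (by rw [hq, hqe]) hδ hm
        exact ⟨hqe, hqe, hd, hd, Or.inl ⟨hp0, hc⟩⟩
    have hp1 : p < 1 := lt_of_le_of_ne unitInterval.le_one' h1
    have hneR := neBot_nhdsWithin_Ioi hp1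
    obtain ⟨g', hg', hgd', ⟨δ', hδ', hm'⟩, q', hq', hlim'⟩ := exists_right_branch hf hp1
    refine ⟨g, g', q, q', min δ δ', hg, hg', hgd, hgd', lt_min hδ hδ',
      fun x hx hxd => hm x hx (by linarith [min_le_left δ δ']),
      fun x hx hxd => hm' x hx (by linarith [min_le_right δ δ']), hq, hq',
      fun hp => ⟨Or.inl ⟨hp0, hlim⟩, Or.inr ⟨hp1, hlim'⟩⟩, fun hp => ?_⟩
    have hc := (tendsto_of_notMem_turningPoints hp).mono_left
          (nhdsWithin_le_nhds (s := Set.Iio p))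
    have hc' := (tendsto_of_notMem_turningPoints hp).mono_left
          (nhdsWithin_le_nhds (s := Set.Ioi p))
    have hqe : q = f p := tendsto_nhds_unique hlim hc
    have hqe' : q' = f p := tendsto_nhds_unique hlim' hc'
    exact ⟨hqe, hqe', deriv_eq_derivative_of_left hp0 hp hg (by rw [hq, hqe]) hδ hm,
      deriv_eq_derivative_of_right hp1 hp hg' (by rw [hq', hqe']) hδ' hm', Or.inl ⟨hp0, hc⟩⟩
  choose gl gr ql qr δ h1 h2 h3 h4 h5 h6 h7 h8 h9 h10 h11 using key
  exact ⟨⟨gl, gr, h1, h2, h3, h4, δ, h5, h6, h7, ql, qr, h8, h9, h10, h11⟩⟩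

/-- On each interval of the partition, the change of variables formula shows that the preimage of a
null set is a null set. -/
theorem isNonsingular_deterministic {f : I → I} (hPC : IsPiecewiseC2 f) (hf : Measurable f) :
    IsNonsingular (Kernel.deterministic f hf) := by
  intro A hA hA0
  suffices h : volume (f ⁻¹' A) = 0 by
    have : ∀ᵐ x : I, x ∉ f ⁻¹' A := measure_eq_zero_iff_ae_notMem.1 h
    filter_upwards [this] with x hx
    rw [Kernel.deterministic_apply' hf x hA]
    simp [show f x ∉ A from hx]
  obtain ⟨Z, -, hcov, hZ⟩ := hPC
  have hsub : f ⁻¹' A ⊆ ⋃ J ∈ Z, (J ∩ f ⁻¹' A) := by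
    intro x hx
    obtain ⟨J, hJ, hxJ⟩ := Set.mem_iUnion₂.1 (hcov.symm ▸ Set.mem_univ x : x ∈ ⋃ J ∈ Z, J)
    exact Set.mem_iUnion₂.2 ⟨J, hJ, hxJ, hx⟩
  refine measure_mono_null hsub ((measure_biUnion_null_iff Z.countable_toSet).2 fun J hJ => ?_)
  obtain ⟨hoc, -, g, hg, hgd, hfg⟩ := hZ J hJ
  have hemb : MeasurableEmbedding (Subtype.val : I → ℝ) :=
    MeasurableEmbedding.subtype_coe measurableSet_Icc
  set S : Set ℝ := Subtype.val '' (J ∩ f ⁻¹' A) with hS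
  have hSm : MeasurableSet S := hemb.measurableSet_image.2 (hoc.measurableSet.inter (hf hA))
  rw [volume_eq_image, ← hS]
  have hJconv : Convex ℝ (Subtype.val '' J : Set ℝ) := by
    refine Set.OrdConnected.convex ⟨?_⟩
    rintro _ ⟨x, hx, rfl⟩ _ ⟨y, hy, rfl⟩ z hz
    exact ⟨⟨z, x.2.1.trans hz.1, hz.2.trans y.2.2⟩, hoc.out hx hy ⟨hz.1, hz.2⟩, rfl⟩
  have hgdiff : Differentiable ℝ g := hg.differentiable (by norm_num)
  have hinj : Set.InjOn g (Subtype.val '' J) := by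
    rcases hasDerivWithinAt_forall_lt_or_forall_gt_of_forall_ne hJconv
      (fun x _ => (hgdiff x).hasDerivAt.hasDerivWithinAt) (m := 0)
      (by rintro _ ⟨x, hx, rfl⟩; exact hgd x (subset_closure hx)) with h | h
    · exact (strictAntiOn_of_deriv_neg hJconv hgdiff.continuous.continuousOn
        fun x hx => h x (interior_subset hx)).injOn
    · exact (strictMonoOn_of_deriv_pos hJconv hgdiff.continuous.continuousOn
        fun x hx => h x (interior_subset hx)).injOn
  have hSJ : S ⊆ Subtype.val '' J := Set.image_mono Set.inter_subset_left
  have h1 := lintegral_image_eq_lintegral_abs_deriv_mul hSm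
    (fun x _ => (hgdiff x).hasDerivAt.hasDerivWithinAt) (hinj.mono hSJ) (fun _ => 1)
  have h2 : volume (g '' S) = 0 := by
    refine measure_mono_null (t := Subtype.val '' A) ?_ (by rw [← volume_eq_image, hA0])
    rintro _ ⟨_, ⟨x, hx, rfl⟩, rfl⟩
    exact ⟨f x, hx.2, hfg x hx.1⟩
  rw [setLIntegral_one, h2] at h1
  have hm : Measurable fun x => ENNReal.ofReal |deriv g x| * 1 :=
    ((measurable_deriv g).abs.ennreal_ofReal).mul_const 1
  have h3 := (ae_restrict_iff' hSm).1 ((lintegral_eq_zero_iff hm).1 h1.symm)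
  refine measure_eq_zero_iff_ae_notMem.2 ?_
  filter_upwards [h3] with x hx hxS
  have := hx hxS
  obtain ⟨y, hy, rfl⟩ := hxS
  simp only [mul_one, Pi.zero_apply, ENNReal.ofReal_eq_zero] at this
  exact hgd y (subset_closure hy.1) (abs_nonpos_iff.1 this)

/-- Strict differentiability of the map at points that are not turning points. -/
theorem Branches.exists_strict {f : I → I} (b : Branches f) {p : I} (hp : p ∉ turningPoints f)
    {η : ℝ} (hη : 0 < η) : ∃ δ > 0, ∀ s t : I, |(s : ℝ) - p| < δ → |(t : ℝ) - p| < δ →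
      |(f s : ℝ) - f t - derivative f p * ((s : ℝ) - t)| ≤ η * |(s : ℝ) - t| := by
  obtain ⟨hql, hqr, hdl, hdr, -⟩ := b.regular p hp
  have hst : ∀ g : ℝ → ℝ, ContDiff ℝ 2 g → deriv g p = derivative f p → ∃ δ > 0, ∀ s t : ℝ,
      |s - p| < δ → |t - p| < δ → |g s - g t - derivative f p * (s - t)| ≤ η * |s - t| := by
    intro g hg hgd
    have h1 : HasStrictDerivAt g (deriv g p) p :=
      hg.contDiffAt.hasStrictDerivAt (by norm_num)
    have h2 := (hasStrictFDerivAt_iff_isLittleO.1 h1.hasStrictFDerivAt).def hη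
    obtain ⟨δ, hδ, h3⟩ := Metric.eventually_nhds_iff.1 h2
    refine ⟨δ, hδ, fun s t hs ht => ?_⟩
    have := h3 (y := (s, t)) (by rw [Prod.dist_eq]; exact max_lt hs ht)
    simp only [ContinuousLinearMap.toSpanSingleton_apply, smul_eq_mul, Real.norm_eq_abs, hgd] at this
    rwa [mul_comm (derivative f p)]
  obtain ⟨δ₁, hδ₁, H₁⟩ := hst _ (b.contDiff_left p) hdl
  obtain ⟨δ₂, hδ₂, H₂⟩ := hst _ (b.contDiff_right p) hdr
  refine ⟨min (min δ₁ δ₂) (b.radius p), lt_min (lt_min hδ₁ hδ₂) (b.radius_pos p), ?_⟩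
  -- it suffices to treat ordered pairs
  suffices h : ∀ s t : I, (s : ℝ) ≤ t → |(s : ℝ) - p| < min (min δ₁ δ₂) (b.radius p) →
      |(t : ℝ) - p| < min (min δ₁ δ₂) (b.radius p) →
      |(f s : ℝ) - f t - derivative f p * ((s : ℝ) - t)| ≤ η * |(s : ℝ) - t| by
    intro s t hs ht
    rcases le_total (s : ℝ) t with hst | hst
    · exact h s t hst hs ht
    · have := h t s hst ht hs
      rw [abs_sub_comm (t : ℝ)] at this
      refine le_trans (le_of_eq ?_) this
      rw [← abs_neg]
      congr 1
      ring
  have hL : ∀ x : I, (x : ℝ) ≤ p → |(x : ℝ) - p| < min (min δ₁ δ₂) (b.radius p) →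
      (f x : ℝ) = b.left p x := by
    intro x hxp hx
    rcases hxp.lt_or_eq with h | h
    · refine b.eq_left p x h ?_
      have := (abs_lt.1 (hx.trans_le (min_le_right _ _))).1
      linarith
    · rw [Subtype.ext h, b.left_apply, hql]
  have hR : ∀ x : I, (p : ℝ) ≤ x → |(x : ℝ) - p| < min (min δ₁ δ₂) (b.radius p) →
      (f x : ℝ) = b.right p x := by
    intro x hxp hx
    rcases hxp.lt_or_eq with h | h
    · refine b.eq_right p x h ?_
      have := (abs_lt.1 (hx.trans_le (min_le_right _ _))).2
      linarith
    · rw [← Subtype.ext h, b.right_apply, hqr]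
  intro s t hst hs ht
  have m1 := min_le_left (min δ₁ δ₂) (b.radius p)
  have m2 := min_le_left δ₁ δ₂
  have m3 := min_le_right δ₁ δ₂
  rcases le_total (t : ℝ) p with htp | htp
  · rw [hL s (hst.trans htp) hs, hL t htp ht]
    exact H₁ s t (by linarith) (by linarith)
  rcases le_total (p : ℝ) s with hsp | hsp
  · rw [hR s hsp hs, hR t htp ht]
    exact H₂ s t (by linarith) (by linarith)
  · have a1 := H₁ s p (by linarith) (by simpa using hδ₁)
    have a2 := H₂ p t (by simpa using hδ₂) (by linarith)
    rw [hL s hsp hs, hR t htp ht]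
    rw [b.left_apply, hql] at a1
    rw [b.right_apply, hqr] at a2
    rw [abs_of_nonpos (by linarith : (s : ℝ) - p ≤ 0)] at a1
    rw [abs_of_nonpos (by linarith : (p : ℝ) - t ≤ 0)] at a2
    rw [abs_of_nonpos (by linarith : (s : ℝ) - t ≤ 0)]
    have a3 := abs_add_le (b.left p s - f p - derivative f p * ((s : ℝ) - p))
      (f p - b.right p t - derivative f p * ((p : ℝ) - t))
    have a4 : b.left p s - b.right p t - derivative f p * ((s : ℝ) - t)
        = (b.left p s - f p - derivative f p * ((s : ℝ) - p))
          + (f p - b.right p t - derivative f p * ((p : ℝ) - t)) := by ring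
    rw [a4]
    linarith

/-! ### Local Lasota–Yorke inequalities along pseudo-orbits -/

theorem SupportedNear.mono {h : L1} {p δ δ' : ℝ} (hs : SupportedNear h p δ) (hδ : δ ≤ δ') :
    SupportedNear h p δ' := by
  filter_upwards [hs] with x hx hxp using hx (hδ.trans hxp)

/-- Cutting a function at a point. -/
theorem exists_split {h : L1} (hh : h ∈ BV) (p : I) {δ : ℝ} (hs : SupportedNear h p δ) :
    ∃ hl hr : L1, h = hl + hr ∧
      (hl ∈ BV ∧ bvar hl ≤ bvar h ∧ ‖hl‖ ≤ ‖h‖ ∧ SupportedNear hl p δ ∧ (IsReal h → IsReal hl) ∧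
        ∀ᵐ x : I, hl x ≠ 0 → x < p ∧ (p : ℝ) - δ < x) ∧
      (hr ∈ BV ∧ bvar hr ≤ bvar h ∧ ‖hr‖ ≤ ‖h‖ ∧ SupportedNear hr p δ ∧ (IsReal h → IsReal hr) ∧
        ∀ᵐ x : I, hr x ≠ 0 → p < x ∧ (x : ℝ) < p + δ) := by
  have hw : ∀ S : Set ℝ, ∀ x : I, ‖S.indicator (fun _ => (1 : ℂ)) (x : ℝ)‖ ≤ 1 := by
    intro S x
    by_cases hx : (x : ℝ) ∈ S <;> simp [hx]
  have hwm : ∀ S : Set ℝ, MeasurableSet S →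
      Measurable fun x : I => S.indicator (fun _ => (1 : ℂ)) (x : ℝ) := fun S hS =>
    (measurable_const.indicator hS).comp measurable_subtype_coe
  obtain ⟨hl, hlx⟩ := exists_mul _ (hwm (Set.Iio (p : ℝ)) measurableSet_Iio) (hw _) h
  obtain ⟨hr, hrx⟩ := exists_mul _ (hwm (Set.Ioi (p : ℝ)) measurableSet_Ioi) (hw _) h
  obtain ⟨hlB, hlv⟩ := bvar_left_le hh p.2.1 hlx
  obtain ⟨hrB, hrv⟩ := bvar_right_le hh p.2.2 hrx
  refine ⟨hl, hr, ?_, ⟨hlB, hlv, ?_, ?_, fun hR => ?_, ?_⟩, hrB, hrv, ?_, ?_, fun hR => ?_, ?_⟩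
  · refine Lp.ext ?_
    filter_upwards [Lp.coeFn_add hl hr, hlx, hrx, ae_ne (p : ℝ)] with x h1 h2 h3 h4
    rw [h1, Pi.add_apply, h2, h3]
    rcases lt_or_gt_of_ne h4 with h5 | h5
    · simp [h5, show x ≤ p from h5.le]
    · simp [h5, show p ≤ x from h5.le]
  · simpa using norm_le_mul_of_eq_mul (hw _) hlx
  · filter_upwards [hs, hlx] with x h1 h2 h3
    rw [h2, h1 h3, mul_zero]
  · filter_upwards [hR, hlx] with x h1 h2
    rw [h2]
    by_cases hx : (x : ℝ) ∈ Set.Iio (p : ℝ)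
    · rw [Set.indicator_of_mem hx, one_mul, h1]
    · rw [Set.indicator_of_notMem hx, zero_mul, Complex.zero_im]
  · filter_upwards [hs, hlx] with x h1 h2 h3
    by_cases hx : (x : ℝ) ∈ Set.Iio (p : ℝ)
    · refine ⟨hx, ?_⟩
      by_contra hcon
      have h4 : δ ≤ |(x : ℝ) - p| := by
        rw [abs_sub_comm]
        exact le_trans (by linarith) (le_abs_self _)
      exact h3 (by rw [h2, h1 h4, mul_zero])
    · rw [h2, Set.indicator_of_notMem hx, zero_mul] at h3
      exact absurd rfl h3
  · simpa using norm_le_mul_of_eq_mul (hw _) hrx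
  · filter_upwards [hs, hrx] with x h1 h2 h3
    rw [h2, h1 h3, mul_zero]
  · filter_upwards [hR, hrx] with x h1 h2
    rw [h2]
    by_cases hx : (x : ℝ) ∈ Set.Ioi (p : ℝ)
    · rw [Set.indicator_of_mem hx, one_mul, h1]
    · rw [Set.indicator_of_notMem hx, zero_mul, Complex.zero_im]
  · filter_upwards [hs, hrx] with x h1 h2 h3
    by_cases hx : (x : ℝ) ∈ Set.Ioi (p : ℝ)
    · refine ⟨hx, ?_⟩
      by_contra hcon
      have h4 : δ ≤ |(x : ℝ) - p| := le_trans (by linarith) (le_abs_self _)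
      exact h3 (by rw [h2, h1 h4, mul_zero])
    · rw [h2, Set.indicator_of_notMem hx, zero_mul] at h3
      exact absurd rfl h3

/-- The unperturbed transfer operator is bounded on `BV`. -/
theorem exists_bvar_perronFrobenius_le {f : I → I} (b : Branches f) {hf : Measurable f}
    (hns : IsNonsingular (Kernel.deterministic f hf)) :
    ∃ A B : ℝ, 0 ≤ A ∧ 0 ≤ B ∧ ∀ h ∈ BV, perronFrobenius f hf h ∈ BV ∧
      bvar (perronFrobenius f hf h) ≤ A * bvar h + B * ‖h‖ := by
  have hloc : ∀ p : I, ∃ δ > 0, ∃ A B : ℝ, 0 ≤ A ∧ 0 ≤ B ∧ ∀ h ∈ BV, SupportedNear h p δ →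
      perronFrobenius f hf h ∈ BV ∧ bvar (perronFrobenius f hf h) ≤ A * bvar h + B * ‖h‖ := by
    intro p
    obtain ⟨δ₁, hδ₁, B₁, hB₁, H₁⟩ := exists_local_bvar_perronFrobenius_le hns (b.contDiff_left p)
      (b.contDiff_left p) rfl rfl rfl (b.deriv_left_ne p) one_pos
    obtain ⟨δ₂, hδ₂, B₂, hB₂, H₂⟩ := exists_local_bvar_perronFrobenius_le hns (b.contDiff_right p)
      (b.contDiff_right p) rfl rfl rfl (b.deriv_right_ne p) one_pos
    refine ⟨min (min δ₁ δ₂) (b.radius p), lt_min (lt_min hδ₁ hδ₂) (b.radius_pos p),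
      (|deriv (b.left p) p|⁻¹ + 1) + (|deriv (b.right p) p|⁻¹ + 1), B₁ + B₂, by positivity,
      by positivity, fun h hh hs => ?_⟩
    obtain ⟨hl, hr, hlr, ⟨hlB, hlv, hln, hls, -, hlx⟩, hrB, hrv, hrn, hrs, -, hrx⟩ :=
      exists_split hh p hs
    have m1 := min_le_left (min δ₁ δ₂) (b.radius p)
    have m2 := min_le_right (min δ₁ δ₂) (b.radius p)
    obtain ⟨l1, l2, -⟩ := H₁ hl hlB _ (m1.trans (min_le_left _ _)) hls (by
      filter_upwards [hlx] with x hx hne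
      rw [ite_self]
      exact b.eq_left p x (hx hne).1 (by linarith [(hx hne).2]))
    obtain ⟨r1, r2, -⟩ := H₂ hr hrB _ (m1.trans (min_le_right _ _)) hrs (by
      filter_upwards [hrx] with x hx hne
      rw [ite_self]
      exact b.eq_right p x (hx hne).1 (by linarith [(hx hne).2]))
    rw [hlr, map_add, ← hlr]
    refine ⟨BV.add_mem l1 r1, (bvar_add_le l1 r1).trans ?_⟩
    have k1 : (|deriv (b.left p) p|⁻¹ + 1) * bvar hl ≤ (|deriv (b.left p) p|⁻¹ + 1) * bvar h :=
      mul_le_mul_of_nonneg_left hlv (by positivity)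
    have k2 : (|deriv (b.right p) p|⁻¹ + 1) * bvar hr ≤ (|deriv (b.right p) p|⁻¹ + 1) * bvar h :=
      mul_le_mul_of_nonneg_left hrv (by positivity)
    have k3 := mul_le_mul_of_nonneg_left hln hB₁
    have k4 := mul_le_mul_of_nonneg_left hrn hB₂
    linarith
  choose δ hδ A B hA hB H using hloc
  obtain ⟨s, C, hC, hs⟩ := exists_localisation δ hδ
  refine ⟨∑ p ∈ s, A p, (∑ p ∈ s, A p) * C + ∑ p ∈ s, B p, Finset.sum_nonneg fun p _ => hA p,
    add_nonneg (mul_nonneg (Finset.sum_nonneg fun p _ => hA p) hC)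
      (Finset.sum_nonneg fun p _ => hB p), fun h hh => ?_⟩
  obtain ⟨g, hg, hgp, hgs⟩ := hs h hh
  have h1 : ∀ p ∈ s, perronFrobenius f hf (g p) ∈ BV := fun p hp =>
    (H p _ (hgp p hp).1 (hgp p hp).2.1).1
  have h2 : perronFrobenius f hf h = ∑ p ∈ s, perronFrobenius f hf (g p) := by rw [hg, map_sum]
  rw [h2]
  refine ⟨BV.sum_mem h1, (bvar_sum_le s _ h1).trans ?_⟩
  have h3 : ∀ p ∈ s, bvar (perronFrobenius f hf (g p)) ≤ (∑ p ∈ s, A p) * bvar (g p) + B p * ‖h‖ := by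
    intro p hp
    refine (H p _ (hgp p hp).1 (hgp p hp).2.1).2.trans (add_le_add ?_ ?_)
    · exact mul_le_mul_of_nonneg_right
        (Finset.single_le_sum (f := A) (fun q _ => hA q) hp) (bvar_nonneg _)
    · exact mul_le_mul_of_nonneg_left (hgp p hp).2.2.1 (hB p)
  refine (Finset.sum_le_sum h3).trans ?_
  rw [Finset.sum_add_distrib, ← Finset.mul_sum, ← Finset.sum_mul]
  have := mul_le_mul_of_nonneg_left hgs (Finset.sum_nonneg fun p (_ : p ∈ s) => hA p)
  linarith

/-- Regularity of the perturbation in terms of real numbers. -/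
theorem IsSmallPerturbation.exists_bvar_le {E : Set ℝ} {Q : ℝ → Kernel I I}
    [∀ ε, IsMarkovKernel (Q ε)] (hQ : IsSmallPerturbation E Q) :
    ∃ C : ℝ, 0 ≤ C ∧ ∀ ε ∈ E, ∀ h ∈ BV, IsReal h →
      transferOp (Q ε) h ∈ BV ∧ bvar (transferOp (Q ε) h) ≤ bvar h + C * ‖h‖ := by
  obtain ⟨C, hC⟩ := hQ.regularity
  refine ⟨C, C.2, fun ε hε h hh hr => ?_⟩
  have h1 := hC ε hε h hh hr
  have hfin : var h + C * ‖h‖ₑ ≠ ∞ :=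
    ENNReal.add_ne_top.2 ⟨ne_of_lt hh, ENNReal.mul_ne_top ENNReal.coe_ne_top enorm_ne_top⟩
  refine ⟨h1.trans_lt (lt_top_iff_ne_top.2 hfin), ?_⟩
  have h2 := ENNReal.toReal_mono hfin h1
  rwa [ENNReal.toReal_add (ne_of_lt hh) (ENNReal.mul_ne_top ENNReal.coe_ne_top enorm_ne_top),
    ENNReal.toReal_mul, toReal_enorm, ENNReal.coe_toReal] at h2

/-- `A` is an asymptotic variation bound at `p` for the `n`-th power of the perturbed operators: up to
an arbitrarily small error, and for all small `ε`, the variation of real functions supported close to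
`p` is multiplied by at most `A`, modulo a multiple of the `L¹` norm. -/
def LocalBound (f : I → I) (hf : Measurable f) (E : Set ℝ) (Q : ℝ → Kernel I I)
    [∀ ε, IsMarkovKernel (Q ε)] (n : ℕ) (p : I) (A : ℝ) : Prop :=
  ∀ η > 0, ∃ δ > 0, ∃ B : ℝ, 0 ≤ B ∧ ∃ ε₀ > 0, ∀ ε ∈ E, ε < ε₀ → ∀ h ∈ BV, IsReal h →
    SupportedNear h p δ → (perturbedOp f hf (Q ε) ^ n) h ∈ BV ∧
      bvar ((perturbedOp f hf (Q ε) ^ n) h) ≤ (A + η) * bvar h + B * ‖h‖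

section

variable {f : I → I} {hf : Measurable f} {E : Set ℝ} {Q : ℝ → Kernel I I}
  [∀ ε, IsMarkovKernel (Q ε)]

theorem localBound_zero (p : I) : LocalBound f hf E Q 0 p 1 := by
  intro η hη
  refine ⟨1, one_pos, 0, le_rfl, 1, one_pos, fun ε _ _ h hh _ _ => ?_⟩
  rw [pow_zero, Module.End.one_apply]
  refine ⟨hh, ?_⟩
  nlinarith [bvar_nonneg h]

/-- One step of the perturbed dynamics through a branch with derivative `d` at `p`: first the local
inequality for the map, then the perturbation, which enlarges the support by at most `ε`. -/
theorem LocalBound.branch (hns : IsNonsingular (Kernel.deterministic f hf))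
    (hQ : IsSmallPerturbation E Q) {n : ℕ} {q : I} {A : ℝ} (hA : 0 ≤ A)
    (hL : LocalBound f hf E Q n q A) {gl gr : ℝ → ℝ} (hl : ContDiff ℝ 2 gl)
    (hr : ContDiff ℝ 2 gr) {p d : ℝ} (hlq : gl p = q) (hlr : gl p = gr p) (hdl : deriv gl p = d)
    (hdr : deriv gr p = d) (hd : d ≠ 0) {η : ℝ} (hη : 0 < η) :
    ∃ δ > 0, ∃ B : ℝ, 0 ≤ B ∧ ∃ ε₀ > 0, ∀ ε ∈ E, ε < ε₀ → ∀ h ∈ BV, IsReal h →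
      SupportedNear h p δ →
      (∀ᵐ x : I, h x ≠ 0 → (f x : ℝ) = if (x : ℝ) ≤ p then gl x else gr x) →
      (perturbedOp f hf (Q ε) ^ (n + 1)) h ∈ BV ∧
      bvar ((perturbedOp f hf (Q ε) ^ (n + 1)) h) ≤ (A * |d|⁻¹ + η) * bvar h + B * ‖h‖ := by
  obtain ⟨C, hC, hreg⟩ := hQ.exists_bvar_le
  set D := |d|⁻¹ with hD
  have hD0 : 0 ≤ D := by positivity
  set η₁ := min 1 (η / (A + D + 1)) with hη₁
  have hη₁0 : 0 < η₁ := lt_min one_pos (by positivity)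
  have hprod : (A + η₁) * (D + η₁) ≤ A * D + η := by
    have h1 : η₁ ≤ 1 := min_le_left _ _
    have h2 : η₁ * (A + D + 1) ≤ η := by
      rw [← le_div_iff₀ (by positivity)]; exact min_le_right _ _
    nlinarith
  obtain ⟨δ₁, hδ₁, B₁, hB₁, ε₁, hε₁, H₁⟩ := hL η₁ hη₁0
  obtain ⟨δ₂, hδ₂, B₂, hB₂, H₂⟩ :=
    exists_local_bvar_perronFrobenius_le hns hl hr hlr hdl hdr hd hη₁0
  have hd1 : 0 < |d| + 1 := by positivity
  refine ⟨min δ₂ (δ₁ / 2 / (|d| + 1)), lt_min hδ₂ (by positivity),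
    (A + η₁) * (B₂ + C) + B₁, by positivity, min ε₁ (δ₁ / 2), lt_min hε₁ (by positivity),
    fun ε hε hεlt h hh hR hs hm => ?_⟩
  obtain ⟨k1, k2, k3⟩ := H₂ h hh _ (min_le_left _ _) hs hm
  set k := perronFrobenius f hf h with hk
  have hkn : ‖k‖ ≤ ‖h‖ := norm_transferOp_le hns h
  have hkR : IsReal k := isReal_transferOp hns hR
  obtain ⟨g1, g2⟩ := hreg ε hε k k1 hkR
  have hgn := norm_transferOp_le (hQ.nonsingular ε hε) k
  have hgR := isReal_transferOp (hQ.nonsingular ε hε) hkR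
  have hgs : SupportedNear (transferOp (Q ε) k) q δ₁ := by
    rw [← hlq]
    refine supportedNear_transferOp (hQ.nonsingular ε hε) (hQ.locality ε hε) ?_ k3
    have h1 : (|d| + 1) * min δ₂ (δ₁ / 2 / (|d| + 1)) ≤ δ₁ / 2 := by
      rw [mul_comm, ← le_div_iff₀ hd1]; exact min_le_right _ _
    have h2 := hεlt.trans_le (min_le_right _ _)
    linarith
  obtain ⟨r1, r2⟩ := H₁ ε hε (hεlt.trans_le (min_le_left _ _)) _ g1 hgR hgs
  have he : (perturbedOp f hf (Q ε) ^ (n + 1)) h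
      = (perturbedOp f hf (Q ε) ^ n) (transferOp (Q ε) k) := by
    rw [pow_succ, Module.End.mul_apply]
    rfl
  rw [he]
  refine ⟨r1, r2.trans ?_⟩
  have hn0 := norm_nonneg h
  have hv0 := bvar_nonneg h
  have e1 : bvar (transferOp (Q ε) k) ≤ (D + η₁) * bvar h + (B₂ + C) * ‖h‖ := by
    have := mul_le_mul_of_nonneg_left hkn hC
    linarith
  have e2 := mul_le_mul_of_nonneg_left e1 (show 0 ≤ A + η₁ by positivity)
  have e3 := mul_le_mul_of_nonneg_left (hgn.trans hkn) hB₁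
  have e4 := mul_le_mul_of_nonneg_right hprod hv0
  linarith

/-- At points that are not turning points the variation is simply divided by the slope. -/
theorem LocalBound.regular (b : Branches f) (hns : IsNonsingular (Kernel.deterministic f hf))
    (hQ : IsSmallPerturbation E Q) {n : ℕ} {p : I} (hp : p ∉ turningPoints f) {A : ℝ} (hA : 0 ≤ A)
    (hL : LocalBound f hf E Q n (f p) A) :
    LocalBound f hf E Q (n + 1) p (A * |derivative f p|⁻¹) := by
  intro η hη
  obtain ⟨hql, hqr, hdl, hdr, -⟩ := b.regular p hp
  obtain ⟨δ, hδ, B, hB, ε₀, hε₀, H⟩ := hL.branch hns hQ hA (b.contDiff_left p) (b.contDiff_right p)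
    (p := p) (by rw [b.left_apply, hql]) (by rw [b.left_apply, b.right_apply, hql, hqr]) hdl hdr
    (hdl ▸ b.deriv_left_ne p) hη
  refine ⟨min δ (b.radius p), lt_min hδ (b.radius_pos p), B, hB, ε₀, hε₀,
    fun ε hε hεlt h hh hR hs => H ε hε hεlt h hh hR (hs.mono (min_le_left _ _)) ?_⟩
  filter_upwards [hs, ae_ne (p : ℝ)] with x hx hxp hne
  have h1 : |(x : ℝ) - p| < b.radius p := by
    by_contra hcon
    exact hne (hx ((min_le_right _ _).trans (not_lt.1 hcon)))
  rw [abs_lt] at h1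
  rcases lt_or_gt_of_ne hxp with h2 | h2
  · rw [if_pos h2.le]
    exact b.eq_left p x h2 (by linarith)
  · rw [if_neg (not_le.2 h2)]
    exact b.eq_right p x h2 (by linarith)

/-- At a turning point a function is cut into two pieces, each of at most the same variation, which
then move along different branches. -/
theorem LocalBound.turning (b : Branches f) (hns : IsNonsingular (Kernel.deterministic f hf))
    (hQ : IsSmallPerturbation E Q) {n : ℕ} {p : I} {A A' : ℝ} (hA : 0 ≤ A) (hA' : 0 ≤ A')
    (hL : LocalBound f hf E Q n (b.leftValue p) A)
    (hL' : LocalBound f hf E Q n (b.rightValue p) A') :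
    LocalBound f hf E Q (n + 1) p
      (A * |deriv (b.left p) p|⁻¹ + A' * |deriv (b.right p) p|⁻¹) := by
  intro η hη
  obtain ⟨δ₁, hδ₁, B₁, hB₁, ε₁, hε₁, H₁⟩ := hL.branch hns hQ hA (b.contDiff_left p)
    (b.contDiff_left p) (p := p) (b.left_apply p) rfl rfl rfl (b.deriv_left_ne p) (half_pos hη)
  obtain ⟨δ₂, hδ₂, B₂, hB₂, ε₂, hε₂, H₂⟩ := hL'.branch hns hQ hA' (b.contDiff_right p)
    (b.contDiff_right p) (p := p) (b.right_apply p) rfl rfl rfl (b.deriv_right_ne p) (half_pos hη)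
  refine ⟨min (min δ₁ δ₂) (b.radius p), lt_min (lt_min hδ₁ hδ₂) (b.radius_pos p), B₁ + B₂,
    by positivity, min ε₁ ε₂, lt_min hε₁ hε₂, fun ε hε hεlt h hh hR hs => ?_⟩
  obtain ⟨hl, hr, hlr, ⟨hlB, hlv, hln, hls, hlR, hlx⟩, hrB, hrv, hrn, hrs, hrR, hrx⟩ :=
    exists_split hh p hs
  have m1 := min_le_left (min δ₁ δ₂) (b.radius p)
  have m2 := min_le_right (min δ₁ δ₂) (b.radius p)
  obtain ⟨l1, l2⟩ := H₁ ε hε (hεlt.trans_le (min_le_left _ _)) hl hlB (hlR hR)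
    (hls.mono (m1.trans (min_le_left _ _))) (by
      filter_upwards [hlx] with x hx hne
      rw [ite_self]
      exact b.eq_left p x (hx hne).1 (by linarith [(hx hne).2]))
  obtain ⟨r1, r2⟩ := H₂ ε hε (hεlt.trans_le (min_le_right _ _)) hr hrB (hrR hR)
    (hrs.mono (m1.trans (min_le_right _ _))) (by
      filter_upwards [hrx] with x hx hne
      rw [ite_self]
      exact b.eq_right p x (hx hne).1 (by linarith [(hx hne).2]))
  rw [hlr, map_add, ← hlr]
  refine ⟨BV.add_mem l1 r1, (bvar_add_le l1 r1).trans ?_⟩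
  have k1 := mul_le_mul_of_nonneg_left hlv
    (show 0 ≤ A * |deriv (b.left p) p|⁻¹ + η / 2 by positivity)
  have k2 := mul_le_mul_of_nonneg_left hrv
    (show 0 ≤ A' * |deriv (b.right p) p|⁻¹ + η / 2 by positivity)
  have k3 := mul_le_mul_of_nonneg_left hln hB₁
  have k4 := mul_le_mul_of_nonneg_left hrn hB₂
  linarith

end

/-! ### Decay on a subspace of finite codimension -/

section Decay

variable {V : Type*} [NormedAddCommGroup V] [NormedSpace ℂ V] [CompleteSpace V]

/-- The operator is injective on a closed complement of its kernel, with the same range, and a range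
with a closed complement is closed. -/
theorem isClosed_range_of_isCompl_ker (S : V →L[ℂ] V) (hfin : FiniteDimensional ℂ S.ker)
    (hc : IsCompl S.ker S.range) : IsClosed (S.range : Set V) := by
  obtain ⟨M, hMc, hM⟩ :=
    (Submodule.ClosedComplemented.of_finiteDimensional S.ker).exists_isClosed_isCompl
  have : CompleteSpace M := hMc.completeSpace_coe
  set g : M →L[ℂ] V := S.comp M.subtypeL with hg
  have hrange : g.range = S.range := by
    refine le_antisymm ?_ ?_
    · rintro _ ⟨x, rfl⟩
      exact ⟨x, rfl⟩
    · rintro _ ⟨x, rfl⟩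
      obtain ⟨y, hy, z, hz, rfl⟩ := Submodule.mem_sup.1 (hM.sup_eq_top ▸ Submodule.mem_top : x ∈ _ ⊔ M)
      refine ⟨⟨z, hz⟩, ?_⟩
      have hy' : S y = 0 := hy
      simp [hg, hy']
  have hker : g.ker = ⊥ := by
    refine (Submodule.eq_bot_iff _).2 fun x hx => ?_
    have h1 : (x : V) ∈ S.ker := hx
    have := (Submodule.disjoint_def.1 hM.disjoint) _ h1 x.2
    exact Subtype.ext this
  rw [← hrange]
  refine g.closed_complemented_range_of_isCompl_of_ker_eq_bot S.ker ?_
    S.isClosed_ker hker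
  rw [hrange]
  exact hc.symm

/-- The powers of an operator whose spectrum lies in the disk of radius `b₁ < b` decay like `bⁿ`. -/
theorem exists_norm_pow_le (T : V →L[ℂ] V) {b₁ b : ℝ} (hb : 0 < b) (hb₁ : b₁ < b)
    (hT : ∀ z ∈ spectrum ℂ T, ‖z‖ < b₁) : ∃ C : ℝ, 0 ≤ C ∧ ∀ n, ‖T ^ n‖ ≤ C * b ^ n := by
  have hr : spectralRadius ℂ T < ENNReal.ofReal b := by
    refine lt_of_le_of_lt (b := ENNReal.ofReal b₁) (iSup₂_le fun z hz => ?_)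
      ((ENNReal.ofReal_lt_ofReal_iff hb).2 hb₁)
    rw [← enorm_eq_nnnorm, ← ofReal_norm]
    exact ENNReal.ofReal_le_ofReal (hT z hz).le
  have h1 := (spectrum.pow_norm_pow_one_div_tendsto_nhds_spectralRadius T).eventually_lt_const hr
  obtain ⟨n₀, hn₀⟩ := eventually_atTop.1 (h1.and (eventually_gt_atTop 0))
  refine ⟨1 + ∑ i ∈ Finset.range n₀, ‖T ^ i‖ / b ^ i, by positivity, fun n => ?_⟩
  have hsum : 0 ≤ ∑ i ∈ Finset.range n₀, ‖T ^ i‖ / b ^ i := by positivity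
  rcases lt_or_ge n n₀ with hn | hn
  · have h2 : ‖T ^ n‖ / b ^ n ≤ ∑ i ∈ Finset.range n₀, ‖T ^ i‖ / b ^ i :=
      Finset.single_le_sum (f := fun i => ‖T ^ i‖ / b ^ i) (fun i _ => by positivity)
        (Finset.mem_range.2 hn)
    rw [← div_le_iff₀ (by positivity)]
    linarith
  · obtain ⟨h2, h3⟩ := hn₀ n hn
    rw [ENNReal.ofReal_lt_ofReal_iff hb] at h2
    have h4 : ‖T ^ n‖ ≤ b ^ n := by
      have h5 := pow_le_pow_left₀ (by positivity) h2.le n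
      rwa [one_div, Real.rpow_inv_natCast_pow (norm_nonneg _) h3.ne'] at h5
    have : 0 ≤ b ^ n := by positivity
    nlinarith

/-- If outside a disk the spectrum consists of isolated eigenvalues of finite multiplicity, then on a
subspace of finite codimension, the common kernel of the spectral projections, the powers of the
operator decay at the corresponding rate. -/
theorem exists_decay_of_isolated (T : V →L[ℂ] V) {a b : ℝ} (ha : 0 ≤ a) (hab : a < b)
    (hiso : ∀ z ∈ spectrum ℂ T, a < ‖z‖ → ¬ AccPt z (𝓟 (spectrum ℂ T)) ∧ ∃ k : ℕ, 1 ≤ k ∧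
      FiniteDimensional ℂ ((T - algebraMap ℂ _ z) ^ k).ker ∧
      IsCompl ((T - algebraMap ℂ _ z) ^ k).ker ((T - algebraMap ℂ _ z) ^ k).range) :
    ∃ (m : ℕ) (C : ℝ), 0 ≤ C ∧ ∀ e : Fin (m + 1) → V, ∃ c : Fin (m + 1) → ℂ, c ≠ 0 ∧
      ∀ n, ‖(T ^ n) (∑ j, c j • e j)‖ ≤ C * b ^ n * ‖∑ j, c j • e j‖ := by
  obtain ⟨b₁, hab₁, hb₁b⟩ := exists_between hab
  set D : ℂ → V →L[ℂ] V := fun z => T - algebraMap ℂ _ z with hD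
  have hDapp : ∀ z v, D z v = T v - z • v := fun z v => by
    simp [hD, Algebra.algebraMap_eq_smul_one]
  -- the finitely many eigenvalues outside the small disk
  set F : Set ℂ := spectrum ℂ T ∩ {z | b₁ ≤ ‖z‖} with hF
  have hFfin : F.Finite := by
    by_contra hinf
    have hcomp : IsCompact F := (spectrum.isCompact T).inter_right
      (isClosed_le continuous_const continuous_norm)
    obtain ⟨z, hz, hacc⟩ := Set.Infinite.exists_accPt_of_subset_isCompact hinf hcomp subset_rfl
    exact (hiso z hz.1 (hab₁.trans_le hz.2)).1
      (hacc.mono (principal_mono.2 Set.inter_subset_left))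
  have hex : ∀ z : F, ∃ k : ℕ, 1 ≤ k ∧ FiniteDimensional ℂ (D z ^ k).ker ∧
      IsCompl (D z ^ k).ker (D z ^ k).range := fun z => (hiso z z.2.1 (hab₁.trans_le z.2.2)).2
  choose k hk hfin hcompl using hex
  have : Finite F := hFfin
  have : Fintype F := Fintype.ofFinite F
  have hcomm : ∀ z w n, Commute (D w) (D z ^ n) := by
    intro z w n
    refine Commute.pow_right ?_ n
    refine Commute.sub_left (Commute.sub_right rfl ?_) (Commute.sub_right ?_ ?_)
    · exact (Algebra.commutes z T).symm
    · exact Algebra.commutes w T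
    · exact Algebra.commutes w _
  have hcommT : ∀ z n, Commute T (D z ^ n) := by
    intro z n
    refine Commute.pow_right (Commute.sub_right rfl ?_) n
    exact (Algebra.commutes z T).symm
  have happ : ∀ {A B : V →L[ℂ] V}, Commute A B → ∀ v, A (B v) = B (A v) := by
    intro A B h v
    have := congrArg (fun X : V →L[ℂ] V => X v) h.eq
    simpa using this
  -- the common kernel of the spectral projections
  set R : Submodule ℂ V := ⨅ z : F, (D z ^ k z).range with hR
  have hmemR : ∀ v, v ∈ R ↔ ∀ z : F, v ∈ (D z ^ k z).range := fun v => by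
    rw [hR, Submodule.mem_iInf]
  have hRclosed : IsClosed (R : Set V) := by
    have : (R : Set V) = ⋂ z : F, ((D z ^ k z).range : Set V) := by
      ext v
      rw [Set.mem_iInter]
      exact hmemR v
    rw [this]
    exact isClosed_iInter fun z => isClosed_range_of_isCompl_ker _ (hfin z) (hcompl z)
  have hRcompl : CompleteSpace R := hRclosed.completeSpace_coe
  have hTR : ∀ v ∈ R, T v ∈ R := by
    intro v hv
    refine (hmemR _).2 fun z => ?_
    obtain ⟨u, rfl⟩ := (hmemR _).1 hv z
    exact ⟨T u, (happ (hcommT z (k z)) u).symm⟩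
  set TR : R →L[ℂ] R := T.restrict hTR with hTRdef
  have hTRapp : ∀ v : R, ((TR v : R) : V) = T v := fun v => rfl
  -- `T - w` is a bijection of `R` for all `w` outside the small disk
  have hinj : ∀ w : ℂ, b₁ ≤ ‖w‖ → ∀ v ∈ R, D w v = 0 → v = 0 := by
    intro w hw v hv h0
    by_cases hwF : w ∈ spectrum ℂ T
    · have h1 : v ∈ (D w ^ k ⟨w, hwF, hw⟩).ker := by
        obtain ⟨j, hj⟩ := Nat.exists_eq_add_of_le (hk ⟨w, hwF, hw⟩)
        rw [LinearMap.mem_ker, ContinuousLinearMap.coe_coe, hj, add_comm, pow_succ]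
        simp [h0]
      exact Submodule.disjoint_def.1 (hcompl ⟨w, hwF, hw⟩).disjoint v h1 ((hmemR v).1 hv ⟨w, hwF, hw⟩)
    · have h1 := ContinuousLinearMap.isUnit_iff_bijective.1 (spectrum.notMem_iff.1 hwF)
      refine h1.1 ?_
      rw [map_zero, ← neg_sub, neg_apply, neg_eq_zero]
      exact h0
  have hsurj : ∀ w : ℂ, b₁ ≤ ‖w‖ → ∀ u ∈ R, ∃ v ∈ R, D w v = u := by
    intro w hw u hu
    have h1 : ∃ v, D w v = u ∧ ∀ h : w ∈ F, v ∈ (D w ^ k ⟨w, h⟩).range := by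
      by_cases hwF : w ∈ spectrum ℂ T
      · obtain ⟨x, hx⟩ := (hmemR u).1 hu ⟨w, hwF, hw⟩
        obtain ⟨y, hy, _, ⟨z, rfl⟩, rfl⟩ := Submodule.mem_sup.1
          ((hcompl ⟨w, hwF, hw⟩).sup_eq_top ▸ Submodule.mem_top : x ∈ _ ⊔ _)
        have hy' : (D w ^ k ⟨w, hwF, hw⟩) y = 0 := hy
        obtain ⟨j, hj⟩ := Nat.exists_eq_add_of_le (hk ⟨w, hwF, hw⟩)
        refine ⟨(D w ^ k ⟨w, hwF, hw⟩) ((D w ^ j) z), ?_, fun h => ⟨_, rfl⟩⟩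
        rw [← hx]
        simp only [map_add, ContinuousLinearMap.coe_coe]
        have h2 : D w ((D w ^ j) z) = (D w ^ k ⟨w, hwF, hw⟩) z := by
          rw [hj, add_comm, pow_succ']
          rfl
        rw [hy', zero_add, happ (hcomm w w _), h2]
      · obtain ⟨v, hv⟩ := (ContinuousLinearMap.isUnit_iff_bijective.1 (spectrum.notMem_iff.1 hwF)).2 (-u)
        refine ⟨v, ?_, fun h => absurd h.1 hwF⟩
        rw [← neg_sub, neg_apply, neg_inj] at hv
        exact hv
    obtain ⟨v, hv, hvw⟩ := h1
    refine ⟨v, (hmemR v).2 fun z => ?_, hv⟩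
    by_cases hzw : (z : ℂ) = w
    · subst hzw
      exact hvw z.2
    -- for `z ≠ w`, the component `y` of `v` in the spectral subspace of `z` is killed by `T - w`, and
    -- `T - w` is injective there
    obtain ⟨y, hy, x, hx, hyx⟩ := Submodule.mem_sup.1
      ((hcompl z).sup_eq_top ▸ Submodule.mem_top : v ∈ _ ⊔ _)
    have hy' : (D z ^ k z) y = 0 := hy
    have h2 : D w y ∈ (D z ^ k z).ker := by
      rw [LinearMap.mem_ker, ContinuousLinearMap.coe_coe, ← happ (hcomm z w (k z)), hy', map_zero]
    have h3 : D w y ∈ (D z ^ k z).range := by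
      have : D w y = u - D w x := by rw [← hv, ← hyx, map_add, add_sub_cancel_right]
      rw [this]
      refine Submodule.sub_mem _ ((hmemR u).1 hu z) ?_
      obtain ⟨t, rfl⟩ := hx
      exact ⟨D w t, (happ (hcomm z w (k z)) t).symm⟩
    have h4 : D w y = 0 := Submodule.disjoint_def.1 (hcompl z).disjoint _ h2 h3
    have h5 : D z y = (w - z) • y := by
      rw [hDapp] at h4 ⊢
      rw [sub_eq_zero.1 h4, sub_smul]
    have h6 : ∀ n, (D z ^ n) y = (w - z) ^ n • y := by
      intro n
      induction n with
      | zero => simp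
      | succ n ih => rw [pow_succ, mul_apply_eq_comp, h5, map_smul, ih, smul_smul, pow_succ,
          mul_comm]
    rw [h6] at hy'
    have h7 : y = 0 := (smul_eq_zero.1 hy').resolve_left
      (pow_ne_zero _ (sub_ne_zero.2 (Ne.symm hzw)))
    rw [← hyx, h7, zero_add]
    exact hx
  have hspec : ∀ w ∈ spectrum ℂ TR, ‖w‖ < b₁ := by
    intro w hw
    by_contra hcon
    have hwb := not_lt.1 hcon
    refine hw (ContinuousLinearMap.isUnit_iff_bijective.2 ⟨?_, fun u => ?_⟩)
    · refine (injective_iff_map_eq_zero _).2 fun v hv => ?_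
      have h1 : w • (v : V) - T v = 0 := by
        have := congrArg (Subtype.val) hv
        simpa [Algebra.algebraMap_eq_smul_one, hTRapp] using this
      refine Subtype.ext (hinj w hwb v v.2 ?_)
      rw [hDapp, ← neg_sub, h1, neg_zero]
    · obtain ⟨v, hv, hvu⟩ := hsurj w hwb (-u) (R.neg_mem u.2)
      refine ⟨⟨v, hv⟩, Subtype.ext ?_⟩
      have h1 : w • v - T v = u := by
        rw [hDapp] at hvu
        rw [← neg_sub, hvu, neg_neg]
      simpa [Algebra.algebraMap_eq_smul_one, hTRapp] using h1
  obtain ⟨C, hC, hpow⟩ := exists_norm_pow_le TR (ha.trans_lt hab) hb₁b hspec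
  have hpowapp : ∀ n (v : R), (((TR ^ n) v : R) : V) = (T ^ n) v := by
    intro n
    induction n with
    | zero => intro v; simp
    | succ n ih =>
      intro v
      rw [pow_succ, pow_succ, mul_apply_eq_comp, mul_apply_eq_comp, ih, hTRapp]
  set W := ∀ z : F, (D z ^ k z).ker
  have : FiniteDimensional ℂ W := by
    have := hfin
    infer_instance
  -- `m = dim W` conditions put a combination of `m + 1` vectors into `R`
  set L : V →ₗ[ℂ] W := LinearMap.pi fun z => Submodule.projectionOnto _ _ (hcompl z) with hL
  have hLker : ∀ v, L v = 0 → v ∈ R := by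
    intro v hv
    refine (hmemR v).2 fun z => ?_
    have h1 : Submodule.projectionOnto _ _ (hcompl z) v = 0 := congrFun hv z
    exact (Submodule.projectionOnto_apply_eq_zero_iff (hcompl z)).1 h1
  refine ⟨Module.finrank ℂ W, C, hC, fun e => ?_⟩
  set Φ : (Fin (Module.finrank ℂ W + 1) → ℂ) →ₗ[ℂ] W := L.comp (Fintype.linearCombination ℂ e) with hΦ
  have hne : Φ.ker ≠ ⊥ := LinearMap.ker_ne_bot_of_finrank_lt (by simp)
  obtain ⟨c, hc, hc0⟩ := (Submodule.ne_bot_iff _).1 hne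
  refine ⟨c, hc0, fun n => ?_⟩
  have hmem : ∑ j, c j • e j ∈ R := hLker _ hc
  have h1 := (TR ^ n).le_of_opNorm_le (hpow n) ⟨_, hmem⟩
  rw [← hpowapp n ⟨_, hmem⟩]
  exact h1

end Decay

/-! ### The Banach space `BV` -/

/-- `BV` as a type of its own, to carry the norm `bvNorm` instead of the norm of `L¹`. -/
def BVSpace : Type := BV

namespace BVSpace

instance : AddCommGroup BVSpace := inferInstanceAs (AddCommGroup BV)

instance : Module ℂ BVSpace := inferInstanceAs (Module ℂ BV)

/-- The inclusion of `BV` in `L¹`. -/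
def toL1 : BVSpace →ₗ[ℂ] L1 := BV.subtype

theorem toL1_mem (v : BVSpace) : toL1 v ∈ BV := v.2

theorem toL1_injective : Function.Injective toL1 := Subtype.val_injective

/-- An element of `BV` as an element of `BVSpace`. -/
def mk (h : L1) (hh : h ∈ BV) : BVSpace := (⟨h, hh⟩ : BV)

theorem toL1_mk {h : L1} (hh : h ∈ BV) : toL1 (mk h hh) = h := rfl

instance : Norm BVSpace := ⟨fun v => bvNorm (toL1 v)⟩

theorem norm_def (v : BVSpace) : ‖v‖ = bvar (toL1 v) + ‖toL1 v‖ := rfl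

theorem core : NormedSpace.Core ℂ BVSpace where
  norm_nonneg v := add_nonneg (bvar_nonneg _) (norm_nonneg _)
  norm_smul c v := by
    rw [norm_def, norm_def, map_smul, bvar_smul c (toL1_mem v), norm_smul, mul_add]
  norm_triangle v w := by
    rw [norm_def, norm_def, norm_def, map_add]
    linarith [bvar_add_le (toL1_mem v) (toL1_mem w), norm_add_le (toL1 v) (toL1 w)]
  norm_eq_zero_iff v := by
    rw [norm_def]
    constructor
    · intro h
      have h1 := bvar_nonneg (toL1 v)
      have h2 := norm_nonneg (toL1 v)
      exact toL1_injective (by rw [map_zero]; exact norm_eq_zero.1 (by linarith))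
    · rintro rfl
      rw [map_zero, bvar_zero, norm_zero, add_zero]

instance : NormedAddCommGroup BVSpace := NormedAddCommGroup.ofCore core

instance : NormedSpace ℂ BVSpace := NormedSpace.ofCore core

instance : CompleteSpace BVSpace := by
  refine Metric.complete_of_cauchySeq_tendsto fun u hu => ?_
  have hu1 : CauchySeq fun n => toL1 (u n) := by
    refine Metric.cauchySeq_iff'.2 fun ε hε => ?_
    obtain ⟨N, hN⟩ := Metric.cauchySeq_iff'.1 hu ε hε
    refine ⟨N, fun n hn => lt_of_le_of_lt ?_ (hN n hn)⟩
    rw [dist_eq_norm, dist_eq_norm, ← map_sub, norm_def (u n - u N)]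
    linarith [bvar_nonneg (toL1 (u n - u N))]
  obtain ⟨h, hh⟩ := cauchySeq_tendsto_of_complete hu1
  have key : ∀ ε > 0, ∃ N, ∀ n ≥ N, (toL1 (u n) - h ∈ BV ∧ bvar (toL1 (u n) - h) ≤ ε) := by
    intro ε hε
    obtain ⟨N, hN⟩ := Metric.cauchySeq_iff.1 hu ε hε
    refine ⟨N, fun n hn => mem_BV_of_tendsto (tendsto_const_nhds.sub hh) ?_⟩
    refine eventually_atTop.2 ⟨N, fun m hm => ?_⟩
    rw [← map_sub]
    refine ⟨toL1_mem _, ?_⟩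
    have := hN n hn m hm
    rw [dist_eq_norm, norm_def] at this
    linarith [norm_nonneg (toL1 (u n - u m))]
  have hBV : h ∈ BV := by
    obtain ⟨N, hN⟩ := key 1 one_pos
    have := BV.sub_mem (toL1_mem (u N)) (hN N le_rfl).1
    rwa [sub_sub_cancel] at this
  refine ⟨mk h hBV, Metric.tendsto_atTop.2 fun ε hε => ?_⟩
  obtain ⟨N₁, hN₁⟩ := key (ε / 2) (half_pos hε)
  obtain ⟨N₂, hN₂⟩ := Metric.tendsto_atTop.1 hh (ε / 2) (half_pos hε)
  refine ⟨max N₁ N₂, fun n hn => ?_⟩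
  rw [dist_eq_norm, norm_def, map_sub, toL1_mk]
  have h1 := (hN₁ n (le_of_max_le_left hn)).2
  have h2 := hN₂ n (le_of_max_le_right hn)
  rw [dist_eq_norm] at h2
  linarith

end BVSpace

open BVSpace

/-- An operator on `L¹` which is bounded in `BV`, as an operator on the Banach space `BV`. -/
def restrictBV (T : Module.End ℂ L1) {A B : ℝ} (hA : 0 ≤ A) (hB : 0 ≤ B)
    (hT : ∀ h ∈ BV, T h ∈ BV ∧ bvar (T h) ≤ A * bvar h + B * ‖h‖) (hT1 : ∀ h, ‖T h‖ ≤ ‖h‖) :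
    BVSpace →L[ℂ] BVSpace :=
  LinearMap.mkContinuous
    { toFun := fun v => mk (T (toL1 v)) (hT _ (toL1_mem v)).1
      map_add' := fun v w => toL1_injective (by
        rw [toL1_mk, map_add, map_add, map_add]; rfl)
      map_smul' := fun c v => toL1_injective (by
        rw [toL1_mk, map_smul, map_smul, map_smul]; rfl) } (A + B + 1) (fun v => by
    have h1 := (hT (toL1 v) (toL1_mem v)).2
    have h2 := hT1 (toL1 v)
    rw [norm_def, norm_def v]
    change bvar (T (toL1 v)) + ‖T (toL1 v)‖ ≤ _
    nlinarith [bvar_nonneg (toL1 v), norm_nonneg (toL1 v)])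

section

variable {T : Module.End ℂ L1} {A B : ℝ} {hA : 0 ≤ A} {hB : 0 ≤ B}
  {hT : ∀ h ∈ BV, T h ∈ BV ∧ bvar (T h) ≤ A * bvar h + B * ‖h‖} {hT1 : ∀ h, ‖T h‖ ≤ ‖h‖}

theorem toL1_restrictBV (v : BVSpace) : toL1 (restrictBV T hA hB hT hT1 v) = T (toL1 v) := rfl

theorem toL1_restrictBV_pow (n : ℕ) (v : BVSpace) :
    toL1 ((restrictBV T hA hB hT hT1 ^ n) v) = (T ^ n) (toL1 v) := by
  induction n generalizing v with
  | zero => simp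
  | succ n ih => rw [pow_succ, mul_apply_eq_comp, ih, pow_succ, Module.End.mul_apply, toL1_restrictBV]

theorem toL1_restrictBV_sub_pow (z : ℂ) (n : ℕ) (v : BVSpace) :
    toL1 (((restrictBV T hA hB hT hT1 - algebraMap ℂ _ z) ^ n) v)
      = ((T - algebraMap ℂ _ z) ^ n) (toL1 v) := by
  induction n generalizing v with
  | zero => simp
  | succ n ih =>
    rw [pow_succ, mul_apply_eq_comp, ih, pow_succ, Module.End.mul_apply]
    simp [Algebra.algebraMap_eq_smul_one, toL1_restrictBV]

theorem spectrum_restrictBV_subset : spectrum ℂ (restrictBV T hA hB hT hT1) ⊆ bvSpectrum T := by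
  intro z hz
  by_contra hcon
  simp only [bvSpectrum, Set.mem_compl_iff, not_not] at hcon
  obtain ⟨⟨-, hinj, hsurj⟩, -⟩ := hcon
  have happ : ∀ v : BVSpace, toL1 ((algebraMap ℂ (BVSpace →L[ℂ] BVSpace) z
      - restrictBV T hA hB hT hT1) v) = z • toL1 v - T (toL1 v) := fun v => by
    simp [Algebra.algebraMap_eq_smul_one, toL1_restrictBV]
  refine hz (ContinuousLinearMap.isUnit_iff_bijective.2 ⟨fun v w hvw => ?_, fun w => ?_⟩)
  · refine toL1_injective (hinj (toL1_mem v) (toL1_mem w) ?_)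
    simp only
    rw [← happ, ← happ, hvw]
  · obtain ⟨h, hh, hhw⟩ := hsurj (toL1_mem w)
    refine ⟨mk h hh, toL1_injective ?_⟩
    rw [happ]
    exact hhw

end

/-- Below the essential spectral radius: if it is less than `θt`, then the iterates decay faster than
`θtⁿ` on a subspace of finite codimension. -/
theorem exists_decay_of_essSpectralRadius_lt (T : Module.End ℂ L1) {A B : ℝ} (hA : 0 ≤ A)
    (hB : 0 ≤ B) (hT : ∀ h ∈ BV, T h ∈ BV ∧ bvar (T h) ≤ A * bvar h + B * ‖h‖)
    (hT1 : ∀ h, ‖T h‖ ≤ ‖h‖) {θt : ℝ} (hθ : essSpectralRadius T < ENNReal.ofReal θt) :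
    ∃ b : ℝ, 0 < b ∧ b < θt ∧ ∃ (m : ℕ) (C : ℝ), 0 ≤ C ∧ ∀ e : Fin (m + 1) → L1,
      (∀ j, e j ∈ BV) → ∃ c : Fin (m + 1) → ℂ, c ≠ 0 ∧
      ∀ n, bvar ((T ^ n) (∑ j, c j • e j)) ≤ C * b ^ n *
        (bvar (∑ j, c j • e j) + ‖∑ j, c j • e j‖) := by
  obtain ⟨θ, hθmem, hθlt⟩ := sInf_lt_iff.1 hθ
  have hθtop : θ ≠ ∞ := ne_top_of_lt hθlt
  have hθt : 0 < θt := by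
    by_contra hcon
    rw [ENNReal.ofReal_of_nonpos (not_lt.1 hcon)] at hθlt
    exact absurd hθlt not_lt_zero
  set a := θ.toReal with ha
  have ha0 : 0 ≤ a := ENNReal.toReal_nonneg
  have haθ : a < θt := by
    rw [← ENNReal.ofReal_toReal hθtop, ENNReal.ofReal_lt_ofReal_iff hθt] at hθlt
    exact hθlt
  obtain ⟨b, hab, hbθ⟩ := exists_between haθ
  set TB := restrictBV T hA hB hT hT1 with hTB
  have hiso : ∀ z ∈ spectrum ℂ TB, a < ‖z‖ → ¬ AccPt z (𝓟 (spectrum ℂ TB)) ∧ ∃ k : ℕ, 1 ≤ k ∧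
      FiniteDimensional ℂ ((TB - algebraMap ℂ _ z) ^ k).ker ∧
      IsCompl ((TB - algebraMap ℂ _ z) ^ k).ker ((TB - algebraMap ℂ _ z) ^ k).range := by
    intro z hz haz
    have hθz : θ < ‖z‖ₑ := by
      rw [← ENNReal.ofReal_toReal hθtop, ← ofReal_norm,
        ENNReal.ofReal_lt_ofReal_iff (ha0.trans_lt haz)]
      exact haz
    obtain ⟨-, hacc, -, k, hk, hfin, hdisj, hsup⟩ := hθmem z (spectrum_restrictBV_subset hz) hθz
    refine ⟨fun h => hacc (h.mono (principal_mono.2 spectrum_restrictBV_subset)), k, hk, ?_, ?_⟩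
    · have hmem : ∀ v : ((TB - algebraMap ℂ _ z) ^ k).ker,
          toL1 (v : BVSpace) ∈ LinearMap.ker ((T - algebraMap ℂ _ z) ^ k) ⊓ BV := by
        intro v
        refine ⟨?_, toL1_mem _⟩
        have hv : ((TB - algebraMap ℂ _ z) ^ k) (v : BVSpace) = 0 := v.2
        rw [SetLike.mem_coe, LinearMap.mem_ker, ← toL1_restrictBV_sub_pow (hA := hA) (hB := hB)
          (hT := hT) (hT1 := hT1), ← hTB, hv, map_zero]
      let ι : ((TB - algebraMap ℂ _ z) ^ k).ker →ₗ[ℂ]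
          (LinearMap.ker ((T - algebraMap ℂ _ z) ^ k) ⊓ BV : Submodule ℂ L1) :=
        LinearMap.codRestrict _ (toL1.comp (Submodule.subtype _)) hmem
      refine Module.Finite.of_injective ι fun v w hvw => ?_
      have h1 : toL1 (v : BVSpace) = toL1 (w : BVSpace) := by
        have := congrArg Subtype.val hvw
        exact this
      exact Subtype.ext (toL1_injective h1)
    · refine ⟨Submodule.disjoint_def.2 fun v hv hv' => ?_, codisjoint_iff.2 ?_⟩
      · obtain ⟨w, rfl⟩ := hv'
        have hv0 : ((TB - algebraMap ℂ _ z) ^ k) (((TB - algebraMap ℂ _ z) ^ k) w) = 0 := hv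
        have h1 : toL1 (((TB - algebraMap ℂ _ z) ^ k) w) ∈
            (LinearMap.ker ((T - algebraMap ℂ _ z) ^ k) ⊓ BV) ⊓
              BV.map ((T - algebraMap ℂ _ z) ^ k) := by
          refine ⟨⟨?_, toL1_mem _⟩, ?_⟩
          · rw [SetLike.mem_coe, LinearMap.mem_ker, ← toL1_restrictBV_sub_pow (hA := hA) (hB := hB)
              (hT := hT) (hT1 := hT1), ← hTB, hv0, map_zero]
          · rw [hTB, toL1_restrictBV_sub_pow]
            exact Submodule.mem_map_of_mem (toL1_mem w)
        rw [hdisj, Submodule.mem_bot] at h1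
        exact toL1_injective (by rw [map_zero]; exact h1)
      · refine (Submodule.eq_top_iff').2 fun v => ?_
        have h1 : toL1 v ∈ (LinearMap.ker ((T - algebraMap ℂ _ z) ^ k) ⊓ BV) ⊔
              BV.map ((T - algebraMap ℂ _ z) ^ k) := by
          rw [hsup]; exact toL1_mem v
        obtain ⟨y, hy, _, ⟨w, hw, rfl⟩, hyw⟩ := Submodule.mem_sup.1 h1
        refine Submodule.mem_sup.2
          ⟨mk y hy.2, ?_, ((TB - algebraMap ℂ _ z) ^ k) (mk w hw), ⟨mk w hw, rfl⟩, ?_⟩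
        · refine toL1_injective ?_
          rw [ContinuousLinearMap.coe_coe, hTB, toL1_restrictBV_sub_pow, map_zero]
          exact hy.1
        · refine toL1_injective ?_
          rw [map_add, hTB, toL1_restrictBV_sub_pow]
          exact hyw
  obtain ⟨m, C, hC, hm⟩ := exists_decay_of_isolated TB ha0 hab hiso
  refine ⟨b, ha0.trans_lt hab, hbθ, m, C, hC, fun e he => ?_⟩
  obtain ⟨c, hc, hn⟩ := hm fun j => mk (e j) (he j)
  refine ⟨c, hc, fun n => ?_⟩
  have h1 := hn n
  have h2 : toL1 (∑ j, c j • mk (e j) (he j)) = ∑ j, c j • e j := by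
    rw [map_sum]
    rfl
  rw [norm_def, norm_def, hTB, toL1_restrictBV_pow, h2] at h1
  linarith [norm_nonneg ((T ^ n) (∑ j, c j • e j))]

/-! ### The essential spectral radius bounds the reciprocal slopes of the iterates -/

/-- The half-open interval `(a, b]` as a subset of `[0,1]`. -/
def unitIoc (a b : ℝ) : Set I := {x | a < x ∧ (x : ℝ) ≤ b}

theorem measurableSet_unitIoc (a b : ℝ) : MeasurableSet (unitIoc a b) :=
  (measurableSet_Ioc (a := a) (b := b)).preimage measurable_subtype_coe

theorem volume_real_unitIoc {a b : ℝ} (ha : 0 ≤ a) (hab : a ≤ b) (hb : b ≤ 1) :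
    volume.real (unitIoc a b) = b - a := by
  have : (Subtype.val '' unitIoc a b : Set ℝ) = Set.Ioc a b := by
    ext t
    constructor
    · rintro ⟨x, hx, rfl⟩; exact hx
    · intro ht
      exact ⟨⟨t, ha.trans ht.1.le, ht.2.trans hb⟩, ht, rfl⟩
  rw [measureReal_def, volume_eq_image, this, ← measureReal_def, Real.volume_real_Ioc_of_le hab]

theorem setIntegral_unitIoc {a b : ℝ} (ha : 0 ≤ a) (hab : a ≤ b) (hb : b ≤ 1) (F : ℝ → ℂ) :
    ∫ x in unitIoc a b, F x = ∫ t in a..b, F t := by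
  have hemb : MeasurableEmbedding (Subtype.val : I → ℝ) :=
    MeasurableEmbedding.subtype_coe measurableSet_Icc
  have h1 := unitInterval.measurePreserving_coe.setIntegral_preimage_emb hemb F (Set.Ioc a b)
  have h2 : Set.Ioc a b ∩ Set.Icc (0 : ℝ) 1 = Set.Ioc a b :=
    Set.inter_eq_left.2 fun t ht => ⟨ha.trans ht.1.le, ht.2.trans hb⟩
  rw [Measure.restrict_restrict measurableSet_Ioc, h2] at h1
  rw [intervalIntegral.integral_of_le hab]
  exact h1

/-- The indicator function of an interval. -/
def iocIndicator (a b : ℝ) : L1 :=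
  indicatorConstLp 1 (measurableSet_unitIoc a b) (measure_ne_top _ _) (1 : ℂ)

theorem iocIndicator_ae (a b : ℝ) :
    iocIndicator a b =ᵐ[volume] (unitIoc a b).indicator fun _ => (1 : ℂ) :=
  indicatorConstLp_coeFn

theorem iocIndicator_mem_BV {a b : ℝ} (ha : 0 ≤ a) (hab : a ≤ b) (hb : b ≤ 1) :
    iocIndicator a b ∈ BV ∧ bvar (iocIndicator a b) ≤ 2 := by
  refine mem_BV_of_bound fun φ hφ hs hφb => ?_
  have h1 : ∫ x : I, deriv φ (x : ℝ) * iocIndicator a b x = φ b - φ a := by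
    have : ∫ x : I, deriv φ (x : ℝ) * iocIndicator a b x = ∫ x in unitIoc a b, deriv φ (x : ℝ) := by
      rw [← integral_indicator (measurableSet_unitIoc a b)]
      refine integral_congr_ae ?_
      filter_upwards [iocIndicator_ae a b] with x hx
      rw [hx]
      by_cases hxc : x ∈ unitIoc a b <;> simp [hxc]
    rw [this, setIntegral_unitIoc ha hab hb]
    exact intervalIntegral.integral_deriv_eq_sub
      (fun x _ => hφ.differentiable one_ne_zero x)
      ((hφ.continuous_deriv le_rfl).intervalIntegrable _ _)
  rw [h1]
  exact (norm_sub_le _ _).trans (by linarith [hφb a, hφb b])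

theorem norm_iocIndicator_le (a b : ℝ) : ‖iocIndicator a b‖ ≤ 1 := by
  rw [iocIndicator, norm_indicatorConstLp one_ne_zero ENNReal.one_ne_top]
  simp only [norm_one, one_mul, ENNReal.toReal_one, div_one, Real.rpow_one]
  exact measureReal_le_one

/-- Near a point whose first `n` iterates are not turning points, `fⁿ` is injective and Lipschitz with
any constant larger than its slope at the point. -/
theorem Branches.exists_iterate_nhd {f : I → I} (b : Branches f) (n : ℕ) (x : I)
    (hx : ∀ i < n, f^[i] x ∉ turningPoints f) {L : ℝ}
    (hL : ∏ i ∈ Finset.range n, |derivative f (f^[i] x)| < L) :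
    ∃ δ > 0, ∀ s t : I, |(s : ℝ) - x| < δ → |(t : ℝ) - x| < δ →
      |(f^[n] s : ℝ) - f^[n] t| ≤ L * |(s : ℝ) - t| ∧ (f^[n] s = f^[n] t → s = t) := by
  induction n generalizing x L with
  | zero =>
    refine ⟨1, one_pos, fun s t _ _ => ⟨?_, fun h => h⟩⟩
    rw [Finset.prod_range_zero] at hL
    simp only [Function.iterate_zero, id_eq]
    nlinarith [abs_nonneg ((s : ℝ) - t)]
  | succ n ih =>
    rw [Finset.prod_range_succ'] at hL
    simp only [Function.iterate_succ_apply, Function.iterate_zero, id_eq] at hL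
    set P := ∏ i ∈ Finset.range n, |derivative f (f^[i] (f x))| with hP
    set d := derivative f x with hd
    have hx0 : x ∉ turningPoints f := hx 0 (Nat.succ_pos n)
    have hd0 : 0 < |d| := by
      obtain ⟨-, -, hdl, -, -⟩ := b.regular x hx0
      rw [hd, ← hdl]
      exact abs_pos.2 (b.deriv_left_ne x)
    have hP0 : 0 ≤ P := Finset.prod_nonneg fun _ _ => abs_nonneg _
    obtain ⟨η, hη, hηd, hηL⟩ : ∃ η > 0, η < |d| ∧ (P + η) * (|d| + η) < L := by
      have h1 : Tendsto (fun η : ℝ => (P + η) * (|d| + η)) (𝓝[>] 0) (𝓝 ((P + 0) * (|d| + 0))) :=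
        (Continuous.tendsto (by fun_prop) 0).mono_left nhdsWithin_le_nhds
      rw [add_zero, add_zero] at h1
      obtain ⟨η, h2, h3⟩ := ((h1.eventually_lt_const hL).and (Ioo_mem_nhdsGT hd0)).exists
      exact ⟨η, h3.1, h3.2, h2⟩
    obtain ⟨δ₁, hδ₁, H₁⟩ := b.exists_strict hx0 hη
    obtain ⟨δ₂, hδ₂, H₂⟩ := ih (f x) (fun i hi => by
      have := hx (i + 1) (Nat.succ_lt_succ hi)
      rwa [Function.iterate_succ_apply] at this) (L := P + η) (by linarith)
    have hlip : ∀ s t : I, |(s : ℝ) - x| < δ₁ → |(t : ℝ) - x| < δ₁ →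
        |(f s : ℝ) - f t| ≤ (|d| + η) * |(s : ℝ) - t| := by
      intro s t hs ht
      have h1 := H₁ s t hs ht
      have h2 := abs_sub_abs_le_abs_sub ((f s : ℝ) - f t) (d * ((s : ℝ) - t))
      rw [abs_mul] at h2
      linarith
    refine ⟨min δ₁ (δ₂ / (|d| + η)), lt_min hδ₁ (by positivity), fun s t hs ht => ?_⟩
    have hs1 := hs.trans_le (min_le_left _ _)
    have ht1 := ht.trans_le (min_le_left _ _)
    have hnear : ∀ y : I, |(y : ℝ) - x| < min δ₁ (δ₂ / (|d| + η)) → |(f y : ℝ) - f x| < δ₂ := by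
      intro y hy
      refine (hlip y x (hy.trans_le (min_le_left _ _)) (by simpa using hδ₁)).trans_lt ?_
      rw [mul_comm, ← lt_div_iff₀ (by positivity)]
      exact hy.trans_le (min_le_right _ _)
    obtain ⟨h1, h2⟩ := H₂ (f s) (f t) (hnear s hs) (hnear t ht)
    rw [Function.iterate_succ_apply, Function.iterate_succ_apply]
    refine ⟨?_, fun h => ?_⟩
    · calc _ ≤ (P + η) * |(f s : ℝ) - f t| := h1
        _ ≤ (P + η) * ((|d| + η) * |(s : ℝ) - t|) :=
          mul_le_mul_of_nonneg_left (hlip s t hs1 ht1) (by linarith)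
        _ ≤ L * |(s : ℝ) - t| := by
          rw [← mul_assoc]
          exact mul_le_mul_of_nonneg_right hηL.le (abs_nonneg _)
    · have h3 := H₁ s t hs1 ht1
      rw [h2 h, sub_self, zero_sub, abs_neg, abs_mul] at h3
      by_contra hne
      have : 0 < |(s : ℝ) - t| := abs_pos.2 (sub_ne_zero.2 fun h' => hne (Subtype.ext h'))
      have := le_of_mul_le_mul_right h3 this
      linarith

/-- If the essential spectral radius is less than `θt`, then the reciprocal slopes of `fⁿ` along orbit
segments without turning points are `O(βⁿ)` for some `β < θt`. Some combination `h` of indicators of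
tiny disjoint intervals near the point lies in the subspace of decay. On the image of the interval with
the largest coefficient, the `n`-th iterate of `h` under the transfer operator has the height of `h`
divided by the slope, so that the decay of the variation bounds the reciprocal slope. -/
theorem Branches.exists_inv_slope_le {f : I → I} (b : Branches f) {hf : Measurable f}
    (hns : IsNonsingular (Kernel.deterministic f hf)) {θt : ℝ}
    (hθ : essSpectralRadius (perronFrobenius f hf) < ENNReal.ofReal θt) :
    ∃ β C : ℝ, 0 < β ∧ β < θt ∧ 0 < C ∧ ∀ (n : ℕ) (x : I), (∀ i < n, f^[i] x ∉ turningPoints f) →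
      (∏ i ∈ Finset.range n, |derivative f (f^[i] x)|)⁻¹ ≤ C * β ^ n := by
  obtain ⟨A, B, hA, hB, hAB⟩ := exists_bvar_perronFrobenius_le b hns
  obtain ⟨β, hβ, hβθ, m, C, hC, hdecay⟩ := exists_decay_of_essSpectralRadius_lt _ hA hB hAB
    (norm_transferOp_le hns) hθ
  refine ⟨β, 12 * (m + 1) * C + 1, hβ, hβθ, by positivity, fun n x hx => ?_⟩
  set P := ∏ i ∈ Finset.range n, |derivative f (f^[i] x)| with hP
  have hP0 : 0 < P := Finset.prod_pos fun i hi => by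
    obtain ⟨-, -, hdl, -, -⟩ := b.regular _ (hx i (Finset.mem_range.1 hi))
    rw [← hdl]
    exact abs_pos.2 (b.deriv_left_ne _)
  obtain ⟨δ, hδ, H⟩ := b.exists_iterate_nhd n x hx (L := 2 * P) (by linarith)
  -- disjoint intervals of length `s` close to `x`
  set u : ℝ := max 0 (x - δ / 2) with hu
  set v : ℝ := min 1 (x + δ / 2) with hv
  have huv : u < v := by
    have h0 := x.2.1
    have h1 := x.2.2
    rcases h0.lt_or_eq with h2 | h2
    · exact (max_lt h2 (by linarith)).trans_le (le_min h1 (by linarith))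
    · exact (max_le h0 (by linarith)).trans_lt (lt_min (by linarith) (by linarith))
  have hu0 : 0 ≤ u := le_max_left _ _
  have hv1 : v ≤ 1 := min_le_left _ _
  set s : ℝ := (v - u) / (m + 1) with hs
  have hs0 : 0 < s := div_pos (by linarith) (by positivity)
  have hsm : u + (m + 1) * s = v := by
    rw [hs]; field_simp; ring
  set lo : Fin (m + 1) → ℝ := fun j => u + (j : ℕ) * s with hlo
  have hlo0 : ∀ j, 0 ≤ lo j := fun j => by positivity
  have hlo1 : ∀ j, lo j + s ≤ v := fun j => by
    have : ((j : ℕ) : ℝ) ≤ m := by exact_mod_cast Nat.lt_succ_iff.1 j.2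
    rw [← hsm]
    simp only [hlo]
    nlinarith
  set K : Fin (m + 1) → Set I := fun j => unitIoc (lo j) (lo j + s) with hK
  have hKnear : ∀ j, ∀ y ∈ K j, |(y : ℝ) - x| < δ := by
    intro j y hy
    have h1 : u < y := lt_of_le_of_lt (by simp only [hlo]; nlinarith [(j : ℕ).cast_nonneg (α := ℝ)]) hy.1
    have h2 : (y : ℝ) ≤ v := hy.2.trans (hlo1 j)
    have h3 : (x : ℝ) - δ / 2 ≤ u := le_max_right _ _
    have h4 : v ≤ x + δ / 2 := min_le_right _ _
    rw [abs_lt]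
    constructor <;> linarith
  have hKdisj : ∀ i j, ∀ y, y ∈ K i → y ∈ K j → i = j := by
    have key : ∀ i j : Fin (m + 1), i < j → ∀ y, y ∈ K i → y ∉ K j := by
      intro i j hij y hyi hyj
      have h1 : ((i : ℕ) : ℝ) + 1 ≤ (j : ℕ) := by exact_mod_cast hij
      have h2 := hyi.2
      have h3 := hyj.1
      simp only [hlo] at h2 h3
      nlinarith
    intro i j y hyi hyj
    rcases lt_trichotomy i j with h | h | h
    · exact absurd hyj (key i j h y hyi)
    · exact h
    · exact absurd hyi (key j i h y hyj)
  have hvol : ∀ j, volume.real (K j) = s := fun j => by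
    rw [hK, volume_real_unitIoc (hlo0 j) (by linarith) ((hlo1 j).trans hv1)]
    ring
  set e : Fin (m + 1) → L1 := fun j => iocIndicator (lo j) (lo j + s) with he
  have heB : ∀ j, e j ∈ BV ∧ bvar (e j) ≤ 2 := fun j =>
    iocIndicator_mem_BV (hlo0 j) (by linarith) ((hlo1 j).trans hv1)
  obtain ⟨c, hc0, hc⟩ := hdecay e fun j => (heB j).1
  obtain ⟨j₀, hj₀⟩ := Finite.exists_max fun j => ‖c j‖
  have hcpos : 0 < ‖c j₀‖ := by
    obtain ⟨i, hi⟩ := Function.ne_iff.1 hc0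
    exact (norm_pos_iff.2 hi).trans_le (hj₀ i)
  set h : L1 := ∑ j, c j • e j with hh
  have hhB : h ∈ BV := BV.sum_mem fun j _ => BV.smul_mem _ (heB j).1
  have hbv : bvar h ≤ 2 * (m + 1) * ‖c j₀‖ := by
    refine (bvar_sum_le _ _ fun j _ => BV.smul_mem _ (heB j).1).trans ?_
    have : ∀ j ∈ (Finset.univ : Finset (Fin (m + 1))), bvar (c j • e j) ≤ ‖c j₀‖ * 2 := fun j _ => by
      rw [bvar_smul _ (heB j).1]
      exact mul_le_mul (hj₀ j) (heB j).2 (bvar_nonneg _) hcpos.le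
    refine (Finset.sum_le_sum this).trans_eq ?_
    rw [Finset.sum_const, Finset.card_univ, Fintype.card_fin, nsmul_eq_mul]
    push_cast
    ring
  have hnorm : ‖h‖ ≤ (m + 1) * ‖c j₀‖ := by
    refine (norm_sum_le _ _).trans ?_
    have : ∀ j ∈ (Finset.univ : Finset (Fin (m + 1))), ‖c j • e j‖ ≤ ‖c j₀‖ := fun j _ => by
      rw [norm_smul]
      exact (mul_le_of_le_one_right (norm_nonneg _) (norm_iocIndicator_le _ _)).trans (hj₀ j)
    refine (Finset.sum_le_sum this).trans_eq ?_
    rw [Finset.sum_const, Finset.card_univ, Fintype.card_fin, nsmul_eq_mul]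
    push_cast
    ring
  set T := perronFrobenius f hf with hT
  have hTB : (T ^ n) h ∈ BV := by
    have : ∀ k : ℕ, ∀ g ∈ BV, (T ^ k) g ∈ BV := by
      intro k
      induction k with
      | zero => intro g hg; simpa using hg
      | succ k ihk =>
        intro g hg
        rw [pow_succ, Module.End.mul_apply]
        exact ihk _ (hAB g hg).1
    exact this n h hhB
  -- the mass of the iterate on the image `W` of the interval `K j₀`, compared with the measure of `W`
  have hinj : Set.InjOn f^[n] (K j₀) := fun y hy z hz hyz =>
    (H y z (hKnear _ y hy) (hKnear _ z hz)).2 hyz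
  set W := f^[n] '' K j₀ with hW
  have hWm : MeasurableSet W :=
    (measurableSet_unitIoc _ _).image_of_measurable_injOn (hf.iterate n) hinj
  have hWint : ∫ y in W, (T ^ n) h y = s • c j₀ := by
    rw [setIntegral_perronFrobenius_pow hns n h hWm, ← integral_indicator (hf.iterate n hWm),
      ← hvol j₀, ← integral_indicator_const _ (measurableSet_unitIoc (lo j₀) (lo j₀ + s))]
    refine integral_congr_ae ?_
    have h1 : ⇑h =ᵐ[volume] fun y => ∑ j, (c j • e j : L1) y := by
      filter_upwards [Lp.coeFn_finsetSum (p := 1) (μ := (volume : Measure I)) Finset.univ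
        (fun j => c j • e j)] with y hy
      rw [hh, hy, Finset.sum_apply]
    filter_upwards [h1, ae_all_iff.2 fun j => Lp.coeFn_smul (c j) (e j),
      ae_all_iff.2 fun j => iocIndicator_ae (lo j) (lo j + s)] with y hy1 hy2 hy3
    classical
    have hval : ∀ j, (c j • e j : L1) y = if y ∈ K j then c j else 0 := by
      intro j
      rw [hy2 j, Pi.smul_apply, he, hy3 j]
      by_cases hyK : y ∈ K j
      · rw [if_pos hyK, Set.indicator_of_mem hyK]; simp
      · rw [if_neg hyK, Set.indicator_of_notMem hyK]; simp
    simp_rw [hval] at hy1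
    by_cases hyK : y ∈ K j₀
    · have hyW : y ∈ f^[n] ⁻¹' W := ⟨y, hyK, rfl⟩
      rw [Set.indicator_of_mem hyW, Set.indicator_of_mem (show y ∈ unitIoc _ _ from hyK), hy1,
        Finset.sum_eq_single j₀, if_pos hyK]
      · intro j _ hj
        exact if_neg fun hyj => hj (hKdisj _ _ y hyj hyK)
      · simp
    · rw [Set.indicator_of_notMem (show y ∉ unitIoc _ _ from hyK)]
      by_cases hyW : y ∈ f^[n] ⁻¹' W
      · rw [Set.indicator_of_mem hyW, hy1]
        refine Finset.sum_eq_zero fun j _ => if_neg fun hyj => hyK ?_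
        obtain ⟨z, hz, hzy⟩ := hyW
        rwa [← (H z y (hKnear _ z hz) (hKnear _ y hyj)).2 hzy]
      · exact Set.indicator_of_notMem hyW _
  have hWvol : volume.real W ≤ 4 * P * s := by
    have hne : (K j₀).Nonempty := by
      by_contra hempty
      rw [Set.not_nonempty_iff_eq_empty] at hempty
      have := hvol j₀
      rw [hempty, measureReal_empty] at this
      linarith
    obtain ⟨z, hz⟩ := hne
    have hsub : (Subtype.val '' W : Set ℝ) ⊆
        Metric.closedBall (f^[n] z : ℝ) (2 * P * s) := by
      rintro _ ⟨_, ⟨y, hy, rfl⟩, rfl⟩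
      rw [Metric.mem_closedBall, Real.dist_eq]
      refine (H y z (hKnear _ y hy) (hKnear _ z hz)).1.trans ?_
      refine mul_le_mul_of_nonneg_left ?_ (by positivity)
      rw [abs_le]
      constructor <;> linarith [hy.1, hy.2, hz.1, hz.2]
    rw [measureReal_def, volume_eq_image, ← measureReal_def]
    refine (measureReal_mono hsub measure_closedBall_lt_top.ne).trans_eq ?_
    rw [measureReal_def, Real.volume_closedBall, ENNReal.toReal_ofReal (by positivity)]
    ring
  have hmain := norm_setIntegral_le_volume_mul_bvar hTB hWm
  rw [hWint, norm_smul, Real.norm_of_nonneg hs0.le] at hmain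
  have h2 : bvar ((T ^ n) h) ≤ C * β ^ n * (3 * (m + 1) * ‖c j₀‖) :=
    (hc n).trans (mul_le_mul_of_nonneg_left (by linarith) (by positivity))
  have h3 : s * ‖c j₀‖ ≤ (4 * P * s) * (C * β ^ n * (3 * (m + 1) * ‖c j₀‖)) :=
    hmain.trans (mul_le_mul hWvol h2 (bvar_nonneg _) (by positivity))
  have h4 : s * ‖c j₀‖ * 1 ≤ s * ‖c j₀‖ * (P * (12 * (m + 1) * C * β ^ n)) := by
    refine le_trans (le_of_eq (mul_one _)) (h3.trans_eq ?_)
    ring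
  have h5 := le_of_mul_le_mul_left h4 (by positivity)
  rw [inv_le_iff_one_le_mul₀' hP0]
  refine h5.trans (mul_le_mul_of_nonneg_left ?_ hP0.le)
  exact mul_le_mul_of_nonneg_right (by linarith) (by positivity)

/-! ### The uniform Lasota–Yorke inequality -/

section

variable {f : I → I} {hf : Measurable f} {E : Set ℝ} {Q : ℝ → Kernel I I} [∀ ε, IsMarkovKernel (Q ε)]

/-- The turning points which can be reached from `p` by successive one-sided values of `f`. -/
def reachableTurningPoints (f : I → I) (p : I) : Set I :=
  {c ∈ turningPoints f | Relation.ReflTransGen (OneSidedValue f) p c}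

theorem ncard_reachable_le (hT : (turningPoints f).Finite) {p q : I} (h : OneSidedValue f p q) :
    (reachableTurningPoints f q).ncard ≤ (reachableTurningPoints f p).ncard :=
  Set.ncard_le_ncard (fun _ hc => ⟨hc.1, hc.2.head h⟩) (hT.subset fun _ hc => hc.1)

/-- Without periodic turning points, a turning point cannot be reached again once it has been left. -/
theorem ncard_reachable_lt (hT : (turningPoints f).Finite) (hPTP : periodicTurningPoints f = ∅)
    {p q : I} (hp : p ∈ turningPoints f) (h : OneSidedValue f p q) :
    (reachableTurningPoints f q).ncard < (reachableTurningPoints f p).ncard := by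
  refine Set.ncard_lt_ncard ⟨fun _ hc => ⟨hc.1, hc.2.head h⟩, fun hsub => ?_⟩
    (hT.subset fun _ hc => hc.1)
  have hp' : p ∈ reachableTurningPoints f p := ⟨hp, .refl⟩
  have : p ∈ periodicTurningPoints f := ⟨hp, .head' h (hsub hp').2⟩
  rw [hPTP] at this
  exact this

/-- The local variation bounds decay faster than `θtⁿ`, uniformly in the point: a pseudo-orbit consists
of boundedly many orbit segments without turning points, and along each of them the bound is multiplied
by a reciprocal slope. The constant `G` pays for one passage through a turning point. -/
theorem Branches.exists_localBound (b : Branches f)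
    (hns : IsNonsingular (Kernel.deterministic f hf)) (hT : (turningPoints f).Finite)
    (hPTP : periodicTurningPoints f = ∅) (hQ : IsSmallPerturbation E Q) {θt : ℝ}
    (hθ : essSpectralRadius (perronFrobenius f hf) < ENNReal.ofReal θt) :
    ∃ β K : ℝ, 0 < β ∧ β < θt ∧ 0 < K ∧
      ∀ n p, ∃ A, 0 ≤ A ∧ A ≤ K * β ^ n ∧ LocalBound f hf E Q n p A := by
  obtain ⟨β, C, hβ, hβθ, hC, hslope⟩ := b.exists_inv_slope_le hns hθ
  obtain ⟨D, hD⟩ := (hT.image fun c => |deriv (b.left c) c|⁻¹ + |deriv (b.right c) c|⁻¹).bddAbove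
  set G := max 1 (D * C / β) with hG
  have hG1 : 1 ≤ G := le_max_left _ _
  have hGD : D * C ≤ G * β := (div_le_iff₀ hβ).1 (le_max_right _ _)
  -- The point moves along an orbit segment `x, …, f^[j] x` without turning points; its slope is only
  -- estimated when the segment ends, so that the constant `C` occurs once per segment.
  set m : I → ℕ := fun p => (reachableTurningPoints f p).ncard with hm
  have claim : ∀ (n : ℕ) (x : I) (j : ℕ), (∀ i < j, f^[i] x ∉ turningPoints f) →
      ∃ A, 0 ≤ A ∧ LocalBound f hf E Q n (f^[j] x) A ∧
        A * (∏ i ∈ Finset.range j, |derivative f (f^[i] x)|)⁻¹ ≤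
          C * G ^ m (f^[j] x) * β ^ (n + j) := by
    intro n
    induction n with
    | zero =>
      intro x j hx
      refine ⟨1, zero_le_one, localBound_zero _, ?_⟩
      rw [one_mul, zero_add]
      refine (hslope j x hx).trans (mul_le_mul_of_nonneg_right ?_ (by positivity))
      exact le_mul_of_one_le_right hC.le (one_le_pow₀ hG1)
    | succ n ih =>
      intro x j hx
      set p := f^[j] x with hp
      set S := (∏ i ∈ Finset.range j, |derivative f (f^[i] x)|)⁻¹ with hS
      have hS0 : 0 ≤ S := inv_nonneg.2 (Finset.prod_nonneg fun _ _ => abs_nonneg _)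
      by_cases hpT : p ∈ turningPoints f
      · obtain ⟨hl, hr⟩ := b.turning p hpT
        obtain ⟨A, hA0, hA, hAle⟩ := ih (b.leftValue p) 0 (by simp)
        obtain ⟨A', hA'0, hA', hAle'⟩ := ih (b.rightValue p) 0 (by simp)
        simp only [Function.iterate_zero, id_eq, Finset.range_zero, Finset.prod_empty, inv_one,
          mul_one, add_zero] at hA hAle hA' hAle'
        refine ⟨_, by positivity, LocalBound.turning b hns hQ hA0 hA'0 hA hA', ?_⟩
        obtain ⟨k, hk⟩ : ∃ k, m p = k + 1 :=
          Nat.exists_eq_succ_of_ne_zero (ncard_reachable_lt hT hPTP hpT hl).ne_bot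
        have hkl : m (b.leftValue p) ≤ k := by
          have : m (b.leftValue p) < m p := ncard_reachable_lt hT hPTP hpT hl
          lia
        have hkr : m (b.rightValue p) ≤ k := by
          have : m (b.rightValue p) < m p := ncard_reachable_lt hT hPTP hpT hr
          lia
        have hup : ∀ i ≤ k, C * G ^ i * β ^ n ≤ C * G ^ k * β ^ n := fun i hi => by
          gcongr
        have h1 := hAle.trans (hup _ hkl)
        have h2 := hAle'.trans (hup _ hkr)
        have h3 : |deriv (b.left p) p|⁻¹ + |deriv (b.right p) p|⁻¹ ≤ D :=
          hD (Set.mem_image_of_mem _ hpT)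
        have h4 : A * |deriv (b.left p) p|⁻¹ + A' * |deriv (b.right p) p|⁻¹ ≤
            C * G ^ k * β ^ n * D := by
          refine (add_le_add (mul_le_mul_of_nonneg_right h1 (by positivity))
            (mul_le_mul_of_nonneg_right h2 (by positivity))).trans ?_
          rw [← mul_add]
          exact mul_le_mul_of_nonneg_left h3 (by positivity)
        have hD0 : 0 ≤ D := le_trans (by positivity) h3
        calc _ ≤ (C * G ^ k * β ^ n * D) * (C * β ^ j) :=
              mul_le_mul h4 (hslope j x hx) hS0 (by positivity)
          _ = (C * G ^ k * β ^ (n + j)) * (D * C) := by ring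
          _ ≤ (C * G ^ k * β ^ (n + j)) * (G * β) :=
              mul_le_mul_of_nonneg_left hGD (by positivity)
          _ = C * G ^ m p * β ^ (n + 1 + j) := by rw [hk]; ring
      · have hx' : ∀ i < j + 1, f^[i] x ∉ turningPoints f := fun i hi => by
          rcases Nat.lt_succ_iff_lt_or_eq.1 hi with h | rfl
          · exact hx i h
          · exact hpT
        obtain ⟨A, hA0, hA, hAle⟩ := ih x (j + 1) hx'
        rw [Function.iterate_succ_apply', ← hp] at hA hAle
        refine ⟨_, by positivity, LocalBound.regular b hns hQ hpT hA0 hA, ?_⟩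
        obtain ⟨-, -, -, -, hval⟩ := b.regular p hpT
        rw [Finset.prod_range_succ, mul_inv, ← hS, ← hp] at hAle
        calc _ = A * (S * |derivative f p|⁻¹) := by ring
          _ ≤ C * G ^ m (f p) * β ^ (n + (j + 1)) := hAle
          _ ≤ C * G ^ m p * β ^ (n + (j + 1)) := by
            gcongr
            exact ncard_reachable_le hT hval
          _ = C * G ^ m p * β ^ (n + 1 + j) := by ring
  refine ⟨β, C * G ^ (turningPoints f).ncard, hβ, hβθ, by positivity, fun n p => ?_⟩
  obtain ⟨A, hA0, hA, hAle⟩ := claim n p 0 (by simp)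
  simp only [Function.iterate_zero, id_eq, Finset.range_zero, Finset.prod_empty, inv_one,
    mul_one, add_zero] at hA hAle
  refine ⟨A, hA0, hAle.trans ?_, hA⟩
  gcongr
  exact Set.ncard_le_ncard (fun _ hc => hc.1) hT

/-- Summing the local bounds over the pieces of a function, cut at a scale which depends on the number
of iterations but not on the function, gives a Lasota–Yorke inequality uniform in the perturbation. -/
theorem exists_uniform_lasotaYorke {N : ℕ} {a : ℝ} (ha : 0 < a)
    (hloc : ∀ p : I, ∃ A, 0 ≤ A ∧ A ≤ a ∧ LocalBound f hf E Q N p A) :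
    ∃ B ε₀ : ℝ, 0 ≤ B ∧ 0 < ε₀ ∧ ∀ ε ∈ E, ε < ε₀ → ∀ h ∈ BV,
      bvar ((perturbedOp f hf (Q ε) ^ N) h) ≤ 4 * a * bvar h + B * ‖h‖ := by
  have : ∀ p : I, ∃ δ > 0, ∃ B, 0 ≤ B ∧ ∃ ε₀ > 0, ∀ ε ∈ E, ε < ε₀ → ∀ h ∈ BV, IsReal h →
      SupportedNear h p δ → (perturbedOp f hf (Q ε) ^ N) h ∈ BV ∧
        bvar ((perturbedOp f hf (Q ε) ^ N) h) ≤ 2 * a * bvar h + B * ‖h‖ := by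
    intro p
    obtain ⟨A, -, hA, hL⟩ := hloc p
    obtain ⟨δ, hδ, B, hB, ε₀, hε₀, H⟩ := hL a ha
    refine ⟨δ, hδ, B, hB, ε₀, hε₀, fun ε hε hlt h hh hR hs => ?_⟩
    obtain ⟨h1, h2⟩ := H ε hε hlt h hh hR hs
    refine ⟨h1, h2.trans ?_⟩
    have := mul_le_mul_of_nonneg_right (show A + a ≤ 2 * a by linarith) (bvar_nonneg h)
    linarith
  choose δ hδ B hB ε₀ hε₀ H using this
  obtain ⟨s, B', hB', hs⟩ := exists_localisation δ hδ
  obtain ⟨ε₁, hε₁, hε₁le⟩ : ∃ ε₁ > 0, ∀ p ∈ s, ε₁ ≤ ε₀ p := by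
    rcases s.eq_empty_or_nonempty with rfl | hne
    · exact ⟨1, one_pos, by simp⟩
    · exact ⟨s.inf' hne ε₀, (Finset.lt_inf'_iff _).2 fun p _ => hε₀ p,
        fun p hp => Finset.inf'_le _ hp⟩
  set B'' := 2 * a * B' + ∑ p ∈ s, B p with hB''
  have hB''0 : 0 ≤ B'' := add_nonneg (by positivity) (Finset.sum_nonneg fun p _ => hB p)
  have hreal : ∀ ε ∈ E, ε < ε₁ → ∀ h ∈ BV, IsReal h →
      (perturbedOp f hf (Q ε) ^ N) h ∈ BV ∧
      bvar ((perturbedOp f hf (Q ε) ^ N) h) ≤ 2 * a * bvar h + B'' * ‖h‖ := by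
    intro ε hε hlt h hh hR
    obtain ⟨g, hg, hgs, hsum⟩ := hs h hh
    have hp : ∀ p ∈ s, (perturbedOp f hf (Q ε) ^ N) (g p) ∈ BV ∧
        bvar ((perturbedOp f hf (Q ε) ^ N) (g p)) ≤ 2 * a * bvar (g p) + B p * ‖h‖ := by
      intro p hp
      obtain ⟨k1, k2, k3, k4⟩ := hgs p hp
      obtain ⟨l1, l2⟩ := H p ε hε (hlt.trans_le (hε₁le p hp)) (g p) k1 (k4 hR) k2
      exact ⟨l1, l2.trans (by linarith [mul_le_mul_of_nonneg_left k3 (hB p)])⟩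
    have himage : (perturbedOp f hf (Q ε) ^ N) h =
        ∑ p ∈ s, (perturbedOp f hf (Q ε) ^ N) (g p) := by
      conv_lhs => rw [hg]
      exact map_sum _ _ _
    rw [himage]
    refine ⟨BV.sum_mem fun p hps => (hp p hps).1, ?_⟩
    refine (bvar_sum_le _ _ fun p hps => (hp p hps).1).trans
      ((Finset.sum_le_sum fun p hps => (hp p hps).2).trans ?_)
    rw [Finset.sum_add_distrib, ← Finset.mul_sum, ← Finset.sum_mul]
    have := mul_le_mul_of_nonneg_left hsum (show 0 ≤ 2 * a by positivity)
    rw [hB'']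
    linarith
  refine ⟨2 * B'', ε₁, by positivity, hε₁, fun ε hε hlt h hh => ?_⟩
  obtain ⟨h₁, h₂, hsum, hR₁, hR₂, ⟨hB₁, hv₁, hn₁⟩, hB₂, hv₂, hn₂⟩ := exists_re_im hh
  obtain ⟨k1, k2⟩ := hreal ε hε hlt h₁ hB₁ hR₁
  obtain ⟨l1, l2⟩ := hreal ε hε hlt h₂ hB₂ hR₂
  have himage : (perturbedOp f hf (Q ε) ^ N) h = (perturbedOp f hf (Q ε) ^ N) h₁ +
      Complex.I • (perturbedOp f hf (Q ε) ^ N) h₂ := by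
    conv_lhs => rw [hsum]
    rw [map_add, map_smul]
  rw [himage]
  refine (bvar_add_le k1 (BV.smul_mem _ l1)).trans ?_
  rw [bvar_smul _ l1, Complex.norm_I, one_mul]
  have m1 := mul_le_mul_of_nonneg_left hv₁ (show 0 ≤ 2 * a by positivity)
  have m2 := mul_le_mul_of_nonneg_left hv₂ (show 0 ≤ 2 * a by positivity)
  have m3 := mul_le_mul_of_nonneg_left hn₁ hB''0
  have m4 := mul_le_mul_of_nonneg_left hn₂ hB''0
  linarith

/-- Eigenfunctions of the perturbed operators with eigenvalues of modulus greater than `θt`,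
normalised in `L¹`, have uniformly bounded variation. -/
theorem Branches.exists_bvar_eigenfunction_le (b : Branches f)
    (hns : IsNonsingular (Kernel.deterministic f hf)) (hT : (turningPoints f).Finite)
    (hPTP : periodicTurningPoints f = ∅) (hQ : IsSmallPerturbation E Q) {θt : ℝ}
    (hθ : essSpectralRadius (perronFrobenius f hf) < ENNReal.ofReal θt) :
    ∃ V ε₀ : ℝ, 0 ≤ V ∧ 0 < ε₀ ∧ ∀ ε ∈ E, ε < ε₀ → ∀ (z : ℂ) (h : L1), θt < ‖z‖ →
      IsEigenpair (perturbedOp f hf (Q ε)) z h → ‖h‖ = 1 → bvar h ≤ V := by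
  obtain ⟨β, K, hβ, hβθ, hK, hloc⟩ := b.exists_localBound hns hT hPTP hQ hθ
  have hθ0 : 0 < θt := hβ.trans hβθ
  -- the factor `4` accounts for the errors in the local bounds and for the splitting into real and imaginary part
  obtain ⟨N, hN⟩ : ∃ N : ℕ, (β / θt) ^ N < 1 / (4 * K) :=
    exists_pow_lt_of_lt_one (by positivity) ((div_lt_one hθ0).2 hβθ)
  have hgap : 4 * (K * β ^ N) < θt ^ N := by
    rw [div_pow, div_lt_div_iff₀ (by positivity) (by positivity)] at hN
    linarith
  obtain ⟨B, ε₀, hB, hε₀, H⟩ := exists_uniform_lasotaYorke (a := K * β ^ N) (by positivity)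
    (hloc N)
  refine ⟨B / (θt ^ N - 4 * (K * β ^ N)), ε₀, div_nonneg hB (by linarith), hε₀,
    fun ε hε hlt z h hz hE hnorm => ?_⟩
  obtain ⟨hh, -, heig⟩ := hE
  have hpow : ∀ n : ℕ, (perturbedOp f hf (Q ε) ^ n) h = z ^ n • h := by
    intro n
    induction n with
    | zero => simp
    | succ n ih => rw [pow_succ', Module.End.mul_apply, ih, map_smul, heig, smul_smul, pow_succ]
  have h1 := H ε hε hlt h hh
  rw [hpow, bvar_smul _ hh, norm_pow, hnorm, mul_one] at h1
  have h2 : θt ^ N * bvar h ≤ ‖z‖ ^ N * bvar h :=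
    mul_le_mul_of_nonneg_right (pow_le_pow_left₀ hθ0.le hz.le _) (bvar_nonneg _)
  rw [le_div_iff₀ (by linarith)]
  linarith

/-- Smallness for complex functions, from the real and the imaginary part. -/
theorem IsSmallPerturbation.exists_norm_sub_le (hQ : IsSmallPerturbation E Q) :
    ∃ d : ℝ → ℝ, Tendsto d (𝓝[E] 0) (𝓝 0) ∧
      ∀ ε ∈ E, ∀ h ∈ BV, ‖transferOp (Q ε) h - h‖ ≤ d ε * bvar h := by
  obtain ⟨d, hd, H⟩ := hQ.smallness
  have hreal : ∀ ε ∈ E, ∀ h ∈ BV, IsReal h → ‖transferOp (Q ε) h - h‖ ≤ d ε * bvar h := by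
    intro ε hε h hh hR
    have := ENNReal.toReal_mono (ENNReal.mul_ne_top ENNReal.coe_ne_top (ne_of_lt hh))
      (H ε hε h hh hR)
    rwa [ENNReal.toReal_mul, toReal_enorm, ENNReal.coe_toReal] at this
  refine ⟨fun ε => 2 * d ε, ?_, fun ε hε h hh => ?_⟩
  · simpa using (NNReal.tendsto_coe.2 hd).const_mul 2
  obtain ⟨h₁, h₂, hsum, hR₁, hR₂, ⟨hB₁, hv₁, -⟩, hB₂, hv₂, -⟩ := exists_re_im hh
  have himage : transferOp (Q ε) h - h = (transferOp (Q ε) h₁ - h₁) +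
      Complex.I • (transferOp (Q ε) h₂ - h₂) := by
    conv_lhs => rw [hsum]
    rw [map_add, map_smul, smul_sub]
    abel
  rw [himage]
  refine (norm_add_le _ _).trans ?_
  rw [norm_smul, Complex.norm_I, one_mul]
  have h1 := (hreal ε hε h₁ hB₁ hR₁).trans (mul_le_mul_of_nonneg_left hv₁ (d ε).2)
  have h2 := (hreal ε hε h₂ hB₂ hR₂).trans (mul_le_mul_of_nonneg_left hv₂ (d ε).2)
  simp only at h1 h2 ⊢
  linarith

end

end RandomPerturbation

end

theorem theorem1 (f : I → I) (hf : Measurable f) (hPE : IsPiecewiseExpanding f)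
    (hPTP : periodicTurningPoints f = ∅)
    (E : Set ℝ) (hE : ∀ ε ∈ E, 0 < ε)
    (Q : ℝ → Kernel I I) [∀ ε, IsMarkovKernel (Q ε)] (hQ : IsSmallPerturbation E Q)
    (θt : ℝ) (hθ : essSpectralRadius (perronFrobenius f hf) < ENNReal.ofReal θt)
    (ρ : ℝ → ℂ) (η : ℝ → L1)
    (hρ : ∀ ε ∈ E, θt < ‖ρ ε‖)
    (hη : ∀ ε ∈ E, IsEigenpair (perturbedOp f hf (Q ε)) (ρ ε) (η ε) ∧ ‖η ε‖ = 1)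
    (r : ℂ) (hr : MapClusterPt r (𝓝[E] 0) ρ) :
    ∃ (e : ℕ → ℝ) (h : L1), (∀ k, e k ∈ E) ∧ Tendsto e atTop (𝓝 0) ∧
      Tendsto (fun k => ρ (e k)) atTop (𝓝 r) ∧
      Tendsto (fun k => ‖η (e k) - h‖) atTop (𝓝 0) ∧
      IsEigenpair (perronFrobenius f hf) r h := by
  have hPC := hPE.1
  have hns := isNonsingular_deterministic hPC hf
  obtain ⟨b⟩ := exists_branches hPC
  obtain ⟨V, ε₀, hV, hε₀, hbv⟩ :=
    b.exists_bvar_eigenfunction_le hns (finite_turningPoints hPC) hPTP hQ hθ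
  obtain ⟨A, B, hA, hB, hAB⟩ := exists_bvar_perronFrobenius_le b hns
  obtain ⟨d, hd, hdle⟩ := hQ.exists_norm_sub_le
  -- parameters along which the eigenvalues converge to `r`
  have hne : (𝓝[E] (0 : ℝ) ⊓ comap ρ (𝓝 r)).NeBot := by
    rw [inf_comm, neBot_inf_comap_iff_map']
    exact hr
  obtain ⟨e₀, he₀⟩ := exists_seq_tendsto (𝓝[E] (0 : ℝ) ⊓ comap ρ (𝓝 r))
  have he₀E : Tendsto e₀ atTop (𝓝[E] 0) := he₀.mono_right inf_le_left
  have he₀ρ : Tendsto (ρ ∘ e₀) atTop (𝓝 r) := tendsto_comap_iff.1 (he₀.mono_right inf_le_right)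
  obtain ⟨n₀, hn₀⟩ := eventually_atTop.1 ((tendsto_nhdsWithin_iff.1 he₀E).2.and
    ((tendsto_nhdsWithin_iff.1 he₀E).1.eventually_lt_const hε₀))
  -- the shift by `n₀` keeps all parameters in the range of the uniform bound
  obtain ⟨h, s, hs, hhB, hlim⟩ := exists_tendsto_subseq_of_bvar_le (V := V)
    (u := fun k => η (e₀ (k + n₀))) fun k => by
      obtain ⟨h1, h2⟩ := hn₀ (k + n₀) (Nat.le_add_left _ _)
      exact ⟨(hη _ h1).1.1, hbv _ h1 h2 _ _ (hρ _ h1) (hη _ h1).1 (hη _ h1).2, (hη _ h1).2.le⟩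
  set e : ℕ → ℝ := fun k => e₀ (s k + n₀) with he
  have hshift : Tendsto (fun k => s k + n₀) atTop atTop :=
    (tendsto_add_atTop_nat n₀).comp hs.tendsto_atTop
  have heE : ∀ k, e k ∈ E ∧ e k < ε₀ := fun k => hn₀ _ (Nat.le_add_left _ _)
  have he0 : Tendsto e atTop (𝓝[E] 0) := he₀E.comp hshift
  have hρlim : Tendsto (fun k => ρ (e k)) atTop (𝓝 r) := he₀ρ.comp hshift
  have hηlim : Tendsto (fun k => η (e k)) atTop (𝓝 h) := hlim
  have hh1 : ‖h‖ = 1 := by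
    refine tendsto_nhds_unique hηlim.norm ?_
    simp_rw [fun k => (hη _ (heE k).1).2]
    exact tendsto_const_nhds
  refine ⟨e, h, fun k => (heE k).1, (tendsto_nhdsWithin_iff.1 he0).1, hρlim,
    tendsto_iff_norm_sub_tendsto_zero.1 hηlim, hhB, ?_, ?_⟩
  · rintro rfl
    simp at hh1
  have hPlim : Tendsto (fun k => perronFrobenius f hf (η (e k))) atTop
      (𝓝 (perronFrobenius f hf h)) := by
    refine tendsto_iff_norm_sub_tendsto_zero.2 (squeeze_zero (fun _ => norm_nonneg _) (fun k => ?_)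
      (tendsto_iff_norm_sub_tendsto_zero.1 hηlim))
    rw [← map_sub]
    exact norm_transferOp_le hns _
  have hdiff : Tendsto (fun k => ρ (e k) • η (e k) - perronFrobenius f hf (η (e k))) atTop
      (𝓝 0) := by
    refine squeeze_zero_norm (a := fun k => |d (e k)| * (A * V + B)) (fun k => ?_) ?_
    · obtain ⟨hEig, hnorm⟩ := hη _ (heE k).1
      obtain ⟨h1, h2⟩ := hAB _ hEig.1
      have h3 := hbv _ (heE k).1 (heE k).2 _ _ (hρ _ (heE k).1) hEig hnorm
      rw [← hEig.2.2]
      refine (hdle _ (heE k).1 _ h1).trans ?_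
      refine mul_le_mul (le_abs_self _) (h2.trans ?_) (bvar_nonneg _) (abs_nonneg _)
      rw [hnorm, mul_one]
      linarith [mul_le_mul_of_nonneg_left h3 hA]
    · have := ((hd.comp he0).abs).mul_const (A * V + B)
      simpa using this
  refine tendsto_nhds_unique hPlim ?_
  have := (hρlim.smul hηlim).sub hdiff
  simpa using this
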